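/- **Conventions.** A configuration is a locally finite family $u=(u_j)$ of real numbers (points may coincide and are counted with multiplicity; the family may be finite or countably infinite), and $\#_V(u)$ is the number of indices $j$ with $u_j\in V$. The space of configurations carries the $\sigma$-algebra generated by the events $\{\#_V=m\}$, with $V\subset\mathbb R$ a bounded Borel set and $m\in\mathbb Z_{\ge 0}$; a point process is a random configuration, and two point processes with the same law are identified. It is u.l.m. (has uniform local moments) if for every $n\ge 1$ there is $C_n<\infty$ with $\mathbb E[(\#_{[L,L+1]}(u))^n]\le C_n$ for all $L\in\mathbb R$. It is supported on $a\mathbb Z$ if almost surely all its points lie in $a\mathbb Z$. Write $\hat\eta(\xi)=\int_{\mathbb R^n}\eta(x)e^{-2\pi i x\cdot\xi}\,dx$. For $B\in\mathbb R$ and u.l.m. point processes $u,v$, the process $v$ mimics $u$ at bandwidth $[-B,B]$ if for every $n\ge1$ and every Schwartz function $\eta:\mathbb R^n\to\mathbb C$ with $\hat\eta$ supported in $[-B,B]^n$, $$\mathbb E\sum_{j_1,\dots,j_n\ \text{distinct}}\eta(u_{j_1},\dots,u_{j_n})=\mathbb E\sum_{j_1,\dots,j_n\ \text{distinct}}\eta(v_{j_1},\dots,v_{j_n}).$$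 Let $S(0)=1$ and $S(x)=\frac{\sin\pi x}{\pi x}$ for $x\ne0$. The sine process is the point process $z$ such that, for all $n\ge1$ and all continuous compactly supported $\phi:\mathbb R^n\to\mathbb C$, the sum below is integrable and $$\mathbb E\sum_{j_1,\dots,j_n\ \text{distinct}}\phi(z_{j_1},\dots,z_{j_n})=\int_{\mathbb R^n}\phi(x)\det_{n\times n}[S(x_i-x_j)]\,dx .$$ The discrete sine process on $a\mathbb Z$ is the point process $z^*$ supported on $a\mathbb Z$ such that, for all $n\ge1$ and all Schwartz functions $\phi:\mathbb R^n\to\mathbb C$, the sum below is integrable and $$\mathbb E\sum_{j_1,\dots,j_n\ \text{distinct}}\phi(z^*_{j_1},\dots,z^*_{j_n})=\sum_{k\in(a\mathbb Z)^n}a^n\det_{n\times n}[S(k_i-k_j)]\,\phi(k).$$ **Theorem (Sine process mimicry, general bandwidth).** 1. For all $0<a\le1$, a discrete sine process on $a\mathbb Z$ exists, and every point process with its defining property is u.l.m. and mimics the sine process at bandwidth $[-B,B]$ for every $B\le\frac{1-a}{a}$. In particular the sine process can then be mimicked at bandwidth $[-B,B]$ by a u.l.m. point process supported on $a\mathbb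 Z$. 2. For all $0<a\le\frac12$, if $B>\frac{1-a}{a}$, then the sine process cannot be mimicked at bandwidth $[-B,B]$ by a u.l.m. point process supported on $a\mathbb Z$. 3. If $a>\frac12$ and $B\ge\frac1{2a}$, then the sine process cannot be mimicked at bandwidth $[-B,B]$ by a u.l.m. point process supported on $a\mathbb Z$. In all three parts, "the sine process" means any point process with the defining property of the sine process. -/

import Mathlib

open MeasureTheory
open scoped FourierTransform ENNReal NNReal

namespace LatticeMimicry

/-- A locally finite point configuration on the real line, given by the multiplicity of each
point: points may coincide, and there are finitely many of them in each compact set. -/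
structure Configuration where
  mult : ℝ → ℕ
  locallyFinite : ∀ K : Set ℝ, IsCompact K → {x | x ∈ K ∧ mult x ≠ 0}.Finite

namespace Configuration

/-- The points of a configuration, labelled so that a position of multiplicity `m` carries `m`
different points: this type plays the role of the index set of the family `(u_j)`, and the first
component of an element is its position. -/
def Point (c : Configuration) : Type := Σ x : ℝ, Fin (c.mult x)

/-- The position of a point. -/
def Point.pos {c : Configuration} (p : c.Point) : ℝ := p.1

/-- The number of points of the configuration in `V`, counted with multiplicity. -/
noncomputable def count (c : Configuration) (V : Set ℝ) : ℕ∞ :=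
  Set.encard {p : c.Point | p.pos ∈ V}

/-- The sum of `φ (u_{j_1}, …, u_{j_n})` over all `n`-tuples of distinct indices. -/
noncomputable def distinctSum (c : Configuration) {n : ℕ}
    (φ : EuclideanSpace ℝ (Fin n) → ℂ) : ℂ :=
  ∑' s : Fin n ↪ c.Point, φ (WithLp.toLp 2 fun i => (s i).pos)

/-- The `σ`-algebra generated by the cylinder sets `{c | c.count V = m}`, for `V` a bounded Borel
set and `m` a non-negative integer. -/
instance : MeasurableSpace Configuration :=
  MeasurableSpace.generateFrom
    {A | ∃ (V : Set ℝ) (m : ℕ), MeasurableSet V ∧ Bornology.IsBounded V ∧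
      A = {c : Configuration | c.count V = m}}

end Configuration

/-- A point process on the real line, given by its law on the space of configurations. -/
abbrev PointProcess : Type := ProbabilityMeasure Configuration

/-- Uniform local moments: for each `n ≥ 1` the `n`-th moments of the numbers of points in the
intervals `[L, L + 1]` are bounded by a finite constant that does not depend on `L`. -/
def UniformLocalMoments (P : PointProcess) : Prop :=
  ∀ n : ℕ, 1 ≤ n → ∃ C : ℝ≥0, ∀ L : ℝ,
    ∫⁻ c, (c.count (Set.Icc L (L + 1)) : ℝ≥0∞) ^ n ∂(P : Measure Configuration) ≤ C

/-- The process is supported on the lattice `aℤ`. -/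
def SupportedOnLattice (a : ℝ) (P : PointProcess) : Prop :=
  ∀ᵐ c ∂(P : Measure Configuration), ∀ x : ℝ, c.mult x ≠ 0 → ∃ k : ℤ, x = a * k

/-- The process `Q` mimics the process `P` at the bandwidth `[-B, B]`. -/
def Mimics (Q P : PointProcess) (B : ℝ) : Prop :=
  UniformLocalMoments Q ∧ UniformLocalMoments P ∧
    ∀ n : ℕ, 1 ≤ n → ∀ η : SchwartzMap (EuclideanSpace ℝ (Fin n)) ℂ,
      (∀ ξ : EuclideanSpace ℝ (Fin n),
        𝓕 (η : EuclideanSpace ℝ (Fin n) → ℂ) ξ ≠ 0 → ∀ i, ξ i ∈ Set.Icc (-B) B) →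
      ∫ c, c.distinctSum η ∂(P : Measure Configuration) =
        ∫ c, c.distinctSum η ∂(Q : Measure Configuration)

/-- The process `P` is mimicked at the bandwidth `[-B, B]` by some point process with uniform
local moments supported on `aℤ`. -/
def IsMimickedOnLattice (P : PointProcess) (a B : ℝ) : Prop :=
  ∃ Q : PointProcess, UniformLocalMoments Q ∧ SupportedOnLattice a Q ∧ Mimics Q P B

/-- The determinant `det [S (x_i - x_j)]` of the sine kernel, where `S t = sin (π t) / (π t)` for
`t ≠ 0` and `S 0 = 1`. -/
noncomputable def sineDet {n : ℕ} (x : EuclideanSpace ℝ (Fin n)) : ℝ :=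
  (Matrix.of fun i j : Fin n => Real.sinc (Real.pi * (x i - x j))).det

/-- `P` is (the law of) the sine process: for each `n ≥ 1` its `n`-level correlation measure is
`det [S (x_i - x_j)] dx_1 ⋯ dx_n`. -/
def IsSineProcess (P : PointProcess) : Prop :=
  ∀ n : ℕ, 1 ≤ n → ∀ φ : EuclideanSpace ℝ (Fin n) → ℂ, Continuous φ → HasCompactSupport φ →
    Integrable (fun c : Configuration => c.distinctSum φ) (P : Measure Configuration) ∧
      ∫ c, c.distinctSum φ ∂(P : Measure Configuration) = ∫ x, φ x * (sineDet x : ℂ)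

/-- The vector `a k` of the lattice `(aℤ)ⁿ`, for `k ∈ ℤⁿ`. -/
noncomputable def latticePoint (a : ℝ) {n : ℕ} (k : Fin n → ℤ) : EuclideanSpace ℝ (Fin n) :=
  WithLp.toLp 2 fun i => a * (k i : ℝ)

/-- `Q` is (the law of) the discrete sine process on `aℤ`: it is supported on `aℤ`, and for each
`n ≥ 1` its `n`-level correlation measure has the mass `a ^ n det [S (k_i - k_j)]` at each
`k ∈ (aℤ)ⁿ`. -/
def IsDiscreteSineProcess (a : ℝ) (Q : PointProcess) : Prop :=
  SupportedOnLattice a Q ∧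
    ∀ n : ℕ, 1 ≤ n → ∀ φ : SchwartzMap (EuclideanSpace ℝ (Fin n)) ℂ,
      Integrable (fun c : Configuration => c.distinctSum φ) (Q : Measure Configuration) ∧
        ∫ c, c.distinctSum φ ∂(Q : Measure Configuration) =
          ∑' k : Fin n → ℤ,
            (a : ℂ) ^ n * (sineDet (latticePoint a k) : ℂ) * φ (latticePoint a k)

end LatticeMimicry

/-! The function S is the Fourier transform of the indicator of an interval of length 1. So each
term of the Leibniz expansion of det [S(x_i - x_j)] is the average over t in [0, 1)ⁿ of the
character of frequency (t_{σ⁻¹ i} - t_i)_i (`sineDet_eq_sum_integral`), and the sine process tested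
against η samples 𝓕 η, with signs, at these frequencies only (`integral_mul_sineDet`). All three
parts rest on this formula.

Part 1. Restricting η to aℤⁿ adds to 𝓕 η its translates by a⁻¹ℤⁿ (Poisson summation). The
frequencies above have coordinates of modulus at most 1, so a nonzero translate is sampled where
some coordinate has modulus at least 1/a - 1 ≥ B, and there 𝓕 η vanishes
(`tsum_lattice_mul_sineDet`). The discrete process exists because for a ≤ 1 the finite sections of
its kernel lie between 0 and 1: they are integrals of rank-one-type positive forms over [-a/2, a/2],
a subinterval of [-1/2, 1/2], which itself gives the identity. On a finite window the determinantal
law is written down explicitly, and compactness of the probability measures on {0, 1}^ℤ yields the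
law on ℤ (`exists_determinantal_measure`).

Part 2. Two test functions of two variables whose Fourier transforms differ by a translation by
(1/a, 0) agree on aℤ². If B > 1/a - 1, both can fit in the band while the sine process tells them
apart: the transposition contributes to one of them, and nothing contributes to the other.

Part 3. Take 𝓕 η to be the tensor power ψ ⊗ ⋯ ⊗ ψ, where ψ lives on [-1/(2a), 1/(2a)] and its
inverse transform is nonnegative on aℤ. A process on aℤ then gives a nonnegative mean, while the
sine process gives the integral of det [ψ(t_i - t_j)] over the cube. These are the Fredholm
coefficients of the convolution kernel ψ(s - t) on [0, 1]; if all are nonnegative, the Fredholm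
determinant has no zero on the positive axis, the operator has no negative eigenvalue, and ψ is
positive definite on the unit interval (`sum_mul_kernel_nonneg`). For a > 1/2 there is such a ψ
violating this (`exists_resonant_kernel`). -/

namespace LatticeMimicry

/-! ### Determinantal probabilities on a finite set. -/

section MixedDeterminants

open Matrix

variable {ι : Type*} [Fintype ι] [DecidableEq ι]

/-- The matrix with the rows of `M` on `s` and those of `N` elsewhere. -/
def rowMix {R : Type*} (s : Finset ι) (M N : Matrix ι ι R) : Matrix ι ι R :=
  Matrix.of fun i j => if i ∈ s then M i j else N i j

lemma det_rowMix_one {R : Type*} [CommRing R] (M : Matrix ι ι R) (s : Finset ι) :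
    (rowMix s M 1).det = (M.submatrix (Subtype.val : s → ι) Subtype.val).det := by
  rw [Matrix.twoBlockTriangular_det _ (fun i => i ∈ s)]
  · have h1 : (toSquareBlockProp (rowMix s M 1) fun i => i ∈ s) =
        M.submatrix (Subtype.val : s → ι) Subtype.val := by
      ext i j
      simp [toSquareBlockProp_def, rowMix]
    have h2 : (toSquareBlockProp (rowMix s M 1) fun i => ¬ i ∈ s) = 1 := by
      ext i j
      simp [toSquareBlockProp_def, rowMix, i.2, Matrix.one_apply, Subtype.ext_iff]
    rw [h1, h2, det_one, mul_one]
    congr!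
  · intro i hi j hj
    have : i ≠ j := fun h => hi (h ▸ hj)
    simp [rowMix, hi, this]

lemma det_rowMix_add {R : Type*} [CommRing R] (M N : Matrix ι ι R) (t : Finset ι) :
    (rowMix t (M + N) N).det = ∑ s ∈ t.powerset, (rowMix s M N).det := by
  have h := (Matrix.detRowAlternating (n := ι) (R := R)).toMultilinearMap.map_piecewise_add M N t
  have e : ∀ (s : Finset ι) (M N : ι → ι → R), (rowMix s (Matrix.of M) (Matrix.of N)).det =
      (Matrix.detRowAlternating (n := ι) (R := R)).toMultilinearMap (s.piecewise M N) := by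
    intro s M N
    change Matrix.det _ = Matrix.det _
    congr 1
    funext i j
    by_cases hi : i ∈ s <;> simp [rowMix, hi]
  exact (e t (M + N) N).trans (h.trans (Finset.sum_congr rfl fun s _ => (e s M N).symm))

/-- The determinant of the matrix with the rows of `K` on `s` and those of `1 - K` elsewhere: the
probability that the determinantal process with kernel `K` equals `s`. -/
noncomputable def mixedDet (K : Matrix ι ι ℝ) (s : Finset ι) : ℝ :=
  (rowMix s K (1 - K)).det

/-- K and 1 - K commute, so K(1 - K) = K(1 - K)K + (1 - K)K(1 - K), a sum of two congruences of
positive semidefinite matrices. -/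
lemma posSemidef_mul_one_sub {K : Matrix ι ι ℝ} (hK : K.PosSemidef) (hK1 : (1 - K).PosSemidef) :
    (K * (1 - K)).PosSemidef := by
  have e : K * (1 - K) = Kᴴ * (1 - K) * K + (1 - K)ᴴ * K * (1 - K) := by
    rw [hK.1.eq, hK1.1.eq]
    noncomm_ring
  rw [e]
  exact (hK1.conjTranspose_mul_mul_same K).add (hK.conjTranspose_mul_mul_same (1 - K))

/-- The L-ensemble form of the process: with L = K(1 - K)⁻¹, factoring 1 - K out on the right turns
the rows of K into rows of L and those of 1 - K into rows of the identity. Thus the mixed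
determinant is det(L_s) det(1 - K), and L is positive semidefinite. -/
lemma mixedDet_nonneg_of_posDef {K : Matrix ι ι ℝ} (hK : K.PosSemidef) (hK1 : (1 - K).PosDef)
    (s : Finset ι) : 0 ≤ mixedDet K s := by
  set R : Matrix ι ι ℝ := (1 - K)⁻¹ with hR
  have hdet : IsUnit (1 - K).det := hK1.det_pos.ne'.isUnit
  have hRK : R * (1 - K) = 1 := Matrix.nonsing_inv_mul _ hdet
  have hKR : (1 - K) * R = 1 := Matrix.mul_nonsing_inv _ hdet
  have hRp : R.PosDef := hK1.inv
  have hcomm : K * R = R * K := by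
    have h1 : R * ((1 - K) * K) * R = R * (K * (1 - K)) * R := by
      congr 2; noncomm_ring
    calc K * R = R * ((1 - K) * K) * R := by rw [← mul_assoc R, hRK, one_mul]
      _ = R * (K * (1 - K)) * R := h1
      _ = R * K := by rw [mul_assoc, mul_assoc, hKR, mul_one]
  have hL : (K * R).PosSemidef := by
    have e : K * R = Rᴴ * (K * (1 - K)) * R := by
      rw [hRp.1.eq, hcomm, mul_assoc, mul_assoc, hKR, mul_one]
    rw [e]
    exact (posSemidef_mul_one_sub hK hK1.posSemidef).conjTranspose_mul_mul_same R
  have e : rowMix s K (1 - K) = rowMix s (K * R) 1 * (1 - K) := by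
    have h1 : K * R * (1 - K) = K := by rw [mul_assoc, hRK, mul_one]
    ext i j
    by_cases hi : i ∈ s
    · have := congrFun (congrFun h1 i) j
      simp only [rowMix, hi, if_true, Matrix.of_apply]
      rw [← this, Matrix.mul_apply, Matrix.mul_apply]
      simp [hi]
    · have := congrFun (congrFun (one_mul (1 - K)) i) j
      simp only [rowMix, hi, if_false, Matrix.of_apply]
      rw [← this, Matrix.mul_apply, Matrix.mul_apply]
      simp [hi]
  unfold mixedDet
  rw [e, det_mul, det_rowMix_one]
  exact mul_nonneg (hL.submatrix _).det_nonneg hK1.det_pos.le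

/-- When 1 - K is singular, replace K by (1 - e)K and let e tend to 0 from above. -/
lemma mixedDet_nonneg {K : Matrix ι ι ℝ} (hK : K.PosSemidef) (hK1 : (1 - K).PosSemidef)
    (s : Finset ι) : 0 ≤ mixedDet K s := by
  have hc : Continuous fun e : ℝ => mixedDet ((1 - e) • K) s := by
    unfold mixedDet
    refine Continuous.matrix_det ?_
    refine continuous_pi fun i => continuous_pi fun j => ?_
    by_cases hi : i ∈ s
    · simp only [rowMix, hi, if_true, Matrix.smul_apply, Matrix.of_apply]
      fun_prop
    · simp only [rowMix, hi, if_false, Matrix.smul_apply, Matrix.sub_apply, Matrix.of_apply]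
      fun_prop
  have ht := (hc.tendsto 0).mono_left (nhdsWithin_le_nhds (s := Set.Ioi 0))
  simp only [sub_zero, one_smul] at ht
  refine ge_of_tendsto ht ?_
  filter_upwards [Ioo_mem_nhdsGT (zero_lt_one' ℝ)] with e he
  refine mixedDet_nonneg_of_posDef (hK.smul (by linarith [he.2])) ?_ s
  have : 1 - (1 - e) • K = (1 - e) • (1 - K) + e • (1 : Matrix ι ι ℝ) := by
    module
  rw [this]
  exact Matrix.PosDef.posSemidef_add (hK1.smul (by linarith [he.2])) (PosDef.one.smul he.1)

/-- By multilinearity, summing over both choices K and 1 - K for each row outside A gives the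
identity there, which leaves the principal minor of K on A. The case of empty A says that the
probabilities sum to 1. -/
lemma sum_mixedDet_superset (K : Matrix ι ι ℝ) (A : Finset ι) :
    ∑ s : Finset ι with A ⊆ s, mixedDet K s =
      (K.submatrix (Subtype.val : A → ι) Subtype.val).det := by
  have h1 : rowMix Aᶜ (K + rowMix A K (1 - K)) (rowMix A K (1 - K)) = rowMix A K 1 := by
    ext i j
    by_cases hi : i ∈ A
    · simp [rowMix, hi]
    · simp [rowMix, hi]
  rw [← det_rowMix_one, ← h1, det_rowMix_add]
  refine Finset.sum_bij' (fun s _ => s \ A) (fun s _ => s ∪ A) ?_ ?_ ?_ ?_ ?_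
  · intro s hs
    simp only [Finset.mem_powerset]
    intro x hx
    simp at hx ⊢
    exact hx.2
  · intro s hs
    simp
  · intro s hs
    simp at hs
    simp [hs]
  · intro s hs
    ext x
    have : x ∈ s → x ∈ Aᶜ := fun h => Finset.mem_powerset.1 hs h
    simp at this ⊢
    tauto
  · intro s hs
    simp at hs
    unfold mixedDet
    congr 1
    ext i j
    by_cases hi : i ∈ A
    · simp [rowMix, hi, hs hi]
    · by_cases his : i ∈ s <;> simp [rowMix, hi, his]

/-- The expansion of `det (1 + z M)` in principal minors. -/
lemma det_one_add_smul_eq_sum (M : Matrix ι ι ℝ) (z : ℝ) :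
    (1 + z • M).det = ∑ s : Finset ι,
      z ^ s.card * (M.submatrix (Subtype.val : s → ι) Subtype.val).det := by
  have h := det_rowMix_add (z • M) (1 : Matrix ι ι ℝ) Finset.univ
  have e : rowMix Finset.univ (z • M + 1) (1 : Matrix ι ι ℝ) = 1 + z • M := by
    rw [add_comm]
    ext i j
    simp [rowMix]
  rw [e, Finset.powerset_univ] at h
  refine h.trans (Finset.sum_congr rfl fun s _ => ?_)
  rw [det_rowMix_one]
  have : (z • M).submatrix (Subtype.val : s → ι) (Subtype.val : s → ι) =
    z • M.submatrix (Subtype.val : s → ι) (Subtype.val : s → ι) := rfl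
  rw [this, det_smul, Fintype.card_coe]

end MixedDeterminants

end LatticeMimicry

namespace LatticeMimicry

/-! ### Determinantal measures on the integers, by compactness. -/

section DeterminantalMeasure

open Matrix Filter Topology

/-- The configuration of occupied sites given by a set `s` of sites in the window `Λ`. -/
def windowOccupation {Λ : Finset ℤ} (s : Finset Λ) : ℤ → Bool :=
  fun i => decide (∃ h : i ∈ Λ, (⟨i, h⟩ : Λ) ∈ s)

/-- The event that all sites in `A` are occupied. -/
def occupied (A : Finset ℤ) : Set (ℤ → Bool) := {ω | ∀ i ∈ A, ω i = true}

/-- A clopen set has empty frontier, so its measure passes to weak limits. -/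
lemma isClopen_occupied (A : Finset ℤ) : IsClopen (occupied A) := by
  have : occupied A = ⋂ i ∈ A, (fun ω : ℤ → Bool => ω i) ⁻¹' {true} := by
    ext; simp [occupied]
  rw [this]
  refine isClopen_biInter_finset fun i _ => ?_
  exact (isClopen_discrete _).preimage (continuous_apply i)

lemma measurableSet_occupied (A : Finset ℤ) : MeasurableSet (occupied A) :=
  (isClopen_occupied A).isOpen.measurableSet

/-- The law of the determinantal process with kernel `K` in the window `Λ`. -/
noncomputable def windowMeasure (K : Matrix ℤ ℤ ℝ) (Λ : Finset ℤ) : Measure (ℤ → Bool) :=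
  ∑ s : Finset Λ, ENNReal.ofReal
    (mixedDet (K.submatrix (Subtype.val : Λ → ℤ) (Subtype.val : Λ → ℤ)) s) •
      Measure.dirac (windowOccupation s)

/-- The value does not depend on the window once it contains A; hence it survives the limit over
growing windows. -/
lemma windowMeasure_occupied {K : Matrix ℤ ℤ ℝ} {Λ A : Finset ℤ} (hA : A ⊆ Λ)
    (h0 : (K.submatrix (Subtype.val : Λ → ℤ) (Subtype.val : Λ → ℤ)).PosSemidef)
    (h1 : (1 - K.submatrix (Subtype.val : Λ → ℤ) (Subtype.val : Λ → ℤ)).PosSemidef) :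
    windowMeasure K Λ (occupied A) =
      ENNReal.ofReal (K.submatrix (Subtype.val : A → ℤ) (Subtype.val : A → ℤ)).det := by
  set KΛ := K.submatrix (Subtype.val : Λ → ℤ) (Subtype.val : Λ → ℤ) with hKΛ
  set A' : Finset Λ := A.subtype (· ∈ Λ) with hA'
  have hmem : ∀ s : Finset Λ, windowOccupation s ∈ occupied A ↔ A' ⊆ s := by
    intro s
    constructor
    · intro h i hi
      have := h i.1 (by simpa [hA'] using hi)
      simp [windowOccupation] at this
      exact this
    · intro h i hi
      simp only [windowOccupation, decide_eq_true_eq]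
      exact ⟨hA hi, h (by simpa [hA'] using hi)⟩
  have e1 : windowMeasure K Λ (occupied A) =
      ∑ s : Finset Λ with A' ⊆ s, ENNReal.ofReal (mixedDet KΛ s) := by
    rw [windowMeasure, Measure.finsetSum_apply, Finset.sum_filter]
    refine Finset.sum_congr rfl fun s _ => ?_
    rw [Measure.smul_apply, Measure.dirac_apply' _ (measurableSet_occupied A)]
    by_cases hs : A' ⊆ s
    · simp [hs, Set.indicator, hmem, hKΛ]
    · simp [hs, Set.indicator, hmem]
  rw [e1, ← ENNReal.ofReal_sum_of_nonneg fun s _ => mixedDet_nonneg h0 h1 s,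
    sum_mixedDet_superset]
  congr 1
  let e : A' ≃ A :=
    { toFun := fun i => ⟨i.1.1, Finset.mem_subtype.1 i.2⟩
      invFun := fun i => ⟨⟨i.1, hA i.2⟩, Finset.mem_subtype.2 i.2⟩
      left_inv := fun i => rfl
      right_inv := fun i => rfl }
  rw [← Matrix.det_submatrix_equiv_self e]
  rfl

/-- A kernel on `ℤ` whose finite sections are contractions between `0` and `1` is the kernel of a
determinantal process. -/
theorem exists_determinantal_measure (K : Matrix ℤ ℤ ℝ)
    (h0 : ∀ Λ : Finset ℤ, (K.submatrix (Subtype.val : Λ → ℤ) (Subtype.val : Λ → ℤ)).PosSemidef)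
    (h1 : ∀ Λ : Finset ℤ,
      (1 - K.submatrix (Subtype.val : Λ → ℤ) (Subtype.val : Λ → ℤ)).PosSemidef) :
    ∃ μ : ProbabilityMeasure (ℤ → Bool), ∀ A : Finset ℤ,
      (μ : Measure (ℤ → Bool)) (occupied A) =
        ENNReal.ofReal (K.submatrix (Subtype.val : A → ℤ) (Subtype.val : A → ℤ)).det := by
  have hp : ∀ Λ, IsProbabilityMeasure (windowMeasure K Λ) := by
    intro Λ
    constructor
    have := windowMeasure_occupied (A := ∅) (by simp) (h0 Λ) (h1 Λ)
    simpa [occupied] using this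
  let ν : Finset ℤ → ProbabilityMeasure (ℤ → Bool) := fun Λ => ⟨windowMeasure K Λ, hp Λ⟩
  -- The space of probability measures on ℤ → Bool is compact, so the window laws converge along any
  -- ultrafilter; one finer than `atTop` makes every fixed A eventually contained in the window.
  let U : Ultrafilter (Finset ℤ) := Ultrafilter.of atTop
  have hU : (U : Filter (Finset ℤ)) ≤ atTop := Ultrafilter.of_le _
  obtain ⟨μ, hμ⟩ : ∃ μ, Tendsto ν U (𝓝 μ) := ⟨(U.map ν).lim, (U.map ν).le_nhds_lim⟩
  refine ⟨μ, fun A => ?_⟩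
  have ht := ProbabilityMeasure.tendsto_measure_of_null_frontier_of_tendsto' hμ (E := occupied A)
    (by simp [(isClopen_occupied A).frontier_eq])
  refine tendsto_nhds_unique ht (tendsto_const_nhds.congr' ?_)
  filter_upwards [hU (eventually_ge_atTop A)] with Λ hΛ
  exact (windowMeasure_occupied hΛ (h0 Λ) (h1 Λ)).symm

end DeterminantalMeasure

end LatticeMimicry

namespace LatticeMimicry

/-! ### The discrete sine kernel lies between 0 and 1. -/

section SineKernel

open Matrix

lemma integral_cos_two_pi_mul (x c : ℝ) :
    ∫ t in (-c)..c, Real.cos (2 * Real.pi * x * t) = 2 * c * Real.sinc (2 * Real.pi * x * c) := by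
  rcases eq_or_ne x 0 with rfl | hx
  · simp; ring
  rcases eq_or_ne c 0 with rfl | hc
  · simp
  have h : 2 * Real.pi * x ≠ 0 := by positivity
  rw [intervalIntegral.integral_comp_mul_left (fun u => Real.cos u) h, integral_cos,
    Real.sinc_of_ne_zero (by positivity), mul_neg, Real.sin_neg]
  simp only [smul_eq_mul]
  field_simp
  ring

/-- The kernel of the discrete sine process on `aℤ`. -/
noncomputable def latticeSineKernel (a : ℝ) : Matrix ℤ ℤ ℝ :=
  Matrix.of fun k l => a * Real.sinc (Real.pi * (a * k - a * l))

lemma latticeSineKernel_apply (a : ℝ) (k l : ℤ) :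
    latticeSineKernel a k l =
      ∫ t in (-(a / 2))..(a / 2), Real.cos (2 * Real.pi * ((k : ℝ) - l) * t) := by
  rw [integral_cos_two_pi_mul, latticeSineKernel, of_apply]
  congr 1
  · ring
  · congr 1; ring

/-- The case a = 1 of the sine kernel: sin vanishes at nonzero integer multiples of π. Writing the
identity and the kernel as integrals of one integrand over nested intervals makes them comparable.
-/
lemma one_apply_eq_integral_cos (k l : ℤ) :
    (1 : Matrix ℤ ℤ ℝ) k l =
      ∫ t in (-(1 / 2 : ℝ))..(1 / 2), Real.cos (2 * Real.pi * ((k : ℝ) - l) * t) := by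
  rw [integral_cos_two_pi_mul]
  rcases eq_or_ne k l with rfl | h
  · simp
  · rw [one_apply_ne h, Real.sinc_of_ne_zero]
    · have : 2 * Real.pi * ((k : ℝ) - l) * (1 / 2) = ((k - l : ℤ) : ℝ) * Real.pi := by
        push_cast; ring
      rw [this, Real.sin_int_mul_pi]; simp
    · have : (k : ℝ) - l ≠ 0 := sub_ne_zero.2 (by exact_mod_cast h)
      positivity

/-- The double sum is the squared modulus of ∑ v_i exp(2πi x_i t). -/
lemma sum_mul_cos_sub_nonneg {ι : Type*} [Fintype ι] (v x : ι → ℝ) (t : ℝ) :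
    0 ≤ ∑ i, ∑ j, v i * v j * Real.cos (2 * Real.pi * (x i - x j) * t) := by
  have : ∑ i, ∑ j, v i * v j * Real.cos (2 * Real.pi * (x i - x j) * t) =
      (∑ i, v i * Real.cos (2 * Real.pi * x i * t)) ^ 2 +
        (∑ i, v i * Real.sin (2 * Real.pi * x i * t)) ^ 2 := by
    rw [sq, sq, Finset.sum_mul_sum, Finset.sum_mul_sum, ← Finset.sum_add_distrib]
    refine Finset.sum_congr rfl fun i _ => ?_
    rw [← Finset.sum_add_distrib]
    refine Finset.sum_congr rfl fun j _ => ?_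
    rw [show 2 * Real.pi * (x i - x j) * t = 2 * Real.pi * x i * t - 2 * Real.pi * x j * t by ring,
      Real.cos_sub]
    ring
  rw [this]
  positivity

lemma quadratic_integral_cos {ι : Type*} [Fintype ι] (v x : ι → ℝ) (c : ℝ) :
    ∑ i, ∑ j, v i * v j * ∫ t in (-c)..c, Real.cos (2 * Real.pi * (x i - x j) * t) =
      ∫ t in (-c)..c, ∑ i, ∑ j, v i * v j * Real.cos (2 * Real.pi * (x i - x j) * t) := by
  rw [intervalIntegral.integral_finsetSum]
  · refine Finset.sum_congr rfl fun i _ => ?_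
    rw [intervalIntegral.integral_finsetSum]
    · simp
    · intro j _
      exact (by fun_prop : Continuous _).intervalIntegrable _ _
  · intro j _
    exact (by fun_prop : Continuous _).intervalIntegrable _ _

lemma dotProduct_mulVec_eq_sum {ι : Type*} [Fintype ι] (M : Matrix ι ι ℝ) (v : ι → ℝ) :
    star v ⬝ᵥ (M *ᵥ v) = ∑ i, ∑ j, v i * v j * M i j := by
  simp only [dotProduct, mulVec, Finset.mul_sum, star_trivial]
  exact Finset.sum_congr rfl fun i _ => Finset.sum_congr rfl fun j _ => by ring

lemma latticeSineKernel_isHermitian (a : ℝ) : (latticeSineKernel a).IsHermitian := by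
  ext k l
  simp only [latticeSineKernel, conjTranspose_apply, of_apply, star_trivial]
  rw [← Real.sinc_neg]
  congr 2; ring

lemma latticeSineKernel_posSemidef {a : ℝ} (ha : 0 ≤ a) (Λ : Finset ℤ) :
    ((latticeSineKernel a).submatrix (Subtype.val : Λ → ℤ) (Subtype.val : Λ → ℤ)).PosSemidef := by
  refine PosSemidef.of_dotProduct_mulVec_nonneg ((latticeSineKernel_isHermitian a).submatrix _)
    fun v => ?_
  rw [dotProduct_mulVec_eq_sum]
  simp only [submatrix_apply, latticeSineKernel_apply]
  rw [quadratic_integral_cos v (fun i : Λ => ((i : ℤ) : ℝ)) (a / 2)]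
  exact intervalIntegral.integral_nonneg (by linarith) fun t _ => sum_mul_cos_sub_nonneg _ _ _

/-- Both quadratic forms integrate the same nonnegative function, and [-a/2, a/2] ⊆ [-1/2, 1/2];
this is where a ≤ 1 is needed. -/
lemma one_sub_latticeSineKernel_posSemidef {a : ℝ} (ha : 0 ≤ a) (ha1 : a ≤ 1) (Λ : Finset ℤ) :
    (1 - (latticeSineKernel a).submatrix (Subtype.val : Λ → ℤ)
      (Subtype.val : Λ → ℤ)).PosSemidef := by
  refine PosSemidef.of_dotProduct_mulVec_nonneg
    (isHermitian_one.sub ((latticeSineKernel_isHermitian a).submatrix _)) fun v => ?_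
  rw [sub_mulVec, dotProduct_sub, sub_nonneg, dotProduct_mulVec_eq_sum, dotProduct_mulVec_eq_sum]
  have e : ∀ i j : Λ, (1 : Matrix Λ Λ ℝ) i j = (1 : Matrix ℤ ℤ ℝ) i j := by
    intro i j
    rw [one_apply, one_apply]
    exact if_congr Subtype.ext_iff rfl rfl
  simp only [submatrix_apply, latticeSineKernel_apply, e, one_apply_eq_integral_cos]
  rw [quadratic_integral_cos v (fun i : Λ => ((i : ℤ) : ℝ)) (a / 2),
    quadratic_integral_cos v (fun i : Λ => ((i : ℤ) : ℝ)) (1 / 2)]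
  refine intervalIntegral.integral_mono_interval (by linarith) (by linarith) (by linarith) ?_ ?_
  · exact Filter.Eventually.of_forall fun t => sum_mul_cos_sub_nonneg _ _ _
  · exact (by fun_prop : Continuous _).intervalIntegrable _ _

end SineKernel

end LatticeMimicry

namespace LatticeMimicry

/-! ### Configurations, counts and a criterion for uniform local moments. -/

section Configurations

namespace Configuration

lemma measurableSet_count_eq {V : Set ℝ} (hV : MeasurableSet V) (hb : Bornology.IsBounded V)
    (m : ℕ) : MeasurableSet {c : Configuration | c.count V = m} :=
  MeasurableSpace.measurableSet_generateFrom ⟨V, m, hV, hb, rfl⟩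

/-- The `i`-th point at the position `x`. -/
def pointAt (c : Configuration) (x : ℝ) (i : Fin (c.mult x)) : c.Point := ⟨x, i⟩

lemma pointAt_injective (c : Configuration) (x : ℝ) : Function.Injective (c.pointAt x) :=
  fun _ _ h => eq_of_heq (Sigma.mk.inj h).2

lemma count_singleton (c : Configuration) (x : ℝ) : c.count {x} = c.mult x := by
  have e : {p : c.Point | p.pos ∈ ({x} : Set ℝ)} = Set.range (c.pointAt x) := by
    ext ⟨y, i⟩
    constructor
    · rintro (rfl : y = x)
      exact ⟨i, rfl⟩
    · rintro ⟨j, hj⟩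
      exact (congrArg Sigma.fst hj).symm
  rw [count, e, ← Set.image_univ, (c.pointAt_injective x).encard_image, Set.encard_univ]
  simp

lemma count_eq_zero_iff (c : Configuration) (V : Set ℝ) :
    c.count V = 0 ↔ ∀ x ∈ V, c.mult x = 0 := by
  rw [count, Set.encard_eq_zero, Set.eq_empty_iff_forall_notMem]
  constructor
  · intro h x hx
    by_contra h0
    exact h ⟨x, ⟨0, Nat.pos_of_ne_zero h0⟩⟩ hx
  · rintro h ⟨x, i⟩ hx
    have := h x hx
    exact absurd i.2 (by simp [this])

lemma measurable_mult (x : ℝ) : Measurable fun c : Configuration => c.mult x := by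
  refine measurable_to_countable' fun m => ?_
  have := measurableSet_count_eq (measurableSet_singleton x) Bornology.isBounded_singleton m
  simp only [count_singleton] at this
  convert this using 1
  ext c
  simp

lemma finite_point_mem (c : Configuration) {V : Set ℝ} (hV : Bornology.IsBounded V) :
    {p : c.Point | p.pos ∈ V}.Finite := by
  have hK : IsCompact (closure V) := hV.isCompact_closure
  have hf := c.locallyFinite _ hK
  refine (hf.biUnion fun x _ => Set.finite_range (c.pointAt x)).subset ?_
  rintro ⟨x, i⟩ hx
  have h0 : c.mult x ≠ 0 := fun h => absurd i.2 (by simp [h])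
  exact Set.mem_biUnion (x := x) ⟨subset_closure hx, h0⟩ ⟨i, rfl⟩

/-- The vector of positions of a tuple of distinct points. -/
def positions (c : Configuration) {n : ℕ} (s : Fin n ↪ c.Point) : EuclideanSpace ℝ (Fin n) :=
  WithLp.toLp 2 fun i => (s i).pos

lemma distinctSum_eq (c : Configuration) {n : ℕ} (φ : EuclideanSpace ℝ (Fin n) → ℂ) :
    c.distinctSum φ = ∑' s : Fin n ↪ c.Point, φ (c.positions s) := rfl

lemma finite_positions_mem (c : Configuration) {n : ℕ} {K : Set (EuclideanSpace ℝ (Fin n))}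
    (hK : Bornology.IsBounded K) : {s : Fin n ↪ c.Point | c.positions s ∈ K}.Finite := by
  have hV : ∀ i : Fin n, Bornology.IsBounded ((fun x : EuclideanSpace ℝ (Fin n) => x i) '' K) := by
    intro i
    exact ((EuclideanSpace.proj i :
      EuclideanSpace ℝ (Fin n) →L[ℝ] ℝ)).lipschitz.isBounded_image hK
  have : {s : Fin n ↪ c.Point | c.positions s ∈ K} ⊆
      (fun s : Fin n ↪ c.Point => (s : Fin n → c.Point)) ⁻¹' (Set.univ.pi fun i =>
        {p : c.Point | p.pos ∈ (fun x : EuclideanSpace ℝ (Fin n) => x i) '' K}) := by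
    intro s hs i _
    exact ⟨_, hs, rfl⟩
  exact ((Set.Finite.pi' fun i => c.finite_point_mem (hV i)).preimage
    (DFunLike.coe_injective.injOn)).subset (by
      intro s hs
      exact fun i => this hs i trivial)

lemma finite_support_positions (c : Configuration) {n : ℕ} {E : Type*} [Zero E]
    {φ : EuclideanSpace ℝ (Fin n) → E}
    (hφ : HasCompactSupport φ) : (Function.support fun s : Fin n ↪ c.Point =>
      φ (c.positions s)).Finite :=
  (c.finite_positions_mem hφ.isCompact.isBounded).subset fun _ hs => subset_tsupport _ hs

/-- The embeddings of `Fin n` in the set of points in a bounded set are counted by a descending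
factorial. -/
lemma card_embedding_count (c : Configuration) {V : Set ℝ} (hV : Bornology.IsBounded V) (n : ℕ) :
    ∃ m : ℕ, c.count V = m ∧ ∃ T : Finset (Fin n ↪ c.Point), T.card = m.descFactorial n ∧
      ∀ s ∈ T, ∀ i, (s i).pos ∈ V := by
  classical
  have hf := c.finite_point_mem hV
  have : Fintype {p : c.Point | p.pos ∈ V} := hf.fintype
  refine ⟨Fintype.card {p : c.Point | p.pos ∈ V}, ?_, ?_⟩
  · rw [count, Set.encard_eq_coe_toFinset_card, Set.toFinset_card]
  · refine ⟨Finset.univ.map ⟨fun s : Fin n ↪ {p : c.Point | p.pos ∈ V} =>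
      s.trans (Function.Embedding.subtype _), ?_⟩, ?_, ?_⟩
    · intro s t h
      ext i
      exact congrArg (fun u : Fin n ↪ c.Point => u i) h
    · rw [Finset.card_map, Finset.card_univ, Fintype.card_embedding_eq, Fintype.card_fin]
    · intro s hs i
      obtain ⟨t, -, rfl⟩ := Finset.mem_map.1 hs
      exact (t i).2

end Configuration

/-- If m ≥ 2n, every factor of the descending factorial is at least m/2. This bounds moments by
factorial moments, which are what the correlation formulas control. -/
lemma pow_le_add_descFactorial (m n : ℕ) :
    m ^ n ≤ (2 * n) ^ n + 2 ^ n * m.descFactorial n := by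
  rcases le_total m (2 * n) with h | h
  · exact (Nat.pow_le_pow_left h n).trans (Nat.le_add_right _ _)
  · have h1 : (m + 1 - n) ^ n ≤ m.descFactorial n := Nat.pow_sub_le_descFactorial m n
    have h2 : m ≤ 2 * (m + 1 - n) := by omega
    calc m ^ n ≤ (2 * (m + 1 - n)) ^ n := Nat.pow_le_pow_left h2 n
      _ = 2 ^ n * (m + 1 - n) ^ n := mul_pow _ _ _
      _ ≤ 2 ^ n * m.descFactorial n := Nat.mul_le_mul_left _ h1
      _ ≤ _ := Nat.le_add_left _ _

/-- A criterion for uniform local moments in terms of test functions that dominate the indicator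
functions of unit cubes. -/
lemma uniformLocalMoments_of_bump (P : PointProcess)
    (h : ∀ n : ℕ, 1 ≤ n → ∃ C : ℝ, ∀ L : ℝ, ∃ φ : EuclideanSpace ℝ (Fin n) → ℝ,
      HasCompactSupport φ ∧ (∀ x, 0 ≤ φ x) ∧ (∀ x, (∀ i, x i ∈ Set.Icc L (L + 1)) → 1 ≤ φ x) ∧
      Integrable (fun c : Configuration => c.distinctSum fun x => (φ x : ℂ))
        (P : Measure Configuration) ∧
      ‖∫ c, c.distinctSum (fun x => (φ x : ℂ)) ∂(P : Measure Configuration)‖ ≤ C) :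
    UniformLocalMoments P := by
  intro n hn
  obtain ⟨C, hC⟩ := h n hn
  refine ⟨(2 * n) ^ n + 2 ^ n * C.toNNReal, fun L => ?_⟩
  obtain ⟨φ, hφc, hφ0, hφ1, hint, hle⟩ := hC L
  have hreal : ∀ c : Configuration, c.distinctSum (fun x => (φ x : ℂ)) =
      ((∑' s : Fin n ↪ c.Point, φ (c.positions s) : ℝ) : ℂ) := by
    intro c
    rw [Configuration.distinctSum_eq, Complex.ofReal_tsum]
  have hbound : ∀ c : Configuration, (c.count (Set.Icc L (L + 1)) : ℝ≥0∞) ^ n ≤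
      (2 * n) ^ n + 2 ^ n * ENNReal.ofReal (∑' s : Fin n ↪ c.Point, φ (c.positions s)) := by
    intro c
    obtain ⟨m, hm, T, hT, hTV⟩ := c.card_embedding_count (Metric.isBounded_Icc L (L + 1)) n
    have h1 : (m.descFactorial n : ℝ) ≤ ∑' s : Fin n ↪ c.Point, φ (c.positions s) := by
      have hs : Summable fun s : Fin n ↪ c.Point => φ (c.positions s) :=
        summable_of_hasFiniteSupport (c.finite_support_positions hφc)
      calc (m.descFactorial n : ℝ) = ∑ s ∈ T, (1 : ℝ) := by simp [hT]
        _ ≤ ∑ s ∈ T, φ (c.positions s) :=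
          Finset.sum_le_sum fun s hs => hφ1 _ (hTV s hs)
        _ ≤ _ := hs.sum_le_tsum T fun _ _ => hφ0 _
    have h2 : (m.descFactorial n : ℝ≥0∞) ≤
        ENNReal.ofReal (∑' s : Fin n ↪ c.Point, φ (c.positions s)) := by
      rw [← ENNReal.ofReal_natCast]
      exact ENNReal.ofReal_le_ofReal h1
    rw [hm]
    have h3 : ((m : ℝ≥0∞)) ^ n ≤ (2 * n) ^ n + 2 ^ n * (m.descFactorial n : ℝ≥0∞) := by
      exact_mod_cast pow_le_add_descFactorial m n
    calc (((m : ℕ∞) : ℝ≥0∞)) ^ n = (m : ℝ≥0∞) ^ n := by simp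
      _ ≤ _ := h3.trans (by gcongr)
  have hI : ∫⁻ c, ENNReal.ofReal (∑' s : Fin n ↪ Configuration.Point c, φ (c.positions s))
      ∂(P : Measure Configuration) ≤ ENNReal.ofReal C := by
    have hint' : Integrable (fun c : Configuration =>
        ∑' s : Fin n ↪ Configuration.Point c, φ (c.positions s)) (P : Measure Configuration) := by
      have := hint.re
      simpa only [hreal, RCLike.re_eq_complex_re, Complex.ofReal_re] using this
    rw [← ofReal_integral_eq_lintegral_ofReal hint'
      (Filter.Eventually.of_forall fun c => tsum_nonneg fun _ => hφ0 _)]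
    refine ENNReal.ofReal_le_ofReal ?_
    simp only [hreal] at hle
    rw [integral_complex_ofReal, Complex.norm_real] at hle
    exact (le_abs_self _).trans hle
  calc ∫⁻ c, (c.count (Set.Icc L (L + 1)) : ℝ≥0∞) ^ n ∂(P : Measure Configuration)
      ≤ ∫⁻ c, ((2 * n) ^ n + 2 ^ n * ENNReal.ofReal
        (∑' s : Fin n ↪ Configuration.Point c, φ (c.positions s)))
          ∂(P : Measure Configuration) := lintegral_mono hbound
    _ = (2 * n) ^ n + 2 ^ n * ∫⁻ c, ENNReal.ofReal
        (∑' s : Fin n ↪ Configuration.Point c, φ (c.positions s))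
          ∂(P : Measure Configuration) := by
      rw [lintegral_add_left measurable_const, lintegral_const_mul' _ _ (by simp)]
      simp
    _ ≤ (2 * n) ^ n + 2 ^ n * ENNReal.ofReal C := by gcongr
    _ = _ := by
      push_cast
      rfl

end Configurations

end LatticeMimicry

namespace LatticeMimicry

/-! ### Absolute convergence of lattice sums of Schwartz functions. -/

section LatticeSums

open Filter Topology

lemma summable_prod_fin {f : ℤ → ℝ} (h0 : ∀ k, 0 ≤ f k) (hf : Summable f) (n : ℕ) :
    Summable fun k : Fin n → ℤ => ∏ i, f (k i) := by
  induction n with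
  | zero => exact Summable.of_finite
  | succ n ih =>
    rw [← (Fin.consEquiv fun _ : Fin (n + 1) => ℤ).summable_iff]
    have := hf.mul_of_nonneg ih h0 (fun k => Finset.prod_nonneg fun i _ => h0 _)
    refine this.congr fun p => ?_
    simp [Fin.consEquiv, Fin.prod_univ_succ]

lemma summable_inv_one_add_sq {a : ℝ} (ha : a ≠ 0) :
    Summable fun k : ℤ => (1 + (a * k) ^ 2)⁻¹ := by
  have h : Summable fun k : ℤ => (a ^ 2)⁻¹ * (1 / (k : ℝ) ^ 2) :=
    (Real.summable_one_div_int_pow.2 one_lt_two).mul_left _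
  refine Summable.of_norm_bounded_eventually h ?_
  have : ∀ᶠ k : ℤ in cofinite, k ≠ 0 := by
    simpa using (Set.finite_singleton (0 : ℤ)).compl_mem_cofinite
  filter_upwards [this] with k hk
  rw [Real.norm_of_nonneg (by positivity), one_div, ← mul_inv, ← mul_pow]
  have : 0 < (a * k) ^ 2 := by positivity
  exact inv_anti₀ this (by linarith)

/-- Decay in product form reduces sums over ℤⁿ to one-dimensional sums. -/
lemma schwartz_norm_le_prod {n : ℕ} (φ : SchwartzMap (EuclideanSpace ℝ (Fin n)) ℂ) :
    ∃ C : ℝ, 0 ≤ C ∧ ∀ x, ‖φ x‖ ≤ C * ∏ i, (1 + (x i) ^ 2)⁻¹ := by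
  obtain ⟨C, hC⟩ : ∃ C : ℝ, ∀ x, (1 + ‖x‖) ^ (2 * n) * ‖φ x‖ ≤ C := by
    refine ⟨2 ^ (2 * n, 0).1 * (Finset.Iic (2 * n, 0)).sup
      (fun m => SchwartzMap.seminorm ℝ m.1 m.2) φ, fun x => ?_⟩
    have h := SchwartzMap.one_add_le_sup_seminorm_apply (𝕜 := ℝ) (m := (2 * n, 0)) (k := 2 * n)
      (n := 0) le_rfl le_rfl φ x
    rwa [norm_iteratedFDeriv_zero] at h
  refine ⟨C, le_trans (by positivity) (hC 0), fun x => ?_⟩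
  have h2 : ∏ i, (1 + (x i) ^ 2) ≤ (1 + ‖x‖) ^ (2 * n) := by
    calc ∏ i, (1 + (x i) ^ 2) ≤ ∏ i : Fin n, (1 + ‖x‖) ^ 2 := by
          refine Finset.prod_le_prod (fun i _ => by positivity) fun i _ => ?_
          have h3 : ‖x i‖ ≤ ‖x‖ := PiLp.norm_apply_le x i
          have h4 : (x i) ^ 2 ≤ ‖x‖ ^ 2 := by
            rw [← sq_abs, ← Real.norm_eq_abs]; gcongr
          nlinarith [norm_nonneg x]
      _ = _ := by simp [← pow_mul]
  have hpos : 0 < ∏ i, (1 + (x i) ^ 2) := Finset.prod_pos fun i _ => by positivity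
  rw [Finset.prod_inv_distrib, ← div_eq_mul_inv, le_div_iff₀ hpos, mul_comm]
  exact (mul_le_mul_of_nonneg_right h2 (norm_nonneg _)).trans (hC x)

lemma summable_norm_schwartz_lattice {a : ℝ} (ha : a ≠ 0) {n : ℕ}
    (φ : SchwartzMap (EuclideanSpace ℝ (Fin n)) ℂ) :
    Summable fun k : Fin n → ℤ => ‖φ (latticePoint a k)‖ := by
  obtain ⟨C, hC, h⟩ := schwartz_norm_le_prod φ
  refine Summable.of_nonneg_of_le (fun _ => norm_nonneg _) (fun k => h _) ?_
  exact (summable_prod_fin (fun k => by positivity) (summable_inv_one_add_sq ha) n).mul_left C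

end LatticeSums

/-! ### Simple configurations on the lattice. -/

section SimpleLattice

/-- Configurations without multiple points that are supported on `aℤ`. -/
def Configuration.IsSimpleOn (c : Configuration) (a : ℝ) : Prop :=
  (∀ x, c.mult x ≠ 0 → ∃ k : ℤ, x = a * k) ∧ ∀ x, c.mult x ≤ 1

namespace Configuration.IsSimpleOn

variable {c : Configuration} {a : ℝ}

/-- The points of a simple configuration on `aℤ` are labelled by integers. -/
noncomputable def pointEquiv (hc : c.IsSimpleOn a) (ha : a ≠ 0) :
    {k : ℤ // c.mult (a * k) ≠ 0} ≃ c.Point :=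
  Equiv.ofBijective (fun k => c.pointAt (a * k) ⟨0, Nat.pos_of_ne_zero k.2⟩) <| by
    constructor
    · rintro ⟨k, hk⟩ ⟨l, hl⟩ h
      have : a * k = a * l := congrArg Point.pos h
      simpa [ha] using this
    · rintro ⟨x, i⟩
      obtain ⟨k, rfl⟩ := hc.1 x (fun h => absurd i.2 (by simp [h]))
      refine ⟨⟨k, fun h => absurd i.2 (by simp [h])⟩, ?_⟩
      have : i = ⟨0, lt_of_le_of_lt (Nat.zero_le _) i.2⟩ := by
        ext
        have := hc.2 (a * k)
        have := i.2
        simp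
        omega
      rw [this]
      rfl

lemma pos_pointEquiv (hc : c.IsSimpleOn a) (ha : a ≠ 0) (k : {k : ℤ // c.mult (a * k) ≠ 0}) :
    (hc.pointEquiv ha k).pos = a * k := rfl

lemma count_eq (hc : c.IsSimpleOn a) (ha : a ≠ 0) (V : Set ℝ) :
    c.count V = {k : ℤ | a * k ∈ V ∧ c.mult (a * k) ≠ 0}.encard := by
  have e1 : {p : c.Point | p.pos ∈ V} = hc.pointEquiv ha '' {k | a * (k : ℤ) ∈ V} := by
    ext p
    obtain ⟨k, rfl⟩ := (hc.pointEquiv ha).surjective p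
    simp [pos_pointEquiv]
  have e2 : {k : ℤ | a * k ∈ V ∧ c.mult (a * k) ≠ 0} =
      Subtype.val '' {k : {k : ℤ // c.mult (a * k) ≠ 0} | a * (k : ℤ) ∈ V} := by
    ext k
    simp [and_comm]
  rw [count, e1, e2, (hc.pointEquiv ha).injective.encard_image,
    Subtype.val_injective.encard_image]

/-- Tuples of distinct elements of a subtype as injective tuples with entries in the subtype. -/
def embeddingEquiv (n : ℕ) (p : ℤ → Prop) :
    {k : Fin n → ℤ // Function.Injective k ∧ ∀ i, p (k i)} ≃ (Fin n ↪ {k : ℤ // p k}) where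
  toFun k := ⟨fun i => ⟨k.1 i, k.2.2 i⟩, fun _ _ h => k.2.1 (congrArg Subtype.val h)⟩
  invFun s := ⟨fun i => (s i).1, fun _ _ h => s.injective (Subtype.ext h), fun i => (s i).2⟩
  left_inv _ := rfl
  right_inv _ := rfl

/-- The index set ℤⁿ no longer depends on the configuration, so the sum becomes a series of
indicator functions that can be integrated term by term. -/
lemma distinctSum_eq_tsum (hc : c.IsSimpleOn a) (ha : a ≠ 0) {n : ℕ}
    (φ : EuclideanSpace ℝ (Fin n) → ℂ) :
    c.distinctSum φ = ∑' k : Fin n → ℤ,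
      {k : Fin n → ℤ | Function.Injective k ∧ ∀ i, c.mult (a * k i) ≠ 0}.indicator
        (fun k => φ (latticePoint a k)) k := by
  rw [distinctSum, ← tsum_subtype]
  have := Equiv.tsum_eq ((embeddingEquiv n fun k => c.mult (a * k) ≠ 0).trans
    ((Equiv.refl (Fin n)).embeddingCongr (hc.pointEquiv ha)))
    (fun s : Fin n ↪ c.Point => φ (WithLp.toLp 2 fun i => (s i).pos))
  rw [← this]
  rfl

end Configuration.IsSimpleOn

end SimpleLattice

end LatticeMimicry

namespace LatticeMimicry

/-! ### Existence of the discrete sine process. -/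

section DiscreteSineProcess

open Filter Topology

/-- The simple configuration on `aℤ` with prescribed occupied sites. -/
noncomputable def latticeConfiguration (a : ℝ) (ha : a ≠ 0) (ω : ℤ → Bool) : Configuration where
  mult x := by
    classical
    exact if ∃ k : ℤ, x = a * k ∧ ω k = true then 1 else 0
  locallyFinite K hK := by
    obtain ⟨R, hR⟩ := hK.isBounded.exists_norm_le
    have hfin : {k : ℤ | ‖(k : ℝ)‖ ≤ R / |a|}.Finite := by
      refine (Set.finite_Icc (-⌈R / |a|⌉) ⌈R / |a|⌉).subset fun k (hk : ‖(k : ℝ)‖ ≤ R / |a|) => ?_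
      rw [Real.norm_eq_abs] at hk
      have := hk.trans (Int.le_ceil _)
      have h2 : |k| ≤ ⌈R / |a|⌉ := by exact_mod_cast this
      exact abs_le.1 h2
    refine (hfin.image fun k : ℤ => a * (k : ℝ)).subset ?_
    rintro x ⟨hx, h0⟩
    have : ∃ k : ℤ, x = a * k ∧ ω k = true := by
      by_contra h
      simp [h] at h0
    obtain ⟨k, rfl, -⟩ := this
    refine ⟨k, ?_, rfl⟩
    have := hR _ hx
    rw [norm_mul] at this
    change ‖(k : ℝ)‖ ≤ R / |a|
    rw [le_div_iff₀ (abs_pos.2 ha), mul_comm]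
    exact this

variable {a : ℝ} (ha : a ≠ 0)

lemma latticeConfiguration_mult_ne_zero (ω : ℤ → Bool) (k : ℤ) :
    (latticeConfiguration a ha ω).mult (a * k) ≠ 0 ↔ ω k = true := by
  have : (∃ l : ℤ, a * (k : ℝ) = a * l ∧ ω l = true) ↔ ω k = true := by
    simp [ha]
  simp [latticeConfiguration, ha]

lemma latticeConfiguration_isSimpleOn (ω : ℤ → Bool) :
    (latticeConfiguration a ha ω).IsSimpleOn a := by
  constructor
  · intro x hx
    by_contra h
    refine hx ?_
    have : ¬ ∃ k : ℤ, x = a * k ∧ ω k = true := fun ⟨k, hk, _⟩ => h ⟨k, hk⟩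
    simp [latticeConfiguration, this]
  · intro x
    simp only [latticeConfiguration]
    split_ifs <;> simp

lemma finite_lattice_mem {a : ℝ} (ha : a ≠ 0) {V : Set ℝ} (hV : Bornology.IsBounded V) :
    {k : ℤ | a * (k : ℝ) ∈ V}.Finite := by
  have h := (latticeConfiguration a ha fun _ => true).locallyFinite _ hV.isCompact_closure
  refine (h.preimage (f := fun k : ℤ => a * (k : ℝ)) ?_).subset ?_
  · intro k _ l _ h
    simpa [ha] using h
  · intro k hk
    exact ⟨subset_closure hk, (latticeConfiguration_mult_ne_zero ha _ k).2 rfl⟩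

/-- A bounded set meets the lattice in finitely many points, so each generating event depends on
finitely many sites. -/
lemma measurable_latticeConfiguration : Measurable (latticeConfiguration a ha) := by
  refine measurable_generateFrom ?_
  rintro _ ⟨V, m, -, hb, rfl⟩
  have hfin := finite_lattice_mem ha hb
  have : Finite {k : ℤ | a * (k : ℝ) ∈ V} := hfin
  let π : (ℤ → Bool) → ({k : ℤ | a * (k : ℝ) ∈ V} → Bool) := fun ω k => ω k
  have hπ : Measurable π := measurable_pi_lambda _ fun k => measurable_pi_apply _
  have e : latticeConfiguration a ha ⁻¹' {c | c.count V = m} =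
      π ⁻¹' {f | {k | f k = true}.encard = m} := by
    ext ω
    simp only [Set.mem_preimage, Set.mem_ofPred_eq]
    rw [(latticeConfiguration_isSimpleOn ha ω).count_eq ha]
    simp only [latticeConfiguration_mult_ne_zero]
    have : {k : ℤ | a * (k : ℝ) ∈ V ∧ ω k = true} =
        Subtype.val '' {k : {k : ℤ | a * (k : ℝ) ∈ V} | π ω k = true} := by
      ext k
      exact ⟨fun h => ⟨⟨k, h.1⟩, h.2, rfl⟩, fun ⟨l, hl, h⟩ => h ▸ ⟨l.2, hl⟩⟩
    rw [this, Subtype.val_injective.encard_image]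
  rw [e]
  exact hπ (Set.toFinite _).measurableSet

/-- Needed to carry the almost sure statement through a pushforward. Counting points off the lattice
in the windows [-N, N] reduces the condition to countably many generating events. -/
lemma measurableSet_isSimpleOn : MeasurableSet {c : Configuration | c.IsSimpleOn a} := by
  have hc : Set.Countable (Set.range fun k : ℤ => a * (k : ℝ)) := Set.countable_range _
  have e : {c : Configuration | c.IsSimpleOn a} =
      (⋂ N : ℕ, {c | c.count (Set.Icc (-(N : ℝ)) N \ Set.range fun k : ℤ => a * (k : ℝ)) =
        ((0 : ℕ) : ℕ∞)}) ∩ ⋂ k : ℤ, {c | c.mult (a * k) ≤ 1} := by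
    ext c
    simp only [Set.mem_inter_iff, Set.mem_iInter, Set.mem_ofPred_eq, Nat.cast_zero,
      Configuration.count_eq_zero_iff]
    constructor
    · intro h
      refine ⟨fun N x hx => ?_, fun k => h.2 _⟩
      by_contra h0
      obtain ⟨k, rfl⟩ := h.1 x h0
      exact hx.2 ⟨k, rfl⟩
    · rintro ⟨h1, h2⟩
      have h3 : ∀ x, c.mult x ≠ 0 → ∃ k : ℤ, x = a * k := by
        intro x hx
        by_contra hk
        obtain ⟨N, hN⟩ := exists_nat_ge |x|
        exact hx (h1 N x ⟨abs_le.1 hN, fun ⟨k, hk'⟩ => hk ⟨k, hk'.symm⟩⟩)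
      refine ⟨h3, fun x => ?_⟩
      by_cases hx : c.mult x = 0
      · simp [hx]
      · obtain ⟨k, rfl⟩ := h3 x hx
        exact h2 k
  rw [e]
  refine (MeasurableSet.iInter fun N => ?_).inter (MeasurableSet.iInter fun k => ?_)
  · exact Configuration.measurableSet_count_eq (measurableSet_Icc.diff hc.measurableSet)
      ((Metric.isBounded_Icc _ _).subset Set.sdiff_subset) 0
  · exact Configuration.measurable_mult _ (measurableSet_Iic (a := 1))

lemma measurableSet_tuple_mem (n : ℕ) (k : Fin n → ℤ) :
    MeasurableSet {c : Configuration | Function.Injective k ∧ ∀ i, c.mult (a * k i) ≠ 0} := by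
  have : {c : Configuration | Function.Injective k ∧ ∀ i, c.mult (a * k i) ≠ 0} =
      {_c | Function.Injective k} ∩ ⋂ i, (fun c : Configuration => c.mult (a * k i)) ⁻¹' {0}ᶜ := by
    ext c
    simp
  rw [this]
  exact (MeasurableSet.const _).inter (MeasurableSet.iInter fun i =>
    Configuration.measurable_mult _ (measurableSet_singleton 0).compl)

/-- The probability that all sites of an injective tuple are occupied. -/
lemma measure_tuple_occupied {μ : ProbabilityMeasure (ℤ → Bool)}
    (hμ : ∀ A : Finset ℤ, (μ : Measure (ℤ → Bool)) (occupied A) =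
      ENNReal.ofReal ((latticeSineKernel a).submatrix (Subtype.val : A → ℤ)
        (Subtype.val : A → ℤ)).det) (ha0 : 0 < a) (n : ℕ) (k : Fin n → ℤ) :
    (μ : Measure (ℤ → Bool)).real {ω | Function.Injective k ∧ ∀ i, ω (k i) = true} =
      a ^ n * sineDet (latticePoint a k) := by
  have hdet : ((latticeSineKernel a).submatrix k k).det = a ^ n * sineDet (latticePoint a k) := by
    have : (latticeSineKernel a).submatrix k k = a • Matrix.of fun i j : Fin n =>
        Real.sinc (Real.pi * (latticePoint a k i - latticePoint a k j)) := by
      ext i j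
      simp [latticeSineKernel, latticePoint]
    rw [this, Matrix.det_smul, Fintype.card_fin, sineDet]
  by_cases hk : Function.Injective k
  · have e : {ω : ℤ → Bool | Function.Injective k ∧ ∀ i, ω (k i) = true} =
        occupied (Finset.univ.map ⟨k, hk⟩) := by
      ext ω
      simp [occupied, hk]
    let e' : Fin n ≃ (Finset.univ.map ⟨k, hk⟩ : Finset ℤ) :=
      Equiv.ofBijective (fun i => ⟨k i, by simp⟩) <| by
        constructor
        · intro i j h
          exact hk (congrArg Subtype.val h)
        · rintro ⟨l, hl⟩
          obtain ⟨i, -, rfl⟩ := Finset.mem_map.1 hl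
          exact ⟨i, rfl⟩
    have h0 := (latticeSineKernel_posSemidef ha0.le (Finset.univ.map ⟨k, hk⟩)).det_nonneg
    rw [Measure.real, e, hμ, ENNReal.toReal_ofReal h0, ← Matrix.det_submatrix_equiv_self e', ← hdet]
    rfl
  · rw [← hdet]
    have e : {ω : ℤ → Bool | Function.Injective k ∧ ∀ i, ω (k i) = true} = ∅ := by
      ext; simp [hk]
    obtain ⟨i, j, hij, hne⟩ : ∃ i j, k i = k j ∧ i ≠ j := by
      simpa [Function.Injective] using hk
    rw [e, Matrix.det_zero_of_row_eq hne]
    · simp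
    · funext l
      simp [hij]

/-- The integral of a distinct sum over a process without multiple points on `aℤ`. -/
lemma hasSum_integral_distinctSum {Q : Measure Configuration} [IsProbabilityMeasure Q]
    (ha : a ≠ 0) (hQ : ∀ᵐ c ∂Q, c.IsSimpleOn a) {n : ℕ}
    {φ : EuclideanSpace ℝ (Fin n) → ℂ} (hφ : Summable fun k => ‖φ (latticePoint a k)‖) :
    Integrable (fun c : Configuration => c.distinctSum φ) Q ∧
      ∫ c, c.distinctSum φ ∂Q = ∑' k : Fin n → ℤ,
        (Q.real {c | Function.Injective k ∧ ∀ i, c.mult (a * k i) ≠ 0} : ℂ) *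
          φ (latticePoint a k) := by
  let F : (Fin n → ℤ) → Configuration → ℂ := fun k =>
    {c : Configuration | Function.Injective k ∧ ∀ i, c.mult (a * k i) ≠ 0}.indicator
      fun _ => φ (latticePoint a k)
  have hFm : ∀ k, Measurable (F k) := fun k =>
    measurable_const.indicator (measurableSet_tuple_mem n k)
  have hFle : ∀ k c, ‖F k c‖ ≤ ‖φ (latticePoint a k)‖ := fun k c => norm_indicator_le_norm_self _ _
  have hFs : ∀ c, Summable fun k => F k c := fun c =>
    Summable.of_norm_bounded hφ fun k => hFle k c
  have hFint : ∀ k, Integrable (F k) Q := fun k =>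
    (integrable_const (φ (latticePoint a k))).indicator (measurableSet_tuple_mem n k)
  have hae : (fun c : Configuration => c.distinctSum φ) =ᵐ[Q] fun c => ∑' k, F k c := by
    filter_upwards [hQ] with c hc
    rw [hc.distinctSum_eq_tsum ha]
    rfl
  have hmeas : AEStronglyMeasurable (fun c => ∑' k, F k c) Q := by
    have : Measurable (fun c => ∑' k, F k c) :=
      measurable_of_tendsto_metrizable' atTop
        (f := fun (s : Finset (Fin n → ℤ)) c => ∑ k ∈ s, F k c)
        (fun s => Finset.measurable_sum s fun k _ => hFm k)
        (tendsto_pi_nhds.2 fun c => (hFs c).hasSum)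
    exact this.aestronglyMeasurable
  have hI : Integrable (fun c => ∑' k, F k c) Q := by
    refine Integrable.of_bound hmeas (∑' k, ‖φ (latticePoint a k)‖) (Eventually.of_forall fun c => ?_)
    exact tsum_of_norm_bounded hφ.hasSum fun k => hFle k c
  refine ⟨hI.congr hae.symm, ?_⟩
  rw [integral_congr_ae hae]
  have hsn : Summable fun k => ∫ c, ‖F k c‖ ∂Q := by
    refine Summable.of_nonneg_of_le (fun k => integral_nonneg fun _ => norm_nonneg _) (fun k => ?_) hφ
    calc ∫ c, ‖F k c‖ ∂Q ≤ ∫ _c, ‖φ (latticePoint a k)‖ ∂Q :=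
          integral_mono (hFint k).norm (integrable_const _) (hFle k)
      _ = _ := by simp
  rw [← integral_tsum_of_summable_integral_norm hFint hsn]
  refine tsum_congr fun k => ?_
  rw [integral_indicator_const _ (measurableSet_tuple_mem n k)]
  simp

theorem exists_isDiscreteSineProcess (ha0 : 0 < a) (ha1 : a ≤ 1) :
    ∃ Q : PointProcess, IsDiscreteSineProcess a Q := by
  obtain ⟨μ, hμ⟩ := exists_determinantal_measure (latticeSineKernel a)
    (latticeSineKernel_posSemidef ha0.le) (one_sub_latticeSineKernel_posSemidef ha0.le ha1)
  have ha : a ≠ 0 := ha0.ne'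
  have hT := measurable_latticeConfiguration ha
  let Q : PointProcess := μ.map hT.aemeasurable
  have hQ : (Q : Measure Configuration) =
    (μ : Measure (ℤ → Bool)).map (latticeConfiguration a ha) := rfl
  have hs : ∀ᵐ c ∂(Q : Measure Configuration), c.IsSimpleOn a := by
    rw [hQ, ae_map_iff hT.aemeasurable measurableSet_isSimpleOn]
    exact Eventually.of_forall fun ω => latticeConfiguration_isSimpleOn ha ω
  refine ⟨Q, ?_, fun n _ φ => ?_⟩
  · filter_upwards [hs] with c hc using hc.1
  · have h := hasSum_integral_distinctSum ha hs (summable_norm_schwartz_lattice ha φ)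
    refine ⟨h.1, h.2.trans (tsum_congr fun k => ?_)⟩
    rw [hQ, map_measureReal_apply hT (measurableSet_tuple_mem n k)]
    simp only [Set.preimage_ofPred_eq, latticeConfiguration_mult_ne_zero]
    rw [measure_tuple_occupied hμ ha0]
    push_cast
    ring

end DiscreteSineProcess

end LatticeMimicry

namespace LatticeMimicry

/-! ### Fourier representation of the sine determinant. -/

section SineDeterminant

open Matrix

/-- The uniform measure on the cube `[0, 1)ⁿ`. -/
noncomputable def cubeMeasure (n : ℕ) : Measure (Fin n → ℝ) :=
  Measure.pi fun _ => volume.restrict (Set.Ico (0 : ℝ) 1)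

instance (n : ℕ) : IsProbabilityMeasure (cubeMeasure n) := by
  have : IsProbabilityMeasure (volume.restrict (Set.Ico (0 : ℝ) 1)) := ⟨by simp⟩
  unfold cubeMeasure
  infer_instance

lemma cubeMeasure_eq_restrict (n : ℕ) :
    cubeMeasure n = volume.restrict (Set.univ.pi fun _ : Fin n => Set.Ico (0 : ℝ) 1) :=
  (Measure.restrict_pi_pi _ _).symm

/-- Integrating over [0, 1) instead of the centred interval costs the phase exp(iπy), which cancels
in a product over a permutation. -/
lemma integral_Ico_exp (y : ℝ) :
    ∫ t in Set.Ico (0 : ℝ) 1, Complex.exp (2 * Real.pi * (t * y : ℝ) * Complex.I) =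
      Complex.exp (Real.pi * y * Complex.I) * (Real.sinc (Real.pi * y) : ℝ) := by
  rw [integral_Ico_eq_integral_Ioo, ← integral_Ioc_eq_integral_Ioo,
    ← intervalIntegral.integral_of_le zero_le_one]
  rcases eq_or_ne y 0 with rfl | hy
  · simp
  have hc : (2 * Real.pi * y * Complex.I : ℂ) ≠ 0 := by
    simp [Real.pi_ne_zero, hy]
  have h := integral_exp_mul_complex (a := 0) (b := 1) hc
  have e : ∀ t : ℝ, Complex.exp (2 * Real.pi * (t * y : ℝ) * Complex.I) =
      Complex.exp (2 * Real.pi * y * Complex.I * t) := by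
    intro t; congr 1; push_cast; ring
  simp only [e]
  rw [h, Real.sinc_of_ne_zero (by positivity)]
  have e2 : Complex.exp (2 * Real.pi * y * Complex.I * (1 : ℝ)) =
      Complex.exp (Real.pi * y * Complex.I) * Complex.exp (Real.pi * y * Complex.I) := by
    rw [← Complex.exp_add]; congr 1; push_cast; ring
  have e3 : Complex.exp (Real.pi * y * Complex.I) * Complex.exp (-(Real.pi * y * Complex.I)) = 1 := by
    rw [← Complex.exp_add, add_neg_cancel, Complex.exp_zero]
  rw [e2]
  push_cast
  rw [Complex.sin]
  have hpy : (Real.pi : ℂ) * y ≠ 0 := by simp [Real.pi_ne_zero, hy]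
  rw [mul_zero, Complex.exp_zero]
  field_simp
  rw [Complex.I_sq]
  congr 1
  linear_combination e3

/-- The frequency vector attached to a permutation and a point of the cube. -/
noncomputable def permFrequency {n : ℕ} (σ : Equiv.Perm (Fin n)) (t : Fin n → ℝ) :
    EuclideanSpace ℝ (Fin n) :=
  WithLp.toLp 2 fun i => t (σ.symm i) - t i

lemma continuous_permFrequency {n : ℕ} (σ : Equiv.Perm (Fin n)) :
    Continuous (permFrequency σ) := by
  unfold permFrequency
  fun_prop

lemma inner_permFrequency {n : ℕ} (σ : Equiv.Perm (Fin n)) (t : Fin n → ℝ)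
    (x : EuclideanSpace ℝ (Fin n)) :
    inner ℝ x (permFrequency σ t) = ∑ i, t i * (x (σ i) - x i) := by
  rw [PiLp.inner_apply]
  simp only [permFrequency, RCLike.inner_apply, conj_trivial, sub_mul, mul_sub,
    Finset.sum_sub_distrib]
  congr 1
  rw [← Equiv.sum_comp σ]
  simp

/-- Each factor S(x_{σ i} - x_i) is an integral over its own variable t_i; collecting the
coefficient of x_i in the total exponent gives the frequency t_{σ⁻¹ i} - t_i. -/
lemma sineDet_eq_sum_integral {n : ℕ} (x : EuclideanSpace ℝ (Fin n)) :
    (sineDet x : ℂ) = ∑ σ : Equiv.Perm (Fin n), ((Equiv.Perm.sign σ : ℤ) : ℂ) *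
      ∫ t, Complex.exp (2 * Real.pi * (inner ℝ x (permFrequency σ t) : ℝ) * Complex.I)
        ∂cubeMeasure n := by
  rw [sineDet, det_apply']
  push_cast
  refine Finset.sum_congr rfl fun σ _ => ?_
  congr 1
  have h1 : ∀ t : Fin n → ℝ,
      Complex.exp (2 * Real.pi * (inner ℝ x (permFrequency σ t) : ℝ) * Complex.I) =
        ∏ i, Complex.exp (2 * Real.pi * (t i * (x (σ i) - x i) : ℝ) * Complex.I) := by
    intro t
    rw [← Complex.exp_sum, inner_permFrequency]
    congr 1
    push_cast
    rw [Finset.mul_sum, Finset.sum_mul]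
  simp only [h1]
  rw [cubeMeasure, integral_fintype_prod_eq_prod
    (fun i (s : ℝ) => Complex.exp (2 * Real.pi * (s * (x (σ i) - x i) : ℝ) * Complex.I))]
  simp only [integral_Ico_exp]
  rw [Finset.prod_mul_distrib, ← Complex.exp_sum]
  -- The phases add up to zero because σ permutes the coordinates of x.
  have h0 : ∑ i, (Real.pi * ((x (σ i) - x i : ℝ) : ℂ) * Complex.I) = 0 := by
    rw [← Finset.sum_mul, ← Finset.mul_sum]
    push_cast
    rw [Finset.sum_sub_distrib, Equiv.sum_comp σ fun i => (x i : ℂ)]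
    simp
  rw [h0, Complex.exp_zero, one_mul]
  simp

lemma continuous_sineDet (n : ℕ) : Continuous (sineDet : EuclideanSpace ℝ (Fin n) → ℝ) := by
  unfold sineDet
  refine Continuous.matrix_det (continuous_pi fun i => continuous_pi fun j => ?_)
  simp only [of_apply]
  exact Real.continuous_sinc.comp (by fun_prop)

lemma abs_sineDet_le {n : ℕ} (x : EuclideanSpace ℝ (Fin n)) : |sineDet x| ≤ n.factorial := by
  rw [sineDet]
  have h := det_le (A := Matrix.of fun i j : Fin n => Real.sinc (Real.pi * (x i - x j)))
    (abv := AbsoluteValue.abs) (x := 1) (fun i j => Real.abs_sinc_le_one _)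
  simpa using h

lemma fourier_neg_eq {n : ℕ} (f : EuclideanSpace ℝ (Fin n) → ℂ) (w : EuclideanSpace ℝ (Fin n)) :
    𝓕 f (-w) = ∫ x, f x * Complex.exp (2 * Real.pi * (inner ℝ x w : ℝ) * Complex.I) := by
  rw [Real.fourier_eq']
  refine integral_congr_ae (Filter.Eventually.of_forall fun x => ?_)
  simp only [smul_eq_mul, inner_neg_right]
  rw [mul_comm]
  congr 2
  push_cast
  ring

/-- The integral of a function against the sine determinant in terms of the Fourier transform. -/
theorem integral_mul_sineDet {n : ℕ} {f : EuclideanSpace ℝ (Fin n) → ℂ} (hf : Integrable f) :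
    ∫ x, f x * (sineDet x : ℂ) = ∑ σ : Equiv.Perm (Fin n), ((Equiv.Perm.sign σ : ℤ) : ℂ) *
      ∫ t, 𝓕 f (-permFrequency σ t) ∂cubeMeasure n := by
  have hprod : ∀ σ : Equiv.Perm (Fin n), Integrable (Function.uncurry
      fun (x : EuclideanSpace ℝ (Fin n)) (t : Fin n → ℝ) => f x *
        Complex.exp (2 * Real.pi * (inner ℝ x (permFrequency σ t) : ℝ) * Complex.I))
      (volume.prod (cubeMeasure n)) := by
    intro σ
    have h1 : Integrable (fun p : EuclideanSpace ℝ (Fin n) × (Fin n → ℝ) => f p.1)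
        (volume.prod (cubeMeasure n)) := hf.comp_fst _
    refine h1.mul_bdd (c := 1) (Continuous.aestronglyMeasurable ?_)
      (Filter.Eventually.of_forall fun p => ?_)
    · have := continuous_permFrequency σ
      fun_prop
    · have : (2 * Real.pi * (inner ℝ p.1 (permFrequency σ p.2) : ℝ) * Complex.I : ℂ) =
        ((2 * Real.pi * inner ℝ p.1 (permFrequency σ p.2) : ℝ) : ℂ) * Complex.I := by push_cast; ring
      rw [this, Complex.norm_exp_ofReal_mul_I]
  simp only [sineDet_eq_sum_integral, Finset.mul_sum, ← mul_assoc]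
  have h2 : ∀ (σ : Equiv.Perm (Fin n)) (x : EuclideanSpace ℝ (Fin n)),
      f x * ((Equiv.Perm.sign σ : ℤ) : ℂ) *
        (∫ t, Complex.exp (2 * Real.pi * (inner ℝ x (permFrequency σ t) : ℝ) * Complex.I)
          ∂cubeMeasure n) =
      ((Equiv.Perm.sign σ : ℤ) : ℂ) * ∫ t, f x *
        Complex.exp (2 * Real.pi * (inner ℝ x (permFrequency σ t) : ℝ) * Complex.I)
          ∂cubeMeasure n := by
    intro σ x
    rw [integral_const_mul]
    ring
  simp only [h2]
  have h3 : ∀ σ : Equiv.Perm (Fin n), Integrable (fun x => ((Equiv.Perm.sign σ : ℤ) : ℂ) *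
      ∫ t, f x * Complex.exp (2 * Real.pi * (inner ℝ x (permFrequency σ t) : ℝ) * Complex.I)
        ∂cubeMeasure n) := fun σ => (hprod σ).integral_prod_left.const_mul _
  rw [integral_finsetSum _ fun σ _ => h3 σ]
  refine Finset.sum_congr rfl fun σ _ => ?_
  rw [integral_const_mul]
  congr 1
  rw [integral_integral_swap (hprod σ)]
  simp only [fourier_neg_eq]

end SineDeterminant

end LatticeMimicry

namespace LatticeMimicry

/-! ### Poisson summation for compactly supported functions. -/

section Poisson

open Filter Topology

variable {n : ℕ}

/-- The half-open unit cube with upper corner `m + 1`. -/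
def latticeCube (m : Fin n → ℤ) : Set (Fin n → ℝ) := {x | ∀ i, x i ∈ Set.Ioc (m i : ℝ) (m i + 1)}

/-- An integer vector as a real vector. -/
def intVector (m : Fin n → ℤ) : Fin n → ℝ := fun i => (m i : ℝ)

lemma measurableSet_latticeCube (m : Fin n → ℤ) : MeasurableSet (latticeCube m) :=
  MeasurableSet.univ_pi' fun _ => measurableSet_Ioc

lemma pairwise_disjoint_latticeCube :
    Pairwise (Function.onFun Disjoint (latticeCube : (Fin n → ℤ) → Set (Fin n → ℝ))) := by
  intro m m' hne
  refine Set.disjoint_left.2 fun x hx hx' => hne ?_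
  funext i
  have h1 := hx i
  have h2 := hx' i
  have h3 : (m i : ℝ) < m' i + 1 := h1.1.trans_le h2.2
  have h4 : (m' i : ℝ) < m i + 1 := h2.1.trans_le h1.2
  have h5 : m i < m' i + 1 := by exact_mod_cast h3
  have h6 : m' i < m i + 1 := by exact_mod_cast h4
  omega

lemma iUnion_latticeCube : ⋃ m, (latticeCube m : Set (Fin n → ℝ)) = Set.univ := by
  refine Set.eq_univ_of_forall fun x => Set.mem_iUnion.2 ⟨fun i => ⌈x i⌉ - 1, fun i => ?_⟩
  have h1 := Int.ceil_lt_add_one (x i)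
  have h2 := Int.le_ceil (x i)
  push_cast
  constructor <;> linarith

lemma setIntegral_latticeCube {E : Type*} [NormedAddCommGroup E] [NormedSpace ℝ E]
    (f : (Fin n → ℝ) → E) (m : Fin n → ℤ) :
    ∫ x in latticeCube m, f x = ∫ x in latticeCube 0, f (x + intVector m) := by
  have h := (measurePreserving_add_right volume (intVector m)).setIntegral_preimage_emb
    (measurableEmbedding_addRight _) f (latticeCube m)
  rw [← h]
  congr 2
  ext x
  simp only [latticeCube, intVector, Set.mem_preimage, Set.mem_ofPred_eq, Pi.add_apply, Set.mem_Ioc,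
    Pi.zero_apply, Int.cast_zero, zero_add]
  exact forall_congr' fun i => by constructor <;> rintro ⟨h1, h2⟩ <;> constructor <;> linarith

/-- Unfolding the integral of a periodization. -/
lemma setIntegral_tsum_translate {f : (Fin n → ℝ) → ℂ} (hf : Integrable f) :
    ∫ x in latticeCube (0 : Fin n → ℤ), ∑' m, f (x + intVector m) = ∫ x, f x := by
  have hU : IntegrableOn f (⋃ m, latticeCube m) := by
    rw [iUnion_latticeCube]; exact hf.integrableOn
  have h1 := hasSum_integral_iUnion measurableSet_latticeCube pairwise_disjoint_latticeCube hU
  have h2 := hasSum_integral_iUnion measurableSet_latticeCube pairwise_disjoint_latticeCube hU.norm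
  rw [iUnion_latticeCube, setIntegral_univ] at h1
  rw [funext (setIntegral_latticeCube f)] at h1
  have h2' : Summable fun m => ∫ x in latticeCube (0 : Fin n → ℤ), ‖f (x + intVector m)‖ := by
    refine h2.summable.congr fun m => ?_
    exact setIntegral_latticeCube (fun x => ‖f x‖) m
  rw [← integral_tsum_of_summable_integral_norm
    (fun m => (hf.comp_add_right (intVector m)).integrableOn) h2', h1.tsum_eq]

/-- The projection of `ℝⁿ` onto the torus. -/
noncomputable def toTorus (x : Fin n → ℝ) : UnitAddTorus (Fin n) := fun i => (x i : UnitAddCircle)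

lemma isOpenQuotientMap_toTorus : IsOpenQuotientMap (toTorus : (Fin n → ℝ) → _) :=
  IsOpenQuotientMap.piMap fun _ => QuotientAddGroup.isOpenQuotientMap_mk

lemma toTorus_eq_iff {x y : Fin n → ℝ} :
    toTorus x = toTorus y ↔ ∃ m : Fin n → ℤ, y = x + intVector m := by
  constructor
  · intro h
    have : ∀ i, ∃ k : ℤ, y i = x i + k := by
      intro i
      have hi := congrFun h i
      simp only [toTorus] at hi
      obtain ⟨k, hk⟩ := (QuotientAddGroup.eq_iff_sub_mem.1 hi.symm)
      refine ⟨k, ?_⟩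
      simp only [zsmul_eq_mul, mul_one] at hk
      linarith
    choose m hm using this
    exact ⟨m, funext hm⟩
  · rintro ⟨m, rfl⟩
    funext i
    simp only [toTorus, Pi.add_apply, intVector]
    refine (QuotientAddGroup.eq_iff_sub_mem.2 ⟨-m i, ?_⟩)
    simp

lemma finite_translate_mem {K : Set (Fin n → ℝ)} (hK : Bornology.IsBounded K) :
    {m : Fin n → ℤ | intVector m ∈ K}.Finite := by
  obtain ⟨R, hR⟩ := hK.exists_norm_le
  refine (Set.finite_Icc (fun _ => -⌈R⌉) (fun _ : Fin n => ⌈R⌉)).subset fun m hm => ?_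
  have h : ∀ i, |m i| ≤ ⌈R⌉ := by
    intro i
    have h1 : ‖intVector m i‖ ≤ R := (norm_le_pi_norm _ i).trans (hR _ hm)
    rw [intVector, Real.norm_eq_abs] at h1
    exact_mod_cast h1.trans (Int.le_ceil R)
  exact ⟨fun i => (abs_le.1 (h i)).1, fun i => (abs_le.1 (h i)).2⟩

/-- The periodization of a continuous compactly supported function. -/
lemma continuous_tsum_translate {G : (Fin n → ℝ) → ℂ} (hG : Continuous G)
    (hc : HasCompactSupport G) : Continuous fun x => ∑' m : Fin n → ℤ, G (x + intVector m) := by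
  rw [continuous_iff_continuousAt]
  intro x₀
  have hb : Bornology.IsBounded ((fun p : (Fin n → ℝ) × (Fin n → ℝ) => p.1 - p.2) ''
      (tsupport G ×ˢ Metric.closedBall x₀ 1)) :=
    ((hc.isCompact.prod (isCompact_closedBall x₀ 1)).image (by fun_prop)).isBounded
  have hfin := finite_translate_mem hb
  have hev : (fun x => ∑ m ∈ hfin.toFinset, G (x + intVector m)) =ᶠ[𝓝 x₀]
      fun x => ∑' m : Fin n → ℤ, G (x + intVector m) := by
    filter_upwards [Metric.closedBall_mem_nhds x₀ one_pos] with x hx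
    refine (tsum_eq_sum fun m hm => ?_).symm
    by_contra h0
    refine hm (hfin.mem_toFinset.2 ⟨(x + intVector m, x), ⟨subset_tsupport _ h0, hx⟩, ?_⟩)
    simp
  refine ContinuousAt.congr ?_ hev
  exact Continuous.continuousAt (by fun_prop)

lemma mFourier_toTorus (k : Fin n → ℤ) (x : Fin n → ℝ) :
    UnitAddTorus.mFourier k (toTorus x) =
      Complex.exp (2 * Real.pi * (∑ i, k i * x i : ℝ) * Complex.I) := by
  simp only [UnitAddTorus.mFourier, ContinuousMap.coe_mk, toTorus, fourier_coe_apply]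
  rw [← Complex.exp_sum]
  congr 1
  push_cast
  rw [Finset.mul_sum, Finset.sum_mul]
  refine Finset.sum_congr rfl fun i _ => ?_
  ring

/-- Poisson summation for continuous compactly supported functions with summable Fourier
coefficients. -/
theorem tsum_integral_exp_eq {G : (Fin n → ℝ) → ℂ} (hG : Continuous G) (hc : HasCompactSupport G)
    (hs : Summable fun k : Fin n → ℤ =>
      ∫ x, Complex.exp (2 * Real.pi * (∑ i, (-k) i * x i : ℝ) * Complex.I) * G x) :
    ∑' k : Fin n → ℤ, ∫ x, Complex.exp (2 * Real.pi * (∑ i, (-k) i * x i : ℝ) * Complex.I) * G x =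
      ∑' m : Fin n → ℤ, G (intVector m) := by
  let F₀ : (Fin n → ℝ) → ℂ := fun x => ∑' m : Fin n → ℤ, G (x + intVector m)
  have hF₀ : Continuous F₀ := continuous_tsum_translate hG hc
  have hper : ∀ x y : Fin n → ℝ, toTorus x = toTorus y → F₀ x = F₀ y := by
    intro x y h
    obtain ⟨m, rfl⟩ := toTorus_eq_iff.1 h
    have := (Equiv.addLeft m).tsum_eq fun m' : Fin n → ℤ => G (x + intVector m')
    refine this.symm.trans (tsum_congr fun m' => ?_)
    congr 1
    funext i
    simp [intVector, add_assoc]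
  -- The periodization descends to the torus; any lift may be used to evaluate it, by `hper`.
  let F : C(UnitAddTorus (Fin n), ℂ) :=
    ⟨fun t => F₀ (isOpenQuotientMap_toTorus.surjective t).choose, by
      rw [isOpenQuotientMap_toTorus.isQuotientMap.continuous_iff]
      convert hF₀ using 1
      funext x
      exact hper _ _ (isOpenQuotientMap_toTorus.surjective (toTorus x)).choose_spec⟩
  have hF : ∀ x, F (toTorus x) = F₀ x := fun x =>
    hper _ _ (isOpenQuotientMap_toTorus.surjective (toTorus x)).choose_spec
  have hcoef : ∀ k : Fin n → ℤ, UnitAddTorus.mFourierCoeff F k =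
      ∫ x, Complex.exp (2 * Real.pi * (∑ i, (-k) i * x i : ℝ) * Complex.I) * G x := by
    intro k
    rw [UnitAddTorus.mFourierCoeff_eq_integral _ _ 0]
    let f : (Fin n → ℝ) → ℂ := fun x =>
      Complex.exp (2 * Real.pi * (∑ i, (-k) i * x i : ℝ) * Complex.I) * G x
    have hfi : Integrable f := by
      refine Continuous.integrable_of_hasCompactSupport (by fun_prop) hc.mul_left
    have h1 := setIntegral_tsum_translate hfi
    refine Eq.trans ?_ h1
    have e : {x : Fin n → ℝ | ∀ i, x i ∈ Set.Ioc ((0 : Fin n → ℝ) i) ((0 : Fin n → ℝ) i + 1)} =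
        latticeCube 0 := by
      ext x; simp [latticeCube]
    rw [e]
    refine setIntegral_congr_fun (measurableSet_latticeCube 0) fun x _ => ?_
    change UnitAddTorus.mFourier (-k) (toTorus x) • F (toTorus x) = _
    rw [hF, smul_eq_mul, ← tsum_mul_left]
    refine tsum_congr fun m => ?_
    have h2 : toTorus (x + intVector m) = toTorus x := (toTorus_eq_iff.2 ⟨m, rfl⟩).symm
    rw [← h2, mFourier_toTorus]
  have hs' : Summable (UnitAddTorus.mFourierCoeff F) := by
    refine hs.congr fun k => (hcoef k).symm
  have h := (UnitAddTorus.hasSum_mFourier_series_apply_of_summable hs' (toTorus 0)).tsum_eq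
  rw [hF] at h
  have h0 : F₀ 0 = ∑' m : Fin n → ℤ, G (intVector m) := by simp [F₀]
  rw [← h0, ← h]
  refine tsum_congr fun k => ?_
  rw [hcoef, mFourier_toTorus]
  simp

end Poisson

end LatticeMimicry

namespace LatticeMimicry

/-! ### Band-limited lattice sums against the sine determinant. -/

section BandLimited

open Filter Topology

variable {n : ℕ}

lemma latticePoint_apply (a : ℝ) (k : Fin n → ℤ) (i : Fin n) : latticePoint a k i = a * k i := rfl

/-- The Fourier coefficients of a rescaled and translated Fourier transform. -/
lemma integral_exp_mul_fourier {a : ℝ} (ha : 0 < a)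
    (η : SchwartzMap (EuclideanSpace ℝ (Fin n)) ℂ) (w : EuclideanSpace ℝ (Fin n))
    (k : Fin n → ℤ) :
    ∫ x : Fin n → ℝ, Complex.exp (2 * Real.pi * (∑ i, k i * x i : ℝ) * Complex.I) *
        𝓕 (η : EuclideanSpace ℝ (Fin n) → ℂ) (a⁻¹ • WithLp.toLp 2 x - w) =
      (a : ℂ) ^ n * (η (latticePoint a k) *
        Complex.exp (2 * Real.pi * (inner ℝ (latticePoint a k) w : ℝ) * Complex.I)) := by
  let g : EuclideanSpace ℝ (Fin n) → ℂ := 𝓕 (η : EuclideanSpace ℝ (Fin n) → ℂ)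
  let H : EuclideanSpace ℝ (Fin n) → ℂ := fun ξ =>
    Complex.exp (2 * Real.pi * (inner ℝ (latticePoint a k) (ξ + w) : ℝ) * Complex.I) * g ξ
  have h1 : ∀ x : Fin n → ℝ, Complex.exp (2 * Real.pi * (∑ i, k i * x i : ℝ) * Complex.I) *
      g (a⁻¹ • WithLp.toLp 2 x - w) = (fun y => H (a⁻¹ • y - w)) (WithLp.toLp 2 x) := by
    intro x
    simp only [H]
    congr 4
    rw [sub_add_cancel, PiLp.inner_apply]
    simp only [Complex.ofReal_inj]
    refine Finset.sum_congr rfl fun i _ => ?_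
    simp only [latticePoint_apply, PiLp.smul_apply, RCLike.inner_apply, conj_trivial, smul_eq_mul]
    field_simp
  have h2 : ∫ x : Fin n → ℝ, (fun y => H (a⁻¹ • y - w)) (WithLp.toLp 2 x) =
      ∫ y, H (a⁻¹ • y - w) := by
    exact (PiLp.volume_preserving_toLp (Fin n)).integral_comp
      (MeasurableEquiv.toLp 2 (Fin n → ℝ)).measurableEmbedding (fun y => H (a⁻¹ • y - w))
  have h3 : ∫ y, H (a⁻¹ • y - w) = (a : ℂ) ^ n * ∫ y, H y := by
    rw [Measure.integral_comp_smul volume (fun y => H (y - w)) a⁻¹,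
      integral_sub_right_eq_self H w, finrank_euclideanSpace_fin, inv_pow, inv_inv,
      abs_of_pos (by positivity)]
    simp
  have h4 : ∫ y, H y = Complex.exp (2 * Real.pi * (inner ℝ (latticePoint a k) w : ℝ) * Complex.I) *
      ∫ y, Complex.exp ((2 * Real.pi * inner ℝ y (latticePoint a k) : ℝ) * Complex.I) • g y := by
    rw [← integral_const_mul]
    congr 1
    funext y
    simp only [H, smul_eq_mul]
    rw [← mul_assoc, ← Complex.exp_add]
    congr 2
    rw [inner_add_right, real_inner_comm y]
    push_cast
    ring
  have h5 : ∫ y, Complex.exp ((2 * Real.pi * inner ℝ y (latticePoint a k) : ℝ) * Complex.I) • g y =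
      η (latticePoint a k) := by
    rw [← Real.fourierInv_eq']
    have : 𝓕⁻ g = (η : EuclideanSpace ℝ (Fin n) → ℂ) :=
      η.continuous.fourierInv_fourier_eq η.integrable (𝓕 η).integrable
    rw [this]
  simp only [g] at h1
  simp only [h1]
  rw [h2, h3, h4, h5]
  ring

/-- Poisson summation on `aℤⁿ` for a band-limited Schwartz function, against an exponential whose
frequency leaves only the zero mode. -/
theorem tsum_lattice_mul_exp {a : ℝ} (ha : 0 < a) (η : SchwartzMap (EuclideanSpace ℝ (Fin n)) ℂ)
    (hc : HasCompactSupport (𝓕 (η : EuclideanSpace ℝ (Fin n) → ℂ)))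
    (w : EuclideanSpace ℝ (Fin n))
    (hw : ∀ m : Fin n → ℤ, m ≠ 0 →
      𝓕 (η : EuclideanSpace ℝ (Fin n) → ℂ) (latticePoint a⁻¹ m - w) = 0) :
    ∑' k : Fin n → ℤ, (a : ℂ) ^ n * (η (latticePoint a k) *
      Complex.exp (2 * Real.pi * (inner ℝ (latticePoint a k) w : ℝ) * Complex.I)) =
      𝓕 (η : EuclideanSpace ℝ (Fin n) → ℂ) (-w) := by
  let G : (Fin n → ℝ) → ℂ := fun x =>
    𝓕 (η : EuclideanSpace ℝ (Fin n) → ℂ) (a⁻¹ • WithLp.toLp 2 x - w)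
  have hη : Continuous (𝓕 (η : EuclideanSpace ℝ (Fin n) → ℂ)) := (𝓕 η).continuous
  have hG : Continuous G := by
    have := PiLp.continuous_toLp 2 (fun _ : Fin n => ℝ)
    exact hη.comp (by fun_prop)
  let e : (Fin n → ℝ) ≃ₜ EuclideanSpace ℝ (Fin n) :=
    ((EuclideanSpace.equiv (Fin n) ℝ).symm.toHomeomorph.trans
      (Homeomorph.smulOfNeZero a⁻¹ (inv_ne_zero ha.ne'))).trans (Homeomorph.subRight w)
  have hGc : HasCompactSupport G := hc.comp_homeomorph e
  have hs : Summable fun k : Fin n → ℤ => (a : ℂ) ^ n * (η (latticePoint a k) *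
      Complex.exp (2 * Real.pi * (inner ℝ (latticePoint a k) w : ℝ) * Complex.I)) := by
    refine Summable.mul_left _ (Summable.of_norm ?_)
    refine (summable_norm_schwartz_lattice ha.ne' η).congr fun k => ?_
    have : (2 * Real.pi * (inner ℝ (latticePoint a k) w : ℝ) * Complex.I : ℂ) =
      ((2 * Real.pi * inner ℝ (latticePoint a k) w : ℝ) : ℂ) * Complex.I := by push_cast; ring
    rw [norm_mul, this, Complex.norm_exp_ofReal_mul_I, mul_one]
  have hcoef := fun k : Fin n → ℤ => integral_exp_mul_fourier ha η w (-k)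
  have h := tsum_integral_exp_eq hG hGc (by
    refine Summable.congr ?_ fun k => (hcoef k).symm
    exact (Equiv.neg (Fin n → ℤ)).summable_iff.2 hs)
  simp only [G, hcoef] at h
  -- Fourier coefficients carry the character of -k, whence the reflection of the summation index.
  rw [← (Equiv.neg (Fin n → ℤ)).tsum_eq]
  refine h.trans ?_
  have e0 : ∀ m : Fin n → ℤ, (a⁻¹ • WithLp.toLp 2 (intVector m) : EuclideanSpace ℝ (Fin n)) =
      latticePoint a⁻¹ m := fun m => by ext i; simp [intVector, latticePoint_apply]
  simp only [e0]
  rw [tsum_eq_single 0 hw]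
  have e1 : (latticePoint a⁻¹ 0 : EuclideanSpace ℝ (Fin n)) = 0 := by
    ext i
    simp [latticePoint_apply]
  rw [e1, zero_sub]

/-- The lattice sum of a band-limited function against the sine determinant equals the
corresponding integral. -/
theorem tsum_lattice_mul_sineDet {a B : ℝ} (ha : 0 < a) (hB : B ≤ (1 - a) / a)
    (η : SchwartzMap (EuclideanSpace ℝ (Fin n)) ℂ)
    (hη : ∀ ξ : EuclideanSpace ℝ (Fin n),
      𝓕 (η : EuclideanSpace ℝ (Fin n) → ℂ) ξ ≠ 0 → ∀ i, ξ i ∈ Set.Icc (-B) B) :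
    ∑' k : Fin n → ℤ, (a : ℂ) ^ n * (sineDet (latticePoint a k) : ℂ) * η (latticePoint a k) =
      ∫ x, η x * (sineDet x : ℂ) := by
  have hcont : Continuous (𝓕 (η : EuclideanSpace ℝ (Fin n) → ℂ)) := (𝓕 η).continuous
  have hc : HasCompactSupport (𝓕 (η : EuclideanSpace ℝ (Fin n) → ℂ)) := by
    refine HasCompactSupport.intro
      (K := (EuclideanSpace.equiv (Fin n) ℝ).symm '' Set.univ.pi fun _ => Set.Icc (-B) B)
      ((isCompact_univ_pi fun _ => isCompact_Icc).image
        (EuclideanSpace.equiv (Fin n) ℝ).symm.continuous) fun ξ hξ => ?_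
    by_contra h0
    exact hξ ⟨ξ, fun i _ => hη ξ h0 i, rfl⟩
  -- By continuity the transform also vanishes on the boundary of the band. This admits the endpoint
  -- B = (1 - a)/a.
  have hopen : ∀ ξ : EuclideanSpace ℝ (Fin n), (∃ i, B ≤ |ξ i|) →
      𝓕 (η : EuclideanSpace ℝ (Fin n) → ℂ) ξ = 0 := by
    rintro ξ ⟨i, hi⟩
    by_contra h0
    obtain ⟨c, hc⟩ : ∃ c : ℝ, ∀ s : ℝ, 0 < s → |ξ i + s * c| = |ξ i| + s := by
      rcases le_total 0 (ξ i) with h | h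
      · exact ⟨1, fun s hs => by rw [abs_of_nonneg h, abs_of_nonneg (by linarith), mul_one]⟩
      · exact ⟨-1, fun s hs => by rw [abs_of_nonpos h, abs_of_nonpos (by linarith)]; ring⟩
    have hlim : Tendsto (fun s : ℝ => 𝓕 (η : EuclideanSpace ℝ (Fin n) → ℂ)
        (ξ + s • EuclideanSpace.single i c)) (𝓝[>] 0)
        (𝓝 (𝓕 (η : EuclideanSpace ℝ (Fin n) → ℂ) ξ)) := by
      have : Tendsto (fun s : ℝ => 𝓕 (η : EuclideanSpace ℝ (Fin n) → ℂ)
          (ξ + s • EuclideanSpace.single i c)) (𝓝 0)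
          (𝓝 (𝓕 (η : EuclideanSpace ℝ (Fin n) → ℂ)
            (ξ + (0 : ℝ) • EuclideanSpace.single i c))) :=
        Continuous.tendsto (hcont.comp (by fun_prop)) 0
      rw [zero_smul, add_zero] at this
      exact this.mono_left nhdsWithin_le_nhds
    obtain ⟨s, hs1, hs2⟩ := ((hlim.eventually_ne h0).and self_mem_nhdsWithin).exists
    have h1 := abs_le.2 (hη _ hs1 i)
    have h2 : (ξ + s • EuclideanSpace.single i c) i = ξ i + s * c := by simp
    rw [h2, hc s hs2] at h1
    have : (0 : ℝ) < s := hs2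
    linarith

  -- No aliasing: some coordinate of m/a has modulus at least 1/a, and subtracting a frequency of
  -- modulus at most 1 leaves at least 1/a - 1 ≥ B.
  have hzero : ∀ (σ : Equiv.Perm (Fin n)) (t : Fin n → ℝ), (∀ i, t i ∈ Set.Ico (0 : ℝ) 1) →
      ∀ m : Fin n → ℤ, m ≠ 0 → 𝓕 (η : EuclideanSpace ℝ (Fin n) → ℂ)
        (latticePoint a⁻¹ m - permFrequency σ t) = 0 := by
    intro σ t ht m hm
    obtain ⟨i, hi⟩ := Function.ne_iff.1 hm
    refine hopen _ ⟨i, ?_⟩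
    have h1 : |permFrequency σ t i| ≤ 1 := by
      have h2 := ht i
      have h3 := ht (σ.symm i)
      change |t (σ.symm i) - t i| ≤ 1
      rw [abs_le]
      constructor <;> linarith [h2.1, h2.2, h3.1, h3.2]
    have h4 : a⁻¹ ≤ |latticePoint a⁻¹ m i| := by
      rw [latticePoint_apply, abs_mul, abs_of_pos (inv_pos.2 ha)]
      have : (1 : ℝ) ≤ |(m i : ℝ)| := by exact_mod_cast Int.one_le_abs hi
      have := inv_pos.2 ha
      nlinarith
    have h5 : (1 - a) / a = a⁻¹ - 1 := by field_simp
    calc B ≤ a⁻¹ - 1 := h5 ▸ hB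
      _ ≤ |latticePoint a⁻¹ m i| - |permFrequency σ t i| := by linarith
      _ ≤ _ := abs_sub_abs_le_abs_sub _ _
  rw [integral_mul_sineDet η.integrable]
  have hnorm : ∀ (σ : Equiv.Perm (Fin n)) (t : Fin n → ℝ) (k : Fin n → ℤ),
      ‖(a : ℂ) ^ n * (η (latticePoint a k) * Complex.exp
        (2 * Real.pi * (inner ℝ (latticePoint a k) (permFrequency σ t) : ℝ) * Complex.I))‖ =
      a ^ n * ‖η (latticePoint a k)‖ := by
    intro σ t k
    have : (2 * Real.pi * (inner ℝ (latticePoint a k) (permFrequency σ t) : ℝ) * Complex.I : ℂ) =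
      ((2 * Real.pi * inner ℝ (latticePoint a k) (permFrequency σ t) : ℝ) : ℂ) * Complex.I := by
        push_cast; ring
    rw [norm_mul, norm_mul, this, Complex.norm_exp_ofReal_mul_I, mul_one, norm_pow,
      Complex.norm_real, Real.norm_of_nonneg ha.le]
  have hlat := (summable_norm_schwartz_lattice ha.ne' η).mul_left (a ^ n)
  have hint : ∀ (σ : Equiv.Perm (Fin n)) (k : Fin n → ℤ), Integrable (fun t =>
      (a : ℂ) ^ n * (η (latticePoint a k) * Complex.exp
        (2 * Real.pi * (inner ℝ (latticePoint a k) (permFrequency σ t) : ℝ) * Complex.I)))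
      (cubeMeasure n) := by
    intro σ k
    have := continuous_permFrequency σ
    exact Integrable.of_bound (Continuous.aestronglyMeasurable (by fun_prop)) _
      (Eventually.of_forall fun t => (hnorm σ t k).le)
  have hswap : ∀ σ : Equiv.Perm (Fin n),
      HasSum (fun k : Fin n → ℤ => ∫ t, (a : ℂ) ^ n * (η (latticePoint a k) * Complex.exp
        (2 * Real.pi * (inner ℝ (latticePoint a k) (permFrequency σ t) : ℝ) * Complex.I))
          ∂cubeMeasure n)
      (∫ t, 𝓕 (η : EuclideanSpace ℝ (Fin n) → ℂ) (-permFrequency σ t) ∂cubeMeasure n) := by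
    intro σ
    have h1 := hasSum_integral_of_summable_integral_norm (hint σ)
      (by simp only [hnorm]; simpa using hlat)
    have h2 : ∫ t, 𝓕 (η : EuclideanSpace ℝ (Fin n) → ℂ) (-permFrequency σ t) ∂cubeMeasure n =
        ∫ t, ∑' k : Fin n → ℤ, (a : ℂ) ^ n * (η (latticePoint a k) * Complex.exp
          (2 * Real.pi * (inner ℝ (latticePoint a k) (permFrequency σ t) : ℝ) * Complex.I))
            ∂cubeMeasure n := by
      rw [cubeMeasure_eq_restrict]
      refine setIntegral_congr_fun (MeasurableSet.univ_pi fun _ => measurableSet_Ico) fun t ht => ?_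
      exact (tsum_lattice_mul_exp ha η hc _ (hzero σ t fun i => ht i trivial)).symm
    rw [h2]
    exact h1
  have htot := hasSum_sum fun σ (_ : σ ∈ (Finset.univ : Finset (Equiv.Perm (Fin n)))) =>
    (hswap σ).mul_left ((Equiv.Perm.sign σ : ℤ) : ℂ)
  rw [← htot.tsum_eq]
  refine tsum_congr fun k => ?_
  rw [sineDet_eq_sum_integral, Finset.mul_sum, Finset.sum_mul]
  refine Finset.sum_congr rfl fun σ _ => ?_
  rw [integral_const_mul, integral_const_mul]
  ring

end BandLimited

end LatticeMimicry

namespace LatticeMimicry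

/-! ### The correlation formula beyond compactly supported test functions. -/

section SineProcess

open Filter Topology

variable {n : ℕ}

/-- Continuous cutoff functions that increase to `1`. -/
noncomputable def cutoff (R : ℕ) (x : EuclideanSpace ℝ (Fin n)) : ℝ :=
  max 0 (min 1 (R + 1 - ‖x‖))

lemma continuous_cutoff (R : ℕ) : Continuous (cutoff R : EuclideanSpace ℝ (Fin n) → ℝ) := by
  unfold cutoff
  fun_prop

lemma cutoff_nonneg (R : ℕ) (x : EuclideanSpace ℝ (Fin n)) : 0 ≤ cutoff R x := le_max_left _ _

lemma cutoff_le_one (R : ℕ) (x : EuclideanSpace ℝ (Fin n)) : cutoff R x ≤ 1 :=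
  max_le zero_le_one (min_le_left _ _)

lemma cutoff_eq_one {R : ℕ} {x : EuclideanSpace ℝ (Fin n)} (h : ‖x‖ ≤ R) : cutoff R x = 1 := by
  rw [cutoff, min_eq_left (by linarith), max_eq_right zero_le_one]

lemma hasCompactSupport_cutoff (R : ℕ) :
    HasCompactSupport (cutoff R : EuclideanSpace ℝ (Fin n) → ℝ) := by
  refine HasCompactSupport.intro (isCompact_closedBall 0 (R + 1)) fun x hx => ?_
  rw [mem_closedBall_zero_iff, not_le] at hx
  rw [cutoff, max_eq_left]
  exact (min_le_right _ _).trans (by linarith)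

lemma eventually_cutoff_eq_one (x : EuclideanSpace ℝ (Fin n)) :
    ∀ᶠ R : ℕ in atTop, cutoff R x = 1 := by
  filter_upwards [eventually_ge_atTop ⌈‖x‖⌉₊] with R hR
  exact cutoff_eq_one ((Nat.le_ceil _).trans (by exact_mod_cast hR))

/-- The correlation formula of the sine process for continuous integrable test functions. -/
theorem IsSineProcess.integral_distinctSum {P : PointProcess} (hP : IsSineProcess P) (hn : 1 ≤ n)
    {f : EuclideanSpace ℝ (Fin n) → ℂ} (hf : Continuous f) (hfi : Integrable f) :
    ∫ c, c.distinctSum f ∂(P : Measure Configuration) = ∫ x, f x * (sineDet x : ℂ) := by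
  let φ : ℕ → EuclideanSpace ℝ (Fin n) → ℂ := fun R x => f x * (cutoff R x : ℂ)
  let ψ : ℕ → EuclideanSpace ℝ (Fin n) → ℂ := fun R x => ((‖f x‖ * cutoff R x : ℝ) : ℂ)
  have hcc : ∀ R, Continuous (cutoff R : EuclideanSpace ℝ (Fin n) → ℝ) := continuous_cutoff
  have hφc : ∀ R, Continuous (φ R) := fun R => by have := hcc R; fun_prop
  have hψc : ∀ R, Continuous (ψ R) := fun R => by have := hcc R; fun_prop
  have hφs : ∀ R, HasCompactSupport (φ R) := fun R =>
    ((hasCompactSupport_cutoff R).comp_left (g := ((↑) : ℝ → ℂ)) Complex.ofReal_zero).mul_left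
  have hψs' : ∀ R, HasCompactSupport fun x : EuclideanSpace ℝ (Fin n) => ‖f x‖ * cutoff R x :=
    fun R => (hasCompactSupport_cutoff R).mul_left
  have hψs : ∀ R, HasCompactSupport (ψ R) := fun R =>
    (hψs' R).comp_left (g := ((↑) : ℝ → ℂ)) Complex.ofReal_zero
  have hdetb : ∀ x : EuclideanSpace ℝ (Fin n), ‖(sineDet x : ℂ)‖ ≤ n.factorial := fun x => by
    rw [Complex.norm_real]; exact abs_sineDet_le x
  have hdetc : Continuous fun x : EuclideanSpace ℝ (Fin n) => (sineDet x : ℂ) :=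
    Complex.continuous_ofReal.comp (continuous_sineDet n)
  let W : ℕ → Configuration → ℝ≥0∞ := fun R c =>
    ∑' s : Fin n ↪ c.Point, ENNReal.ofReal (‖f (c.positions s)‖ * cutoff R (c.positions s))
  let W' : Configuration → ℝ≥0∞ := fun c =>
    ∑' s : Fin n ↪ c.Point, ENNReal.ofReal ‖f (c.positions s)‖
  have hW : ∀ R c, W R c = ENNReal.ofReal ‖c.distinctSum (ψ R)‖ := by
    intro R c
    have hs : Summable fun s : Fin n ↪ c.Point =>
        ‖f (c.positions s)‖ * cutoff R (c.positions s) :=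
      summable_of_hasFiniteSupport (c.finite_support_positions (hψs' R))
    have h0 : ∀ s : Fin n ↪ c.Point, 0 ≤ ‖f (c.positions s)‖ * cutoff R (c.positions s) :=
      fun s => mul_nonneg (norm_nonneg _) (cutoff_nonneg _ _)
    rw [Configuration.distinctSum_eq]
    simp only [ψ]
    rw [← Complex.ofReal_tsum, Complex.norm_real, Real.norm_of_nonneg (tsum_nonneg h0),
      ENNReal.ofReal_tsum_of_nonneg h0 hs]
  have hWm : ∀ R, AEMeasurable (W R) (P : Measure Configuration) := by
    intro R
    simp only [funext (hW R)]
    exact (hP n hn (ψ R) (hψc R) (hψs R)).1.aestronglyMeasurable.norm.aemeasurable.ennreal_ofReal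
  have hWI : ∀ R, ∫⁻ c, W R c ∂(P : Measure Configuration) ≤
      ENNReal.ofReal ((∫ x, ‖f x‖) * n.factorial) := by
    intro R
    obtain ⟨h1, h2⟩ := hP n hn (ψ R) (hψc R) (hψs R)
    have h0 : ∀ c : Configuration, (‖c.distinctSum (ψ R)‖ : ℂ) = c.distinctSum (ψ R) := by
      intro c
      rw [Configuration.distinctSum_eq]
      simp only [ψ]
      rw [← Complex.ofReal_tsum, Complex.norm_real, Real.norm_of_nonneg]
      exact tsum_nonneg fun s => mul_nonneg (norm_nonneg _) (cutoff_nonneg _ _)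
    simp only [hW]
    rw [← ofReal_integral_eq_lintegral_ofReal h1.norm (Eventually.of_forall fun _ => norm_nonneg _)]
    refine ENNReal.ofReal_le_ofReal ?_
    have h3 : ((∫ c, ‖c.distinctSum (ψ R)‖ ∂(P : Measure Configuration) : ℝ) : ℂ) =
        ∫ x, ψ R x * (sineDet x : ℂ) := by
      rw [← h2, ← integral_complex_ofReal]
      simp only [h0]
    calc ∫ c, ‖c.distinctSum (ψ R)‖ ∂(P : Measure Configuration)
        ≤ ‖((∫ c, ‖c.distinctSum (ψ R)‖ ∂(P : Measure Configuration) : ℝ) : ℂ)‖ := by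
          rw [Complex.norm_real]; exact le_abs_self _
      _ = ‖∫ x, ψ R x * (sineDet x : ℂ)‖ := by rw [h3]
      _ ≤ ∫ x, ‖f x‖ * n.factorial := by
          refine norm_integral_le_of_norm_le (hfi.norm.mul_const _) (Eventually.of_forall fun x => ?_)
          rw [norm_mul]
          refine mul_le_mul ?_ (hdetb x) (norm_nonneg _) (norm_nonneg _)
          simp only [ψ]
          rw [Complex.norm_real, Real.norm_of_nonneg
            (mul_nonneg (norm_nonneg _) (cutoff_nonneg _ _))]
          exact mul_le_of_le_one_right (norm_nonneg _) (cutoff_le_one _ _)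
      _ = _ := integral_mul_const _ _
  have hWle : ∀ R c, W R c ≤ W' c := fun R c => ENNReal.tsum_le_tsum fun s =>
    ENNReal.ofReal_le_ofReal (mul_le_of_le_one_right (norm_nonneg _) (cutoff_le_one _ _))
  have hWlim : ∀ c, Tendsto (fun R => W R c) atTop (𝓝 (W' c)) := by
    intro c
    refine tendsto_of_le_liminf_of_limsup_le ?_ ?_
    · rw [show W' c = _ from ENNReal.tsum_eq_iSup_sum]
      refine iSup_le fun t => ?_
      have h1 : ∀ᶠ R : ℕ in atTop, ∀ s ∈ t, cutoff R (c.positions s) = 1 :=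
        (Finset.eventually_all t).2 fun s _ => eventually_cutoff_eq_one _
      refine le_liminf_of_le (by isBoundedDefault) ?_
      filter_upwards [h1] with R hR
      refine le_trans (le_of_eq (Finset.sum_congr rfl fun s hs => ?_)) (ENNReal.sum_le_tsum t)
      rw [hR s hs, mul_one]
    · exact limsup_le_of_le (by isBoundedDefault) (Eventually.of_forall fun R => hWle R c)
  have hW'm : AEMeasurable W' (P : Measure Configuration) :=
    aemeasurable_of_tendsto_metrizable_ae atTop hWm (Eventually.of_forall hWlim)
  -- Fatou's lemma turns the uniform bound on the truncated sums into integrability of the full sum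
  -- of absolute values, which dominates the limits below.
  have hW'I : ∫⁻ c, W' c ∂(P : Measure Configuration) ≠ ∞ := by
    refine ne_top_of_le_ne_top ENNReal.ofReal_ne_top
      (b := ENNReal.ofReal ((∫ x, ‖f x‖) * n.factorial)) ?_
    calc ∫⁻ c, W' c ∂(P : Measure Configuration)
        = ∫⁻ c, liminf (fun R => W R c) atTop ∂(P : Measure Configuration) := by
          simp only [fun c => (hWlim c).liminf_eq]
      _ ≤ liminf (fun R => ∫⁻ c, W R c ∂(P : Measure Configuration)) atTop :=
          lintegral_liminf_le' hWm
      _ ≤ _ := liminf_le_of_le (by isBoundedDefault) fun b hb => by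
          obtain ⟨R, hR⟩ := hb.exists
          exact hR.trans (hWI R)
  have hfin : ∀ᵐ c ∂(P : Measure Configuration), W' c < ∞ := ae_lt_top' hW'm hW'I
  have hlimL : Tendsto (fun R => ∫ c, c.distinctSum (φ R) ∂(P : Measure Configuration)) atTop
      (𝓝 (∫ c, c.distinctSum f ∂(P : Measure Configuration))) := by
    refine tendsto_integral_of_dominated_convergence (fun c => (W' c).toReal)
      (fun R => (hP n hn (φ R) (hφc R) (hφs R)).1.aestronglyMeasurable)
      (integrable_toReal_of_lintegral_ne_top hW'm hW'I) (fun R => ?_) ?_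
    · filter_upwards [hfin] with c hc
      have hsum : Summable fun s : Fin n ↪ c.Point => ‖f (c.positions s)‖ := by
        have := ENNReal.summable_toReal hc.ne
        simpa using this
      have htr : (W' c).toReal = ∑' s : Fin n ↪ c.Point, ‖f (c.positions s)‖ := by
        rw [ENNReal.tsum_toReal_eq fun _ => ENNReal.ofReal_ne_top]
        simp
      rw [htr]
      refine tsum_of_norm_bounded hsum.hasSum fun s => ?_
      change ‖f (c.positions s) * (cutoff R (c.positions s) : ℂ)‖ ≤ _
      rw [norm_mul, Complex.norm_real, Real.norm_of_nonneg (cutoff_nonneg _ _)]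
      exact mul_le_of_le_one_right (norm_nonneg _) (cutoff_le_one _ _)
    · filter_upwards [hfin] with c hc
      have hsum : Summable fun s : Fin n ↪ c.Point => ‖f (c.positions s)‖ := by
        have := ENNReal.summable_toReal hc.ne
        simpa using this
      refine tendsto_tsum_of_dominated_convergence hsum (fun s => ?_)
        (Eventually.of_forall fun R s => ?_)
      · refine tendsto_const_nhds.congr' ?_
        filter_upwards [eventually_cutoff_eq_one (c.positions s)] with R hR
        change f (c.positions s) = f (c.positions s) * (cutoff R (c.positions s) : ℂ)
        rw [hR]; simp
      · change ‖f (c.positions s) * (cutoff R (c.positions s) : ℂ)‖ ≤ _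
        rw [norm_mul, Complex.norm_real, Real.norm_of_nonneg (cutoff_nonneg _ _)]
        exact mul_le_of_le_one_right (norm_nonneg _) (cutoff_le_one _ _)
  have hlimR : Tendsto (fun R => ∫ x, φ R x * (sineDet x : ℂ)) atTop
      (𝓝 (∫ x, f x * (sineDet x : ℂ))) := by
    refine tendsto_integral_of_dominated_convergence (fun x => ‖f x‖ * n.factorial)
      (fun R => ((hφc R).mul hdetc).aestronglyMeasurable) (hfi.norm.mul_const _)
      (fun R => Eventually.of_forall fun x => ?_) (Eventually.of_forall fun x => ?_)
    · rw [norm_mul]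
      refine mul_le_mul ?_ (hdetb x) (norm_nonneg _) (norm_nonneg _)
      simp only [φ]
      rw [norm_mul, Complex.norm_real, Real.norm_of_nonneg (cutoff_nonneg _ _)]
      exact mul_le_of_le_one_right (norm_nonneg _) (cutoff_le_one _ _)
    · refine tendsto_const_nhds.congr' ?_
      filter_upwards [eventually_cutoff_eq_one x] with R hR
      simp only [φ, hR, Complex.ofReal_one, mul_one]
  refine tendsto_nhds_unique hlimL (hlimR.congr fun R => ?_)
  exact (hP n hn (φ R) (hφc R) (hφs R)).2.symm

end SineProcess

end LatticeMimicry

namespace LatticeMimicry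

/-! ### Uniform local moments of both processes. -/

section LocalMoments

open Filter Topology

/-- The centre of the cube `[L, L + 1]ⁿ`. -/
noncomputable def cubeCentre (n : ℕ) (L : ℝ) : EuclideanSpace ℝ (Fin n) :=
  WithLp.toLp 2 fun _ => L + 1 / 2

/-- A smooth bump function that is `1` on the cube `[L, L + 1]ⁿ`. -/
noncomputable def cubeBump (n : ℕ) (L : ℝ) : ContDiffBump (cubeCentre n L) where
  -- Any radius at least √n/2, the half-diagonal of the cube, would do.
  rIn := n + 1
  rOut := n + 2
  rIn_pos := by positivity
  rIn_lt_rOut := by linarith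

lemma cubeBump_eq_one {n : ℕ} {L : ℝ} {x : EuclideanSpace ℝ (Fin n)}
    (hx : ∀ i, x i ∈ Set.Icc L (L + 1)) : cubeBump n L x = 1 := by
  refine (cubeBump n L).one_of_mem_closedBall ?_
  rw [mem_closedBall_iff_norm]
  change _ ≤ (n : ℝ) + 1
  refine abs_le_of_sq_le_sq' ?_ (by positivity) |>.2
  rw [EuclideanSpace.real_norm_sq_eq]
  calc ∑ i, ((x - cubeCentre n L) i) ^ 2 ≤ ∑ _i : Fin n, (1 : ℝ) := by
        refine Finset.sum_le_sum fun i _ => ?_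
        have h := hx i
        have e : (x - cubeCentre n L) i = x i - (L + 1 / 2) := rfl
        rw [e]
        nlinarith [h.1, h.2]
    _ = n := by simp
    _ ≤ (n + 1) ^ 2 := by nlinarith [(Nat.cast_nonneg n : (0 : ℝ) ≤ n)]

lemma cubeBump_translate (n : ℕ) (L : ℝ) (x : EuclideanSpace ℝ (Fin n)) :
    cubeBump n L x = cubeBump n 0 (x - (cubeCentre n L - cubeCentre n 0)) := by
  have h : x - (cubeCentre n L - cubeCentre n 0) - cubeCentre n 0 = x - cubeCentre n L := by abel
  rw [ContDiffBump.apply, ContDiffBump.apply, h]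
  rfl

lemma hasCompactSupport_cubeBump (n : ℕ) (L : ℝ) :
    HasCompactSupport fun x => (cubeBump n L x : ℂ) :=
  (cubeBump n L).hasCompactSupport.comp_left (g := ((↑) : ℝ → ℂ)) Complex.ofReal_zero

lemma contDiff_cubeBump (n : ℕ) (L : ℝ) :
    ContDiff ℝ (⊤ : ℕ∞) fun x => (cubeBump n L x : ℂ) :=
  Complex.ofRealCLM.contDiff.comp (cubeBump n L).contDiff

/-- The sine determinant is bounded by n!, and the bumps are translates of one another, so the bound
is independent of L. -/
theorem IsSineProcess.uniformLocalMoments {P : PointProcess} (hP : IsSineProcess P) :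
    UniformLocalMoments P := by
  refine uniformLocalMoments_of_bump P fun n hn =>
    ⟨(∫ x, cubeBump n 0 x) * n.factorial, fun L => ⟨cubeBump n L, (cubeBump n L).hasCompactSupport,
      fun x => (cubeBump n L).nonneg, fun x hx => (cubeBump_eq_one hx).ge, ?_⟩⟩
  obtain ⟨h1, h2⟩ := hP n hn _ (contDiff_cubeBump n L).continuous (hasCompactSupport_cubeBump n L)
  refine ⟨h1, ?_⟩
  rw [h2]
  have hint : Integrable (cubeBump n L) :=
    (cubeBump n L).continuous.integrable_of_hasCompactSupport (cubeBump n L).hasCompactSupport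
  calc ‖∫ x, (cubeBump n L x : ℂ) * (sineDet x : ℂ)‖
      ≤ ∫ x, cubeBump n L x * n.factorial := by
        refine norm_integral_le_of_norm_le (hint.mul_const _) (Eventually.of_forall fun x => ?_)
        rw [norm_mul, Complex.norm_real, Complex.norm_real,
          Real.norm_of_nonneg (cubeBump n L).nonneg]
        exact mul_le_mul_of_nonneg_left (abs_sineDet_le x) (cubeBump n L).nonneg
    _ = (∫ x, cubeBump n L x) * n.factorial := integral_mul_const _ _
    _ = (∫ x, cubeBump n 0 x) * n.factorial := by
        simp only [cubeBump_translate n L]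
        rw [integral_sub_right_eq_self]

theorem IsDiscreteSineProcess.uniformLocalMoments {a : ℝ} (ha : 0 < a) {Q : PointProcess}
    (hQ : IsDiscreteSineProcess a Q) : UniformLocalMoments Q := by
  refine uniformLocalMoments_of_bump Q fun n hn =>
    ⟨(2 * (n + 2) / a + 1) ^ n * (a ^ n * n.factorial),
      fun L => ⟨cubeBump n L, (cubeBump n L).hasCompactSupport,
      fun x => (cubeBump n L).nonneg, fun x hx => (cubeBump_eq_one hx).ge, ?_⟩⟩
  obtain ⟨h1, h2⟩ := hQ.2 n hn
    ((hasCompactSupport_cubeBump n L).toSchwartzMap (contDiff_cubeBump n L))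
  refine ⟨h1, ?_⟩
  change ‖∫ c, c.distinctSum ((hasCompactSupport_cubeBump n L).toSchwartzMap
    (contDiff_cubeBump n L)) ∂(Q : Measure Configuration)‖ ≤ _
  rw [h2]
  -- Lattice points with every coordinate within the outer radius n + 2 of the centre; their number
  -- is bounded independently of L.
  let T : Finset (Fin n → ℤ) := Fintype.piFinset fun _ =>
    Finset.Icc ⌈(L + 1 / 2 - (n + 2)) / a⌉ ⌊(L + 1 / 2 + (n + 2)) / a⌋
  have hT : ∀ k ∉ T, cubeBump n L (latticePoint a k) = 0 := by
    intro k hk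
    refine (cubeBump n L).zero_of_le_dist ?_
    change (n : ℝ) + 2 ≤ _
    by_contra hlt
    rw [not_le, dist_eq_norm] at hlt
    refine hk (Fintype.mem_piFinset.2 fun i => ?_)
    have h3 : ‖(latticePoint a k - cubeCentre n L) i‖ ≤ ‖latticePoint a k - cubeCentre n L‖ :=
      PiLp.norm_apply_le _ i
    have e : (latticePoint a k - cubeCentre n L) i = a * k i - (L + 1 / 2) := rfl
    rw [e, Real.norm_eq_abs] at h3
    obtain ⟨h4, h5⟩ := abs_le.1 (h3.trans hlt.le)
    rw [Finset.mem_Icc, Int.ceil_le, Int.le_floor, div_le_iff₀ ha, le_div_iff₀ ha]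
    constructor <;> linarith
  have hcard : (T.card : ℝ) ≤ (2 * (n + 2) / a + 1) ^ n := by
    rw [Fintype.card_piFinset_const, Int.card_Icc, Nat.cast_pow]
    refine pow_le_pow_left₀ (by positivity) ?_ n
    have h3 := Int.le_ceil ((L + 1 / 2 - (n + 2)) / a)
    have h4 := Int.floor_le ((L + 1 / 2 + (n + 2)) / a)
    have h5 : ((L + 1 / 2 + (n + 2)) / a) - ((L + 1 / 2 - (n + 2)) / a) = 2 * (n + 2) / a := by
      field_simp; ring
    have h6 : (0 : ℝ) ≤ 2 * (n + 2) / a := by positivity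
    rw [← Int.cast_natCast, Int.toNat_eq_max]
    push_cast
    exact max_le (by linarith) (by linarith)
  rw [tsum_eq_sum (s := T)]
  · calc ‖∑ k ∈ T, (a : ℂ) ^ n * (sineDet (latticePoint a k) : ℂ) *
          (cubeBump n L (latticePoint a k) : ℂ)‖
        ≤ ∑ k ∈ T, a ^ n * n.factorial := by
          refine norm_sum_le_of_le _ fun k _ => ?_
          rw [norm_mul, norm_mul, norm_pow, Complex.norm_real, Complex.norm_real,
            Complex.norm_real, Real.norm_of_nonneg (cubeBump n L).nonneg,
            Real.norm_of_nonneg ha.le, Real.norm_eq_abs]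
          have h3 := abs_sineDet_le (latticePoint a k)
          calc a ^ n * |sineDet (latticePoint a k)| * cubeBump n L (latticePoint a k)
              ≤ a ^ n * |sineDet (latticePoint a k)| * 1 := by
                gcongr; exact (cubeBump n L).le_one
            _ ≤ _ := by rw [mul_one]; gcongr
      _ = T.card * (a ^ n * n.factorial) := by rw [Finset.sum_const, nsmul_eq_mul]
      _ ≤ _ := by gcongr
  · intro k hk
    change _ * (cubeBump n L (latticePoint a k) : ℂ) = 0
    rw [hT k hk]
    simp

end LocalMoments

/-! ### Mimicry by the discrete sine process. -/

section Mimicry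

theorem IsDiscreteSineProcess.mimics {a B : ℝ} (ha : 0 < a) (hB : B ≤ (1 - a) / a)
    {P Q : PointProcess} (hQ : IsDiscreteSineProcess a Q) (hP : IsSineProcess P) :
    Mimics Q P B := by
  refine ⟨hQ.uniformLocalMoments ha, hP.uniformLocalMoments, fun n hn η hη => ?_⟩
  rw [hP.integral_distinctSum hn η.continuous η.integrable, (hQ.2 n hn η).2,
    tsum_lattice_mul_sineDet ha hB η hη]

end Mimicry

end LatticeMimicry

open scoped SchwartzMap

namespace LatticeMimicry

/-! ### Test functions prescribed by their Fourier transforms. -/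

section TestFunctions

variable {n : ℕ}

/-- A smooth compactly supported function is the Fourier transform of a Schwartz function. -/
lemma exists_schwartz_fourier_eq {Ψ : EuclideanSpace ℝ (Fin n) → ℂ} (h1 : HasCompactSupport Ψ)
    (h2 : ContDiff ℝ (⊤ : ℕ∞) Ψ) :
    ∃ η : 𝓢(EuclideanSpace ℝ (Fin n), ℂ), 𝓕 (η : EuclideanSpace ℝ (Fin n) → ℂ) = Ψ ∧
      (η : EuclideanSpace ℝ (Fin n) → ℂ) = 𝓕⁻ Ψ := by
  refine ⟨𝓕⁻ (h1.toSchwartzMap h2), ?_, ?_⟩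
  · rw [← SchwartzMap.fourier_coe, FourierTransform.fourier_fourierInv_eq]
    rfl
  · rw [SchwartzMap.fourierInv_coe]
    rfl

/-- For c in a⁻¹ℤⁿ the character is 1 on aℤⁿ: translating the transform by such a vector is
invisible on the lattice. -/
lemma fourierInv_translate (f : EuclideanSpace ℝ (Fin n) → ℂ) (c x : EuclideanSpace ℝ (Fin n)) :
    𝓕⁻ (fun ξ => f (ξ - c)) x =
      Complex.exp ((2 * Real.pi * inner ℝ c x : ℝ) * Complex.I) * 𝓕⁻ f x := by
  rw [Real.fourierInv_eq', Real.fourierInv_eq', ← integral_const_mul,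
    ← integral_add_right_eq_self _ c]
  congr 1
  funext ξ
  rw [add_sub_cancel_right, smul_eq_mul, smul_eq_mul, ← mul_assoc, ← Complex.exp_add,
    inner_add_left]
  congr 2
  push_cast
  ring

/-- Test functions that agree on the lattice have the same distinct sums over a process supported
on the lattice. -/
lemma integral_distinctSum_congr {a : ℝ} {Q : PointProcess} (hQ : SupportedOnLattice a Q)
    {f g : EuclideanSpace ℝ (Fin n) → ℂ}
    (h : ∀ k : Fin n → ℤ, f (latticePoint a k) = g (latticePoint a k)) :
    ∫ c, c.distinctSum f ∂(Q : Measure Configuration) =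
      ∫ c, c.distinctSum g ∂(Q : Measure Configuration) := by
  refine integral_congr_ae ?_
  filter_upwards [hQ] with c hc
  refine tsum_congr fun s => ?_
  have hk : ∀ i, ∃ k : ℤ, (s i).pos = a * k := fun i =>
    hc _ fun h0 => absurd (lt_of_lt_of_eq (s i).2.2 h0) (Nat.not_lt_zero _)
  choose k hk using hk
  have e : (WithLp.toLp 2 fun i => (s i).pos) = latticePoint a k := by
    ext i
    exact hk i
  rw [e, h]

end TestFunctions

/-! ### Non-mimicry for a ≤ 1/2, by aliasing. -/

section AliasingObstruction

/-- The sine process sees only frequencies on this hyperplane, so a bump away from it has zero mean.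
-/
lemma sum_permFrequency {n : ℕ} (σ : Equiv.Perm (Fin n)) (t : Fin n → ℝ) :
    ∑ i, permFrequency σ t i = 0 := by
  simp only [permFrequency, Finset.sum_sub_distrib]
  rw [Equiv.sum_comp σ.symm t, sub_self]

lemma cubeMeasure_integral_pos {n : ℕ} {f : (Fin n → ℝ) → ℝ} (hf : Continuous f)
    (h0 : ∀ t, 0 ≤ f t) {C : ℝ} (hC : ∀ t, f t ≤ C) {t : Fin n → ℝ}
    (ht : ∀ i, t i ∈ Set.Ioo (0 : ℝ) 1) (hft : f t ≠ 0) : 0 < ∫ t, f t ∂cubeMeasure n := by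
  have hint : Integrable f (cubeMeasure n) :=
    Integrable.of_bound hf.aestronglyMeasurable C
      (Filter.Eventually.of_forall fun t => by rw [Real.norm_of_nonneg (h0 t)]; exact hC t)
  rw [integral_pos_iff_support_of_nonneg h0 hint, cubeMeasure_eq_restrict,
    Measure.restrict_apply hf.isOpen_support.measurableSet]
  have hU : IsOpen (Function.support f ∩ Set.univ.pi fun _ : Fin n => Set.Ioo (0 : ℝ) 1) :=
    hf.isOpen_support.inter (isOpen_set_pi Set.finite_univ fun _ _ => isOpen_Ioo)
  refine (hU.measure_pos volume ⟨t, hft, fun i _ => ht i⟩).trans_le (measure_mono ?_)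
  exact Set.inter_subset_inter_right _ (Set.pi_mono fun _ _ => Set.Ioo_subset_Ico_self)

theorem not_isMimickedOnLattice_of_le_half {a B : ℝ} (ha : 0 < a) (ha2 : a ≤ 1 / 2)
    (hB : (1 - a) / a < B) {P : PointProcess} (hP : IsSineProcess P) :
    ¬ IsMimickedOnLattice P a B := by
  rintro ⟨Q, -, hQ, -, -, hmim⟩
  have hinv : 2 ≤ a⁻¹ := by
    rw [le_inv_comm₀ two_pos ha]; linarith
  have hB' : a⁻¹ - 1 < B := by
    have : (1 - a) / a = a⁻¹ - 1 := by field_simp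
    linarith
  -- The bound 1/4 keeps the bumps away from the origin and from the zero-sum hyperplane where
  -- required; the other bound fits the translated bump, which reaches 1/a - 1 + 2r, into the band.
  obtain ⟨r, hr0, hr4, hrB⟩ : ∃ r : ℝ, 0 < r ∧ r ≤ 1 / 4 ∧ 2 * r ≤ B - (a⁻¹ - 1) :=
    ⟨min (1 / 4) ((B - (a⁻¹ - 1)) / 2), lt_min (by norm_num) (by linarith), min_le_left _ _, by
      have := min_le_right (1 / 4) ((B - (a⁻¹ - 1)) / 2); linarith⟩
  -- The centre c' is close to (-1, 1), an extreme frequency of the transposition, and v is a vector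
  -- of the dual lattice a⁻¹ℤ². Translation by v brings the first coordinate to just above 1/a - 1.
  let c' : EuclideanSpace ℝ (Fin 2) := !₂[-(1 - r), 1 - r]
  let v : EuclideanSpace ℝ (Fin 2) := !₂[a⁻¹, 0]
  let b : ContDiffBump (0 : EuclideanSpace ℝ (Fin 2)) := ⟨r / 2, r, by linarith, by linarith⟩
  have hb : ∀ ξ : EuclideanSpace ℝ (Fin 2), b ξ ≠ 0 → ∀ i, |ξ i| < r := by
    intro ξ hξ i
    have h1 : ξ ∈ Function.support b := hξ
    rw [b.support_eq, mem_ball_zero_iff] at h1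
    exact (PiLp.norm_apply_le ξ i).trans_lt h1
  have hbc : ∀ c : EuclideanSpace ℝ (Fin 2), HasCompactSupport fun ξ => (b (ξ - c) : ℂ) := fun c =>
    (b.hasCompactSupport.comp_left (g := ((↑) : ℝ → ℂ)) Complex.ofReal_zero).comp_homeomorph
      (Homeomorph.subRight c)
  have hbs : ∀ c : EuclideanSpace ℝ (Fin 2), ContDiff ℝ (⊤ : ℕ∞) fun ξ => (b (ξ - c) : ℂ) := fun c =>
    Complex.ofRealCLM.contDiff.comp (b.contDiff.comp (contDiff_id.sub contDiff_const))
  obtain ⟨η', hη'F, hη'⟩ := exists_schwartz_fourier_eq (hbc c') (hbs c')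
  obtain ⟨η, hηF, hη⟩ := exists_schwartz_fourier_eq (hbc (c' + v)) (hbs (c' + v))
  have hlat : ∀ k : Fin 2 → ℤ, η (latticePoint a k) = η' (latticePoint a k) := by
    intro k
    rw [hη, hη', fourierInv_translate (fun ξ => (b ξ : ℂ)) (c' + v),
      fourierInv_translate (fun ξ => (b ξ : ℂ)) c', inner_add_left]
    have h1 : inner ℝ v (latticePoint a k) = (k 0 : ℝ) := by
      rw [PiLp.inner_apply, Fin.sum_univ_two]
      simp [v, latticePoint_apply]
      field_simp
    have h2 : ((2 * Real.pi * (inner ℝ c' (latticePoint a k) + inner ℝ v (latticePoint a k)) : ℝ) :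
        ℂ) * Complex.I = ((2 * Real.pi * inner ℝ c' (latticePoint a k) : ℝ) : ℂ) * Complex.I +
          (k 0 : ℂ) * (2 * Real.pi * Complex.I) := by
      rw [h1]; push_cast; ring
    rw [h2, Complex.exp_add, Complex.exp_int_mul_two_pi_mul_I, mul_one]
  have hc0 : ∀ ξ : EuclideanSpace ℝ (Fin 2), (ξ - c') 0 = ξ 0 + (1 - r) ∧ (ξ - c') 1 = ξ 1 - (1 - r) := fun ξ => by
    constructor
    · change ξ 0 - -(1 - r) = _
      ring
    · rfl
  have hv0 : ∀ ξ : EuclideanSpace ℝ (Fin 2), (ξ - (c' + v)) 0 = ξ 0 + (1 - r) - a⁻¹ ∧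
      (ξ - (c' + v)) 1 = ξ 1 - (1 - r) := fun ξ => by
    constructor
    · change ξ 0 - (-(1 - r) + a⁻¹) = _
      ring
    · change ξ 1 - (1 - r + 0) = _
      ring
  -- The bump at c' reaches modulus 1, and a ≤ 1/2 gives 1 ≤ 1/a - 1 < B.
  have hbox' : ∀ ξ : EuclideanSpace ℝ (Fin 2), 𝓕 (η' : EuclideanSpace ℝ (Fin 2) → ℂ) ξ ≠ 0 → ∀ i, ξ i ∈ Set.Icc (-B) B := by
    intro ξ hξ i
    rw [hη'F] at hξ
    have h := hb (ξ - c') (by simpa using hξ)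
    have h0 := abs_lt.1 (h 0)
    have h1 := abs_lt.1 (h 1)
    rw [(hc0 ξ).1] at h0
    rw [(hc0 ξ).2] at h1
    fin_cases i
    · exact ⟨by simp; linarith, by simp; linarith⟩
    · exact ⟨by simp; linarith, by simp; linarith⟩
  have hbox : ∀ ξ : EuclideanSpace ℝ (Fin 2), 𝓕 (η : EuclideanSpace ℝ (Fin 2) → ℂ) ξ ≠ 0 → ∀ i, ξ i ∈ Set.Icc (-B) B := by
    intro ξ hξ i
    rw [hηF] at hξ
    have h := hb (ξ - (c' + v)) (by simpa using hξ)
    have h0 := abs_lt.1 (h 0)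
    have h1 := abs_lt.1 (h 1)
    rw [(hv0 ξ).1] at h0
    rw [(hv0 ξ).2] at h1
    fin_cases i
    · exact ⟨by simp; linarith, by simp; linarith⟩
    · exact ⟨by simp; linarith, by simp; linarith⟩
  have hQeq := integral_distinctSum_congr hQ hlat
  rw [← hmim 2 one_le_two η hbox, ← hmim 2 one_le_two η' hbox',
    hP.integral_distinctSum one_le_two η.continuous η.integrable,
    hP.integral_distinctSum one_le_two η'.continuous η'.integrable,
    integral_mul_sineDet η.integrable, integral_mul_sineDet η'.integrable] at hQeq
  -- The coordinates of c' + v add up to 1/a ≥ 2, those of a sampled frequency to 0, and the bump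
  -- allows a discrepancy below 2r ≤ 1/2.
  have hzero : ∀ (σ : Equiv.Perm (Fin 2)) (t : Fin 2 → ℝ),
      𝓕 (η : EuclideanSpace ℝ (Fin 2) → ℂ) (-permFrequency σ t) = 0 := by
    intro σ t
    rw [hηF]
    by_contra h0
    have h := hb (-permFrequency σ t - (c' + v)) (by simpa using h0)
    have h0 := abs_lt.1 (h 0)
    have h1 := abs_lt.1 (h 1)
    rw [(hv0 _).1] at h0
    rw [(hv0 _).2] at h1
    have hs := sum_permFrequency σ t
    rw [Fin.sum_univ_two] at hs
    simp only [PiLp.neg_apply] at h0 h1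
    linarith
  -- The identity permutation samples only the origin, which is outside the bump at c'.
  have hone : ∀ t : Fin 2 → ℝ, 𝓕 (η' : EuclideanSpace ℝ (Fin 2) → ℂ) (-permFrequency 1 t) = 0 := by
    intro t
    rw [hη'F]
    by_contra h0
    have h := abs_lt.1 (hb (-permFrequency 1 t - c') (by simpa using h0) 1)
    rw [(hc0 _).2] at h
    have : permFrequency 1 t 1 = 0 := sub_self (t 1)
    simp only [PiLp.neg_apply, this] at h
    linarith
  have huniv : (Finset.univ : Finset (Equiv.Perm (Fin 2))) = {1, Equiv.swap 0 1} := by decide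
  have hne : (1 : Equiv.Perm (Fin 2)) ≠ Equiv.swap 0 1 := by decide
  simp only [hzero, integral_zero, mul_zero, Finset.sum_const_zero] at hQeq
  rw [huniv, Finset.sum_pair hne] at hQeq
  simp only [hone, integral_zero, mul_zero, zero_add] at hQeq
  -- At t = (r/2, 1 - r/2) the transposition samples the centre c' exactly, so its contribution does
  -- not vanish.
  have hpos : 0 < ∫ t, b (-permFrequency (Equiv.swap 0 1) t - c') ∂cubeMeasure 2 := by
    have hcont : Continuous fun t : Fin 2 → ℝ => b (-permFrequency (Equiv.swap 0 1) t - c') := by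
      have := continuous_permFrequency (Equiv.swap (0 : Fin 2) 1)
      exact b.continuous.comp (by fun_prop)
    refine cubeMeasure_integral_pos hcont (fun _ => b.nonneg) (fun _ => b.le_one)
      (t := ![r / 2, 1 - r / 2]) ?_ ?_
    · intro i
      fin_cases i
      · exact ⟨by simp; linarith, by simp; linarith⟩
      · exact ⟨by simp; linarith, by simp; linarith⟩
    · have : -permFrequency (Equiv.swap 0 1) ![r / 2, 1 - r / 2] - c' = 0 := by
        have h0 : (-permFrequency (Equiv.swap 0 1) ![r / 2, 1 - r / 2] - c') 0 = 0 := by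
          rw [(hc0 _).1]
          simp only [PiLp.neg_apply, permFrequency, Equiv.symm_swap, Equiv.swap_apply_left,
            Matrix.cons_val_zero, Matrix.cons_val_one]
          ring
        have h1 : (-permFrequency (Equiv.swap 0 1) ![r / 2, 1 - r / 2] - c') 1 = 0 := by
          rw [(hc0 _).2]
          simp only [PiLp.neg_apply, permFrequency, Equiv.symm_swap, Equiv.swap_apply_right,
            Matrix.cons_val_zero, Matrix.cons_val_one]
          ring
        ext i
        fin_cases i
        exacts [h0, h1]
      rw [this, b.one_of_mem_closedBall (by simp [b.rIn_pos.le])]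
      exact one_ne_zero
  rw [hη'F] at hQeq
  rw [integral_complex_ofReal] at hQeq
  have hsign : ((Equiv.Perm.sign (Equiv.swap (0 : Fin 2) 1) : ℤ) : ℂ) ≠ 0 := by simp
  have h0 := (mul_eq_zero.1 hQeq.symm).resolve_left hsign
  exact hpos.ne' (by exact_mod_cast h0)

end AliasingObstruction

end LatticeMimicry

namespace LatticeMimicry

/-! ### Finite Fredholm expansions and Hadamard's inequality. -/

section FredholmDeterminant

open Matrix Filter Topology

/-- Hadamard's inequality. -/
lemma abs_det_le_pow {n : ℕ} (M : Matrix (Fin n) (Fin n) ℝ) {b : ℝ} (h : ∀ i j, |M i j| ≤ b) :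
    |M.det| ≤ (b * √n) ^ n := by
  have hfact : Fact (Module.finrank ℝ (EuclideanSpace ℝ (Fin n)) = n) := ⟨by simp⟩
  let B := EuclideanSpace.basisFun (Fin n) ℝ
  let o := B.toBasis.orientation
  let v : Fin n → EuclideanSpace ℝ (Fin n) := fun j => WithLp.toLp 2 fun i => M i j
  have h1 := o.abs_volumeForm_apply_le v
  rw [o.volumeForm_robust' B, Module.Basis.det_apply] at h1
  have e : B.toBasis.toMatrix v = M := by
    ext i j
    simp [B, v, Module.Basis.toMatrix_apply]
  rw [e] at h1
  refine h1.trans ((Finset.prod_le_prod (fun _ _ => norm_nonneg _) fun j _ => ?_).trans_eq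
    (by simp : ∏ _j : Fin n, b * √n = _))
  have hb : 0 ≤ b := (abs_nonneg _).trans (h j j)
  rw [EuclideanSpace.norm_eq]
  refine Real.sqrt_le_iff.2 ⟨by positivity, ?_⟩
  rw [mul_pow, Real.sq_sqrt (Nat.cast_nonneg _)]
  refine (Finset.sum_le_card_nsmul Finset.univ _ (b ^ 2) fun i _ => ?_).trans_eq
    (by simp [mul_comm])
  exact pow_le_pow_left₀ (norm_nonneg _) (h i j) 2

/-- The sums of the determinants of submatrices, in terms of principal minors. -/
lemma sum_det_submatrix {ι : Type*} [Fintype ι] [DecidableEq ι] (M : Matrix ι ι ℝ) (n : ℕ) :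
    ∑ k : Fin n → ι, (M.submatrix k k).det =
      (n.factorial : ℝ) * ∑ s : Finset ι with s.card = n,
        (M.submatrix (Subtype.val : s → ι) Subtype.val).det := by
  -- A tuple with a repetition gives two equal rows; every subset of size n has n! injective
  -- enumerations, all with the same minor.
  have h0 : ∑ k : Fin n → ι, (M.submatrix k k).det =
      ∑ k : Fin n → ι with Function.Injective k, (M.submatrix k k).det := by
    refine (Finset.sum_filter_of_ne fun k _ hk => ?_).symm
    by_contra hinj
    simp only [Function.Injective, not_forall] at hinj
    obtain ⟨i, j, hij, hne⟩ := hinj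
    exact hk (det_zero_of_row_eq hne (by ext l; simp [hij]))
  rw [h0, ← Finset.sum_fiberwise_of_maps_to
    (g := fun k : Fin n → ι => Finset.univ.image k)
    (t := Finset.univ.filter fun s : Finset ι => s.card = n), Finset.mul_sum]
  swap
  · intro k hk
    simp only [Finset.mem_filter, Finset.mem_univ, true_and] at hk ⊢
    rw [Finset.card_image_of_injective _ hk, Finset.card_univ, Fintype.card_fin]
  refine Finset.sum_congr rfl fun s hs => ?_
  have hs' : Fintype.card s = n := by simpa using hs
  have e : (Finset.univ.filter fun k : Fin n → ι => Function.Injective k).filter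
      (fun k => Finset.univ.image k = s) =
      (Finset.univ : Finset (Fin n ≃ s)).image fun e i => (e i : ι) := by
    ext k
    simp only [Finset.mem_filter, Finset.mem_univ, true_and, Finset.mem_image]
    constructor
    · rintro ⟨hk, rfl⟩
      refine ⟨Equiv.ofBijective
        (fun i => ⟨k i, Finset.mem_image_of_mem _ (Finset.mem_univ i)⟩) ⟨?_, ?_⟩, rfl⟩
      · exact fun i j hij => hk (congrArg Subtype.val hij)
      · rintro ⟨x, hx⟩
        obtain ⟨i, -, hi⟩ := Finset.mem_image.1 hx
        exact ⟨i, Subtype.ext hi⟩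
    · rintro ⟨e, rfl⟩
      refine ⟨Subtype.val_injective.comp e.injective, ?_⟩
      ext x
      simp only [Finset.mem_image, Finset.mem_univ, true_and]
      exact ⟨by rintro ⟨i, rfl⟩; exact (e i).2, fun hx => ⟨e.symm ⟨x, hx⟩, by simp⟩⟩
  rw [e, Finset.sum_image]
  · have hdet : ∀ e : Fin n ≃ s, (M.submatrix (fun i => (e i : ι)) fun i => (e i : ι)).det =
        (M.submatrix (Subtype.val : s → ι) Subtype.val).det := fun e =>
      det_submatrix_equiv_self e (M.submatrix (Subtype.val : s → ι) Subtype.val)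
    rw [Finset.sum_congr rfl fun e _ => hdet e, Finset.sum_const, Finset.card_univ,
      Fintype.card_equiv ((Fintype.equivFinOfCardEq hs').symm), Fintype.card_fin, nsmul_eq_mul]
  · intro e _ e' _ h
    ext i
    exact congrFun h i

/-- The expansion of `det (1 + z M)` in powers of `z`. -/
lemma det_one_add_smul_eq_tsum {ι : Type*} [Fintype ι] [DecidableEq ι] (M : Matrix ι ι ℝ) (z : ℝ) :
    HasSum (fun n : ℕ => z ^ n / n.factorial * ∑ k : Fin n → ι, (M.submatrix k k).det)
      (1 + z • M).det := by
  rw [det_one_add_smul_eq_sum, ← Finset.sum_fiberwise_of_maps_to (g := Finset.card)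
    (t := Finset.range (Fintype.card ι + 1))
    (fun s _ => Finset.mem_range_succ_iff.2 (Finset.card_le_univ s))]
  have e : ∀ n : ℕ, z ^ n / n.factorial * ∑ k : Fin n → ι, (M.submatrix k k).det =
      ∑ s : Finset ι with s.card = n,
        z ^ s.card * (M.submatrix (Subtype.val : s → ι) Subtype.val).det := by
    intro n
    rw [sum_det_submatrix, ← mul_assoc, div_mul_cancel₀ _ (by positivity), Finset.mul_sum]
    refine Finset.sum_congr rfl fun s hs => ?_
    rw [(Finset.mem_filter.1 hs).2]
  simp only [e]
  refine hasSum_sum_of_ne_finset_zero fun n hn => Finset.sum_eq_zero fun s hs => ?_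
  exact absurd (Finset.mem_range_succ_iff.2 ((Finset.mem_filter.1 hs).2 ▸ Finset.card_le_univ s)) hn

/-- A symmetric matrix `A` for which `1 + z A` is invertible for `0 < z ≤ Z` is such that
`1 + Z A` is positive definite. -/
lemma posDef_one_add_smul {ι : Type*} [Fintype ι] [DecidableEq ι] {A : Matrix ι ι ℝ}
    (hA : A.IsHermitian) {Z : ℝ} (hZ : 0 < Z) (h : ∀ z, 0 < z → z ≤ Z → (1 + z • A).det ≠ 0) :
    (1 + Z • A).PosDef := by
  have hH : (1 + Z • A).IsHermitian := by
    rw [IsHermitian, conjTranspose_add, conjTranspose_smul, hA.eq]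
    simp
  rw [hH.posDef_iff_eigenvalues_pos]
  intro i
  by_contra! hle
  have hv := hH.mulVec_eigenvectorBasis i
  set μ := hH.eigenvalues i
  have hne : (hH.eigenvectorBasis i).ofLp ≠ 0 := fun h0 =>
    hH.eigenvectorBasis.toBasis.ne_zero i (by ext j; simpa using congrFun h0 j)
  set v := (hH.eigenvectorBasis i).ofLp
  have h1 : 0 < 1 - μ := by linarith
  -- An eigenvalue μ ≤ 0 of 1 + ZA makes 1 + zA singular at z = Z/(1 - μ), which lies in (0, Z].
  refine h (Z / (1 - μ)) (by positivity) (div_le_self hZ.le (by linarith))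
    (exists_mulVec_eq_zero_iff.1 ⟨v, hne, ?_⟩)
  rw [add_mulVec, one_mulVec, smul_mulVec] at hv ⊢
  have hAv : Z • A *ᵥ v = (μ - 1) • v := by
    rw [sub_smul, one_smul, ← hv]; simp
  rw [div_eq_inv_mul, mul_smul, hAv, smul_smul]
  rw [show (1 - μ)⁻¹ * (μ - 1) = -1 by field_simp; ring]
  simp

end FredholmDeterminant

end LatticeMimicry

namespace LatticeMimicry

/-! ### Discretized Fredholm determinants. -/

section RiemannSums

open Matrix Filter Topology Pointwise

/-- Convergence of Riemann sums over the cube `[0, 1)ⁿ`. -/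
lemma tendsto_riemannSum {n : ℕ} {F : (Fin n → ℝ) → ℝ} (hF : Continuous F) :
    Tendsto (fun N : ℕ => (∑ k : Fin n → Fin N, F fun i => (k i : ℝ) / N) / (N : ℝ) ^ n) atTop
      (𝓝 (∫ t, F t ∂cubeMeasure n)) := by
  let s : Set (Fin n → ℝ) := Set.univ.pi fun _ => Set.Ico (0 : ℝ) 1
  have hs1 : Bornology.IsBounded s := Bornology.IsBounded.pi fun _ => Metric.isBounded_Ico 0 1
  have hs2 : MeasurableSet s := MeasurableSet.univ_pi fun _ => measurableSet_Ico
  have hs3 : volume (frontier s) = 0 := (convex_pi fun _ _ => convex_Ico 0 1).addHaar_frontier _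
  have h := tendsto_tsum_div_pow_atTop_integral s F hF hs1 hs2 hs3
  rw [cubeMeasure_eq_restrict]
  refine h.congr' ?_
  filter_upwards [eventually_gt_atTop 0] with N hN
  have : NeZero N := ⟨hN.ne'⟩
  have hN' : (0 : ℝ) < N := Nat.cast_pos.2 hN
  rw [Fintype.card_fin]
  congr 1
  let L := Submodule.span ℤ (Set.range (Pi.basisFun ℝ (Fin n)))
  have hmem : ∀ k : Fin n → Fin N, (fun i => (k i : ℝ) / N) ∈ s ∩ (N : ℝ)⁻¹ • (L : Set _) := by
    intro k
    refine ⟨fun i _ => ⟨by positivity, (div_lt_one hN').2 (Nat.cast_lt.2 (k i).2)⟩, ?_⟩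
    refine BoxIntegral.unitPartition.mem_smul_span_iff.2 fun i => ⟨(k i : ℕ), ?_⟩
    field_simp
    simp
  let e : (Fin n → Fin N) → ↑(s ∩ (N : ℝ)⁻¹ • (L : Set (Fin n → ℝ))) := fun k => ⟨_, hmem k⟩
  have he : Function.Bijective e := by
    constructor
    · intro k l hkl
      ext i
      have := congrFun (congrArg Subtype.val hkl) i
      simp only [e] at this
      rw [div_left_inj' hN'.ne'] at this
      exact_mod_cast this
    · rintro ⟨x, hx, hxL⟩
      have hxL' := BoxIntegral.unitPartition.mem_smul_span_iff.1 hxL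
      choose m hm using hxL'
      have hm' : ∀ i, (m i : ℝ) = N * x i := fun i => by simpa using hm i
      have h0 : ∀ i, 0 ≤ m i := fun i => by
        have := mul_nonneg hN'.le (hx i trivial).1
        rw [← hm'] at this
        exact_mod_cast this
      have h1 : ∀ i, m i < N := fun i => by
        have := mul_lt_mul_of_pos_left (hx i trivial).2 hN'
        rw [← hm', mul_one] at this
        exact_mod_cast this
      refine ⟨fun i => ⟨(m i).toNat, by have := h0 i; have := h1 i; omega⟩, Subtype.ext ?_⟩
      funext i
      simp only [e]
      rw [div_eq_iff hN'.ne', mul_comm, ← hm']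
      exact_mod_cast Int.toNat_of_nonneg (h0 i)
  rw [← (Equiv.ofBijective e he).tsum_eq, tsum_fintype]
  rfl

lemma summable_pow_div_sqrt_factorial (c : ℝ) (hc : 0 < c) :
    Summable fun n : ℕ => c ^ n / √(n.factorial : ℝ) := by
  refine summable_of_ratio_test_tendsto_lt_one (l := 0) one_pos
    (Eventually.of_forall fun n => by positivity) ?_
  have h : Tendsto (fun n : ℕ => c / √((n + 1 : ℕ) : ℝ)) atTop (𝓝 0) :=
    tendsto_const_nhds.div_atTop (Real.tendsto_sqrt_atTop.comp
      (tendsto_natCast_atTop_atTop.comp (tendsto_add_atTop_nat 1)))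
  refine h.congr fun n => ?_
  rw [Real.norm_of_nonneg (by positivity), Real.norm_of_nonneg (by positivity),
    Nat.factorial_succ, Nat.cast_mul, Real.sqrt_mul (Nat.cast_nonneg _), pow_succ]
  have : 0 < √(n.factorial : ℝ) := Real.sqrt_pos.2 (by positivity)
  have : 0 < √((n + 1 : ℕ) : ℝ) := Real.sqrt_pos.2 (by positivity)
  field_simp

/-- Since nⁿ ≤ eⁿ n!, the terms are at most (c√e)ⁿ/√(n!). This is the domination supplied by
Hadamard's inequality; the trivial bound n! on determinants would not suffice for large c. -/
lemma summable_pow_mul_sqrt_pow_div_factorial {c : ℝ} (hc : 0 < c) :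
    Summable fun n : ℕ => (c * √n) ^ n / n.factorial := by
  refine Summable.of_nonneg_of_le (fun n => by positivity) (fun n => ?_)
    (summable_pow_div_sqrt_factorial (c * √(Real.exp 1)) (by positivity))
  have hf : (0 : ℝ) < n.factorial := by positivity
  have h1 : (n : ℝ) ^ n ≤ Real.exp 1 ^ n * n.factorial := by
    rw [← Real.exp_nat_mul, mul_one, ← div_le_iff₀ hf]
    exact Real.pow_div_factorial_le_exp _ (Nat.cast_nonneg n) n
  have h2 : √(n : ℝ) ^ n ≤ √(Real.exp 1) ^ n * √(n.factorial : ℝ) := by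
    refine le_of_sq_le_sq ?_ (by positivity)
    rw [mul_pow, Real.sq_sqrt hf.le, ← pow_mul, ← pow_mul, mul_comm n 2, pow_mul, pow_mul,
      Real.sq_sqrt (Nat.cast_nonneg n), Real.sq_sqrt (Real.exp_pos 1).le]
    exact h1
  have hs : 0 < √(n.factorial : ℝ) := Real.sqrt_pos.2 hf
  rw [mul_pow, mul_pow, div_le_div_iff₀ hf hs]
  calc c ^ n * √(n : ℝ) ^ n * √(n.factorial : ℝ)
      ≤ c ^ n * (√(Real.exp 1) ^ n * √(n.factorial : ℝ)) * √(n.factorial : ℝ) := by gcongr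
    _ = c ^ n * √(Real.exp 1) ^ n * (√(n.factorial : ℝ) * √(n.factorial : ℝ)) := by ring
    _ = _ := by rw [Real.mul_self_sqrt hf.le]

/-- The kernel matrix of `ψ` on the uniform grid with `N` points. -/
noncomputable def gridMatrix (ψ : ℝ → ℝ) (N : ℕ) : Matrix (Fin N) (Fin N) ℝ :=
  of fun i j => (N : ℝ)⁻¹ * ψ ((i : ℝ) / N - (j : ℝ) / N)

variable {ψ : ℝ → ℝ}

lemma det_gridMatrix_submatrix (N n : ℕ) (k : Fin n → Fin N) :
    ((gridMatrix ψ N).submatrix k k).det =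
      (of fun i j : Fin n => ψ ((k i : ℝ) / N - (k j : ℝ) / N)).det / (N : ℝ) ^ n := by
  have : (gridMatrix ψ N).submatrix k k =
      (N : ℝ)⁻¹ • of fun i j : Fin n => ψ ((k i : ℝ) / N - (k j : ℝ) / N) := by
    ext i j; rfl
  rw [this, det_smul, Fintype.card_fin, inv_pow, div_eq_inv_mul]

/-- The coefficients of det(1 + zT_N) are Riemann sums converging to the nonnegative Fredholm
coefficients. So for large N the determinant is positive on all of (0, Z], and no eigenvalue can
have crossed zero. -/
lemma eventually_posDef_one_add_gridMatrix (hψ : Continuous ψ) (heven : ∀ t, ψ (-t) = ψ t)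
    {b : ℝ} (hb0 : 0 < b) (hb : ∀ t, |ψ t| ≤ b)
    (hD : ∀ n : ℕ, 1 ≤ n →
      0 ≤ ∫ t, (of fun i j : Fin n => ψ (t i - t j)).det ∂cubeMeasure n)
    {Z : ℝ} (hZ : 0 < Z) : ∀ᶠ N in atTop, (1 + Z • gridMatrix ψ N).PosDef := by
  let S : ℕ → ℕ → ℝ := fun N n => ∑ k : Fin n → Fin N, ((gridMatrix ψ N).submatrix k k).det
  have hS : ∀ n, Tendsto (fun N => S N n) atTop
      (𝓝 (∫ t, (of fun i j : Fin n => ψ (t i - t j)).det ∂cubeMeasure n)) := by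
    intro n
    have hF : Continuous fun t : Fin n → ℝ => (of fun i j : Fin n => ψ (t i - t j)).det := by
      refine Continuous.matrix_det (continuous_matrix fun i j => ?_)
      exact hψ.comp ((continuous_apply i).sub (continuous_apply j))
    refine (tendsto_riemannSum hF).congr fun N => ?_
    simp only [S, det_gridMatrix_submatrix, Finset.sum_div]
  have hbound : ∀ N n, |S N n| ≤ (b * √n) ^ n := by
    intro N n
    refine (Finset.abs_sum_le_sum_abs _ _).trans ?_
    rcases Nat.eq_zero_or_pos N with rfl | hN
    · rcases Nat.eq_zero_or_pos n with rfl | hn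
      · simp
      · have : IsEmpty (Fin n → Fin 0) := ⟨fun f => (f ⟨0, hn⟩).elim0⟩
        simp only [Finset.univ_eq_empty, Finset.sum_empty]
        positivity
    have hN' : (0 : ℝ) < N := Nat.cast_pos.2 hN
    refine (Finset.sum_le_card_nsmul _ _ ((b * √n) ^ n / (N : ℝ) ^ n) fun k _ => ?_).trans_eq ?_
    · rw [det_gridMatrix_submatrix, abs_div, abs_of_pos (pow_pos hN' n)]
      gcongr
      exact abs_det_le_pow _ fun i j => hb _
    · simp only [Finset.card_univ, Fintype.card_pi, Fintype.card_fin, Finset.prod_const,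
        nsmul_eq_mul, Nat.cast_pow]
      field_simp
  -- Only the negative parts of the coefficients can hurt. Each tends to 0 and Hadamard's bound
  -- dominates them; smallness at Z covers all z ≤ Z at once.
  have hlim : Tendsto (fun N => ∑' n : ℕ, Z ^ n / n.factorial * max (-S N n) 0) atTop
      (𝓝 (∑' _ : ℕ, (0 : ℝ))) := by
    refine tendsto_tsum_of_dominated_convergence
      (summable_pow_mul_sqrt_pow_div_factorial (mul_pos hZ hb0)) (fun n => ?_)
      (Eventually.of_forall fun N n => ?_)
    · rcases Nat.eq_zero_or_pos n with rfl | hn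
      · simp [S]
      · have := ((hS n).neg.max (tendsto_const_nhds (x := (0 : ℝ)))).const_mul (Z ^ n / n.factorial : ℝ)
        rwa [max_eq_right (neg_nonpos.2 (hD n hn)), mul_zero] at this
    · rw [Real.norm_of_nonneg (by positivity), mul_assoc Z, mul_pow Z, div_mul_eq_mul_div]
      gcongr
      exact max_le ((neg_le_abs _).trans (hbound N n)) (by positivity)
  rw [tsum_zero] at hlim
  filter_upwards [hlim.eventually (gt_mem_nhds one_pos)] with N hN
  have hsum : Summable fun n : ℕ => Z ^ n / n.factorial * max (-S N n) 0 := by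
    refine Summable.of_nonneg_of_le (fun n => by positivity) (fun n => ?_)
      (summable_pow_mul_sqrt_pow_div_factorial (mul_pos hZ hb0))
    rw [mul_assoc Z, mul_pow Z, div_mul_eq_mul_div]
    gcongr
    exact max_le ((neg_le_abs _).trans (hbound N n)) (by positivity)
  refine posDef_one_add_smul ?_ hZ fun z hz hzZ => ne_of_gt ?_
  · ext i j
    simp only [gridMatrix, conjTranspose_apply, of_apply, star_trivial]
    rw [← heven, neg_sub]
  · have h1 := det_one_add_smul_eq_tsum (gridMatrix ψ N) z
    have h2 : HasSum (fun n : ℕ => if n = 0 then (1 : ℝ) else 0) 1 := by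
      simpa using hasSum_ite_eq (0 : ℕ) (1 : ℝ)
    -- The constant term 1 outweighs the total of the negative parts, which is less than 1.
    have h3 := hasSum_le (fun n => ?_) (h2.sub hsum.hasSum) h1
    · linarith
    · rcases Nat.eq_zero_or_pos n with rfl | hn
      · simp [S]
      · rw [if_neg hn.ne', zero_sub, neg_le, ← mul_neg]
        refine (mul_le_mul_of_nonneg_left (le_max_left (-S N n) 0) (by positivity)).trans ?_
        gcongr

end RiemannSums

end LatticeMimicry

namespace LatticeMimicry

/-! ### Nonnegative Fredholm coefficients force positive definiteness. -/

section PositiveDefinite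

open Matrix Filter Topology

variable {ψ : ℝ → ℝ}

lemma integrable_cubeMeasure {n : ℕ} {f : (Fin n → ℝ) → ℝ} (hf : Continuous f) :
    Integrable f (cubeMeasure n) := by
  rw [cubeMeasure_eq_restrict]
  refine (hf.integrableOn_Icc (a := 0) (b := 1)).mono_set fun t ht => ?_
  exact ⟨fun i => (ht i trivial).1, fun i => (ht i trivial).2.le⟩

/-- Positivity of 1 + Z T_N, divided by N, gives G + Zq ≥ 0 in the limit, where G comes from the
identity and q is the integral in question. As Z is arbitrary, q ≥ 0. -/
lemma integral_quadratic_nonneg (hψ : Continuous ψ) (heven : ∀ t, ψ (-t) = ψ t)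
    {b : ℝ} (hb0 : 0 < b) (hb : ∀ t, |ψ t| ≤ b)
    (hD : ∀ n : ℕ, 1 ≤ n →
      0 ≤ ∫ t, (of fun i j : Fin n => ψ (t i - t j)).det ∂cubeMeasure n)
    {g : ℝ → ℝ} (hg : Continuous g) :
    0 ≤ ∫ t, g (t 0) * g (t 1) * ψ (t 0 - t 1) ∂cubeMeasure 2 := by
  set q := ∫ t, g (t 0) * g (t 1) * ψ (t 0 - t 1) ∂cubeMeasure 2 with hq
  set G := ∫ t, g (t 0) ^ 2 ∂cubeMeasure 1 with hG
  have h1 : Tendsto (fun N : ℕ => (∑ i : Fin N, g ((i : ℝ) / N) ^ 2) / N) atTop (𝓝 G) := by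
    have hF : Continuous fun t : Fin 1 → ℝ => g (t 0) ^ 2 := by fun_prop
    refine (tendsto_riemannSum hF).congr fun N => ?_
    rw [pow_one]
    congr 1
    exact (Equiv.funUnique (Fin 1) (Fin N)).sum_comp fun i => g ((i : ℝ) / N) ^ 2
  have h2 : Tendsto (fun N : ℕ => (∑ i : Fin N, ∑ j : Fin N,
      g ((i : ℝ) / N) * g ((j : ℝ) / N) * ψ ((i : ℝ) / N - (j : ℝ) / N)) / (N : ℝ) ^ 2) atTop
      (𝓝 q) := by
    have hF : Continuous fun t : Fin 2 → ℝ => g (t 0) * g (t 1) * ψ (t 0 - t 1) := by fun_prop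
    refine (tendsto_riemannSum hF).congr fun N => ?_
    congr 1
    rw [← Finset.sum_product', Finset.univ_product_univ]
    exact (finTwoArrowEquiv (Fin N)).sum_comp fun p : Fin N × Fin N =>
      g ((p.1 : ℝ) / N) * g ((p.2 : ℝ) / N) * ψ ((p.1 : ℝ) / N - (p.2 : ℝ) / N)
  have hZ : ∀ Z : ℝ, 0 < Z → 0 ≤ G + Z * q := by
    intro Z hZ
    refine ge_of_tendsto (h1.add (h2.const_mul Z)) ?_
    filter_upwards [eventually_posDef_one_add_gridMatrix hψ heven hb0 hb hD hZ,
      eventually_gt_atTop 0] with N hN hN0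
    have hN' : (0 : ℝ) < N := Nat.cast_pos.2 hN0
    let x : Fin N → ℝ := fun i => g ((i : ℝ) / N)
    have hx := hN.posSemidef.dotProduct_mulVec_nonneg x
    have e : star x ⬝ᵥ ((1 + Z • gridMatrix ψ N) *ᵥ x) = ∑ i : Fin N, g ((i : ℝ) / N) ^ 2 +
        Z * ((N : ℝ)⁻¹ * ∑ i : Fin N, ∑ j : Fin N,
          g ((i : ℝ) / N) * g ((j : ℝ) / N) * ψ ((i : ℝ) / N - (j : ℝ) / N)) := by
      rw [add_mulVec, one_mulVec, smul_mulVec, dotProduct_add, dotProduct_smul, star_trivial,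
        smul_eq_mul]
      congr 1
      · exact Finset.sum_congr rfl fun i _ => (pow_two _).symm
      · congr 1
        rw [dotProduct, Finset.mul_sum]
        refine Finset.sum_congr rfl fun i _ => ?_
        rw [mulVec, dotProduct, Finset.mul_sum, Finset.mul_sum]
        refine Finset.sum_congr rfl fun j _ => ?_
        simp only [gridMatrix, of_apply, x]
        ring
    rw [e] at hx
    have := div_nonneg hx hN'.le
    refine this.trans_eq ?_
    field_simp
  by_contra! hneg
  have hG0 : 0 ≤ G := integral_nonneg fun t => sq_nonneg _
  have := hZ ((G + 1) / (-q)) (div_pos (by linarith) (by linarith))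
  have h3 : (G + 1) / (-q) * q = -(G + 1) := by
    have : q ≠ 0 := hneg.ne
    field_simp
  linarith

/-- A continuous even function whose Fredholm coefficients are nonnegative is positive definite on
the points of the unit interval. -/
lemma sum_mul_kernel_nonneg (hψ : Continuous ψ) (heven : ∀ t, ψ (-t) = ψ t)
    (hψc : HasCompactSupport ψ)
    (hD : ∀ n : ℕ, 1 ≤ n →
      0 ≤ ∫ t, (of fun i j : Fin n => ψ (t i - t j)).det ∂cubeMeasure n)
    {ι : Type*} [Fintype ι] (c s : ι → ℝ) (hs : ∀ i, s i ∈ Set.Ioo (0 : ℝ) 1) :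
    0 ≤ ∑ i, ∑ j, c i * c j * ψ (s i - s j) := by
  obtain ⟨b, hb⟩ := hψ.bounded_above_of_compact_support hψc
  have hb0 : 0 < max b 1 := by positivity
  have hb' : ∀ t, |ψ t| ≤ max b 1 := fun t => (hb t).trans (le_max_left _ _)
  set C := ∑ i, ∑ j, |c i| * |c j| with hC
  have hC0 : 0 ≤ C := by positivity
  -- Here δ is the oscillation of ψ allowed when the points s i are smeared out.
  suffices h : ∀ δ : ℝ, 0 < δ → -(δ * C) ≤ ∑ i, ∑ j, c i * c j * ψ (s i - s j) by
    by_contra! hneg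
    have h1 := h (-(∑ i, ∑ j, c i * c j * ψ (s i - s j)) / (2 * (C + 1)))
      (div_pos (by linarith) (by linarith))
    set q := ∑ i, ∑ j, c i * c j * ψ (s i - s j)
    have h2 : -q / (2 * (C + 1)) * C ≤ -q / 2 := by
      rw [div_mul_eq_mul_div, div_le_div_iff₀ (by linarith) two_pos]
      nlinarith
    linarith
  intro δ hδ
  obtain ⟨ε, hε, hψε⟩ := Metric.uniformContinuous_iff.1
    (hψc.uniformContinuous_of_continuous hψ) δ hδ
  obtain ⟨r, hr, hrε, hrs⟩ : ∃ r : ℝ, 0 < r ∧ 2 * r ≤ ε ∧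
      ∀ i, Metric.ball (s i) r ⊆ Set.Ico (0 : ℝ) 1 := by
    have h1 : ∀ i, ∃ r : ℝ, 0 < r ∧ Metric.ball (s i) r ⊆ Set.Ioo (0 : ℝ) 1 := fun i =>
      Metric.isOpen_iff.1 isOpen_Ioo _ (hs i)
    choose ρ hρ hρs using h1
    have h2 : ∀ᶠ r in 𝓝[>] (0 : ℝ), ∀ i, r < ρ i :=
      eventually_all.2 fun i => nhdsWithin_le_nhds (gt_mem_nhds (hρ i))
    have h3 : ∀ᶠ r in 𝓝[>] (0 : ℝ), r < ε / 2 :=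
      nhdsWithin_le_nhds (gt_mem_nhds (by positivity))
    obtain ⟨r, hr, hr', hr0⟩ := (h2.and (h3.and self_mem_nhdsWithin)).exists
    exact ⟨r, hr0, by linarith, fun i =>
      (Metric.ball_subset_ball (hr i).le).trans ((hρs i).trans Set.Ioo_subset_Ico_self)⟩
  -- Normalized bumps stand for point masses at the s i. Their radius r has 2r ≤ ε, so differences
  -- of points in two bumps stay within ε of s i - s j.
  let β : ι → ℝ → ℝ := fun i =>
    (⟨r / 2, r, by positivity, by linarith⟩ : ContDiffBump (s i)).normed volume
  have hβc : ∀ i, Continuous (β i) := fun i => ContDiffBump.continuous_normed _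
  have hβ0 : ∀ i t, 0 ≤ β i t := fun i t => ContDiffBump.nonneg_normed _ t
  have hβs : ∀ i t, β i t ≠ 0 → t ∈ Metric.ball (s i) r := fun i t ht => by
    have h1 : t ∈ Function.support (β i) := ht
    rwa [ContDiffBump.support_normed_eq] at h1
  have hβi : ∀ i, ∫ t in Set.Ico (0 : ℝ) 1, β i t = 1 := fun i => by
    rw [setIntegral_eq_integral_of_forall_compl_eq_zero]
    · exact ContDiffBump.integral_normed _
    · intro t ht
      by_contra h0
      exact ht (hrs i (hβs i t h0))
  have hβint : ∀ i, Integrable (β i) (volume.restrict (Set.Ico (0 : ℝ) 1)) := fun i =>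
    (ContDiffBump.integrable_normed _).restrict
  have hprod : ∀ i j, Integrable (fun t : Fin 2 → ℝ => β i (t 0) * β j (t 1)) (cubeMeasure 2) ∧
      ∫ t, β i (t 0) * β j (t 1) ∂cubeMeasure 2 = 1 := by
    intro i j
    have h1 := Integrable.fintype_prod (μ := fun _ : Fin 2 => volume.restrict (Set.Ico (0 : ℝ) 1))
      (f := ![β i, β j]) (by intro k; fin_cases k; exacts [hβint i, hβint j])
    have h2 := integral_fintype_prod_eq_prod (𝕜 := ℝ)
      (μ := fun _ : Fin 2 => volume.restrict (Set.Ico (0 : ℝ) 1)) ![β i, β j]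
    simp only [Fin.prod_univ_two, Matrix.cons_val_zero, Matrix.cons_val_one, hβi, mul_one] at h1 h2
    exact ⟨h1, h2⟩
  let g : ℝ → ℝ := fun t => ∑ i, c i * β i t
  have hg : Continuous g := continuous_finsetSum _ fun i _ => (hβc i).const_mul _
  have hpos := integral_quadratic_nonneg hψ heven hb0 hb' hD hg
  have hle : ∀ t : Fin 2 → ℝ, g (t 0) * g (t 1) * ψ (t 0 - t 1) ≤
      ∑ i, ∑ j, (c i * c j * ψ (s i - s j) + δ * (|c i| * |c j|)) * (β i (t 0) * β j (t 1)) := by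
    intro t
    simp only [g]
    rw [Finset.sum_mul_sum, Finset.sum_mul]
    refine Finset.sum_le_sum fun i _ => ?_
    rw [Finset.sum_mul]
    refine Finset.sum_le_sum fun j _ => ?_
    rcases eq_or_ne (β i (t 0)) 0 with h0 | h0
    · simp [h0]
    rcases eq_or_ne (β j (t 1)) 0 with h1 | h1
    · simp [h1]
    have d0 := hβs i _ h0
    have d1 := hβs j _ h1
    rw [Metric.mem_ball, Real.dist_eq] at d0 d1
    have hd : dist (t 0 - t 1) (s i - s j) < ε := by
      rw [Real.dist_eq, show t 0 - t 1 - (s i - s j) = (t 0 - s i) - (t 1 - s j) by ring]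
      exact (abs_sub _ _).trans_lt (by linarith)
    have hψd := hψε hd
    rw [Real.dist_eq] at hψd
    have h3 : c i * c j * (ψ (t 0 - t 1) - ψ (s i - s j)) ≤ δ * (|c i| * |c j|) := by
      refine (le_abs_self _).trans ?_
      rw [abs_mul, abs_mul, mul_comm]
      gcongr
    have h4 : 0 ≤ β i (t 0) * β j (t 1) := mul_nonneg (hβ0 i _) (hβ0 j _)
    nlinarith [mul_le_mul_of_nonneg_right h3 h4]
  have hint : ∀ i j, Integrable (fun t : Fin 2 → ℝ =>
      (c i * c j * ψ (s i - s j) + δ * (|c i| * |c j|)) * (β i (t 0) * β j (t 1)))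
      (cubeMeasure 2) := fun i j => (hprod i j).1.const_mul _
  have hfinal : ∫ t : Fin 2 → ℝ, g (t 0) * g (t 1) * ψ (t 0 - t 1) ∂cubeMeasure 2 ≤
      ∑ i, ∑ j, (c i * c j * ψ (s i - s j) + δ * (|c i| * |c j|)) := by
    refine (integral_mono ?_ (integrable_finsetSum _ fun i _ =>
      integrable_finsetSum _ fun j _ => hint i j) hle).trans_eq ?_
    · exact integrable_cubeMeasure (by fun_prop)
    · rw [integral_finsetSum _ fun i _ => integrable_finsetSum _ fun j _ => hint i j]
      refine Finset.sum_congr rfl fun i _ => ?_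
      rw [integral_finsetSum _ fun j _ => hint i j]
      refine Finset.sum_congr rfl fun j _ => ?_
      rw [integral_const_mul, (hprod i j).2, mul_one]
  have e : ∑ i, ∑ j, (c i * c j * ψ (s i - s j) + δ * (|c i| * |c j|)) =
      (∑ i, ∑ j, c i * c j * ψ (s i - s j)) + δ * C := by
    simp only [Finset.sum_add_distrib, ← Finset.mul_sum, hC]
  linarith

end PositiveDefinite

end LatticeMimicry

open scoped SchwartzMap

namespace LatticeMimicry

/-! ### A kernel that resonates with the lattice. -/

section ResonantKernel

open Convolution

/-- A smooth even bump function with nonnegative Fourier transform. -/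
lemma exists_bump_fourierInv_nonneg {r : ℝ} (hr : 0 < r) :
    ∃ b : ℝ → ℝ, ContDiff ℝ (⊤ : ℕ∞) b ∧ (∀ x, b (-x) = b x) ∧ (∀ x, r ≤ |x| → b x = 0) ∧
      0 < b 0 ∧ ∀ x, ∃ y : ℝ, 0 ≤ y ∧ 𝓕⁻ (fun t => (b t : ℂ)) x = y := by
  let β : ContDiffBump (0 : ℝ) := ⟨r / 4, r / 2, by positivity, by linarith⟩
  have hβc : Continuous β := β.continuous
  have hβi : Integrable β := hβc.integrable_of_hasCompactSupport β.hasCompactSupport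
  have hβn : ∀ x, β (-x) = β x := β.neg
  have hβs : ∀ x, β x ≠ 0 → |x| < r / 2 := fun x hx => by
    have h1 : x ∈ Function.support β := hx
    rw [β.support_eq] at h1
    simpa using h1
  -- The self-convolution of an even real bump: its transform is the square of a real function.
  let b : ℝ → ℝ := (β : ℝ → ℝ) ⋆[ContinuousLinearMap.mul ℝ ℝ, volume] β
  have hb : ∀ x, b x = ∫ t, β t * β (x - t) := fun x => rfl
  refine ⟨b, ?_, ?_, ?_, ?_, ?_⟩
  · exact β.hasCompactSupport.contDiff_convolution_right _ hβc.locallyIntegrable β.contDiff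
  · intro x
    rw [hb, hb, ← integral_neg_eq_self]
    refine integral_congr_ae (Filter.Eventually.of_forall fun t => ?_)
    simp only
    rw [hβn, show -x - -t = -(x - t) by ring, hβn]
  · intro x hx
    rw [hb]
    refine integral_eq_zero_of_ae (Filter.Eventually.of_forall fun t => ?_)
    by_contra h0
    have h1 := hβs t (left_ne_zero_of_mul h0)
    have h2 := hβs (x - t) (right_ne_zero_of_mul h0)
    have := abs_add_le t (x - t)
    rw [add_sub_cancel] at this
    linarith
  · rw [hb]
    have e : ∀ t, β t * β (0 - t) = β t ^ 2 := fun t => by rw [zero_sub, hβn, pow_two]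
    simp only [e]
    have hc : Continuous fun t => β t ^ 2 := hβc.pow 2
    refine hc.integral_pos_of_hasCompactSupport_nonneg_nonzero ?_ (fun t => sq_nonneg _) (x := 0) ?_
    · exact β.hasCompactSupport.comp_left (g := fun y : ℝ => y ^ 2) (by simp)
    · rw [β.one_of_mem_closedBall (by simp [β.rIn_pos.le])]
      norm_num
  · intro x
    have hbc : (fun t => (b t : ℂ)) = (fun t => (β t : ℂ)) ⋆[ContinuousLinearMap.mul ℂ ℂ, volume]
        fun t => (β t : ℂ) := by
      funext x
      rw [hb, ← integral_complex_ofReal]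
      refine integral_congr_ae (Filter.Eventually.of_forall fun t => ?_)
      simp
    have him : ∀ w : ℝ, (𝓕 (fun t => (β t : ℂ)) w).im = 0 := by
      intro w
      rw [← Complex.conj_eq_iff_im, Real.fourier_eq', ← integral_conj, ← integral_neg_eq_self]
      refine integral_congr_ae (Filter.Eventually.of_forall fun t => ?_)
      simp only [smul_eq_mul, map_mul, Complex.conj_ofReal, ← Complex.exp_conj, Complex.conj_I,
        hβn, inner_neg_left]
      congr 2
      push_cast
      ring
    have hβic : Integrable fun t => (β t : ℂ) := hβi.ofReal
    rw [Real.fourierInv_eq_fourier_neg, hbc, Real.fourier_mul_convolution_eq hβic hβic]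
    refine ⟨(𝓕 (fun t => (β t : ℂ)) (-x)).re ^ 2, sq_nonneg _, ?_⟩
    rw [Complex.ofReal_pow, pow_two]
    congr 1 <;> exact Complex.ext (by simp) (by simpa using him (-x))

/-- The Dirichlet kernel with `2 m + 1` terms is nonnegative at the multiples of
`1 / (2 m + 1)`. -/
lemma sum_exp_div_nonneg (m : ℕ) (k : ℤ) : ∃ y : ℝ, 0 ≤ y ∧
    ∑ j ∈ Finset.range (2 * m + 1), Complex.exp
      ((2 * Real.pi * (((j : ℝ) - m) * k / (2 * m + 1)) : ℝ) * Complex.I) = y := by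
  let w : ℂ := Complex.exp ((2 * Real.pi * (k / (2 * m + 1)) : ℝ) * Complex.I)
  let v : ℂ := Complex.exp ((2 * Real.pi * (-(m * k : ℝ) / (2 * m + 1)) : ℝ) * Complex.I)
  have e : ∀ j : ℕ, Complex.exp
      ((2 * Real.pi * (((j : ℝ) - m) * k / (2 * m + 1)) : ℝ) * Complex.I) = v * w ^ j := by
    intro j
    rw [← Complex.exp_nat_mul, ← Complex.exp_add]
    congr 1
    push_cast
    ring
  have hq : (2 * m + 1 : ℂ) ≠ 0 := by exact_mod_cast Nat.succ_ne_zero (2 * m)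
  have hw : w ^ (2 * m + 1) = 1 := by
    rw [← Complex.exp_nat_mul, ← Complex.exp_int_mul_two_pi_mul_I k]
    congr 1
    push_cast
    field_simp
  simp only [e]
  rw [← Finset.mul_sum]
  -- As w is a (2m + 1)-th root of unity, the sum is 2m + 1 if w = 1 and 0 otherwise.
  by_cases h1 : w = 1
  · have hv : v = 1 := by
      have : v * w ^ m = 1 := by
        rw [← e]; simp
      simpa [h1] using this
    exact ⟨2 * m + 1, by positivity, by simp [h1, hv]⟩
  · refine ⟨0, le_rfl, ?_⟩
    rw [geom_sum_eq h1, hw]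
    simp

lemma fourierInv_shift (f : ℝ → ℂ) (c x : ℝ) :
    𝓕⁻ (fun ξ => f (ξ - c)) x = Complex.exp ((2 * Real.pi * (c * x) : ℝ) * Complex.I) * 𝓕⁻ f x := by
  rw [Real.fourierInv_eq', Real.fourierInv_eq', ← integral_const_mul,
    ← integral_add_right_eq_self _ c]
  congr 1
  funext ξ
  rw [add_sub_cancel_right, smul_eq_mul, smul_eq_mul, ← mul_assoc, ← Complex.exp_add]
  congr 2
  simp
  ring

/-- A kernel that is not positive definite on the unit interval, supported in
`[-1 / (2 a), 1 / (2 a)]`, whose Fourier transform is nonnegative on the lattice `aℤ`. -/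
lemma exists_resonant_kernel {a : ℝ} (ha : 1 / 2 < a) :
    ∃ ψ : ℝ → ℝ, ContDiff ℝ (⊤ : ℕ∞) ψ ∧ (∀ x, ψ (-x) = ψ x) ∧
      (∀ x, ψ x ≠ 0 → |x| ≤ 1 / (2 * a)) ∧
      (∀ k : ℤ, ∃ y : ℝ, 0 ≤ y ∧ 𝓕⁻ (fun t => (ψ t : ℂ)) (a * k) = y) ∧
      ∃ c s : Fin 3 → ℝ, (∀ i, s i ∈ Set.Ioo (0 : ℝ) 1) ∧
        ∑ i, ∑ j, c i * c j * ψ (s i - s j) < 0 := by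
  -- The second condition says (m + 1)h < 1 for the spacing h below; as a > 1/2, it holds for large
  -- m.
  obtain ⟨m, hm1, hm⟩ : ∃ m : ℕ, 1 ≤ m ∧ (m : ℝ) + 1 < a * (2 * m + 1) := by
    obtain ⟨m, hm⟩ := exists_nat_gt ((1 - a) / (2 * a - 1))
    refine ⟨m + 1, by omega, ?_⟩
    rw [div_lt_iff₀ (by linarith)] at hm
    push_cast
    nlinarith
  have ha0 : 0 < a := by linarith
  have hq : (0 : ℝ) < 2 * m + 1 := by positivity
  -- The spacing makes 2m + 1 bumps of radius h/2 fill exactly one period 1/a of the dual lattice,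
  -- that is, [-1/(2a), 1/(2a)]; at ak their phases form the Dirichlet sum evaluated above.
  set h : ℝ := 1 / ((2 * m + 1) * a) with hh
  have hh0 : 0 < h := by positivity
  have hha : h * a * (2 * m + 1) = 1 := by rw [hh]; field_simp
  obtain ⟨b, hbs, hbe, hbz, hb0, hbF⟩ := exists_bump_fourierInv_nonneg (half_pos hh0)
  let ψ : ℝ → ℝ := fun x => ∑ j ∈ Finset.range (2 * m + 1), b (x - ((j : ℝ) - m) * h)
  have hval : ∀ l : ℤ, ψ (l * h) = if -(m : ℤ) ≤ l ∧ l ≤ m then b 0 else 0 := by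
    intro l
    have hz : ∀ j : ℕ, (j : ℤ) - m ≠ l → b (l * h - ((j : ℝ) - m) * h) = 0 := by
      intro j hj
      refine hbz _ ?_
      rw [← sub_mul, abs_mul, abs_of_pos hh0]
      have : (1 : ℝ) ≤ |(l : ℝ) - ((j : ℝ) - m)| := by
        have h1 : (1 : ℤ) ≤ |l - (j - m)| := Int.one_le_abs (sub_ne_zero.2 hj.symm)
        exact_mod_cast h1
      nlinarith
    split_ifs with hl
    · have hlm : ((l + m).toNat : ℤ) = l + m := Int.toNat_of_nonneg (by omega)
      have hlm' : ((l + m).toNat : ℝ) = l + m := by exact_mod_cast hlm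
      refine (Finset.sum_eq_single_of_mem (l + m).toNat (Finset.mem_range.2 (by omega))
        fun j _ hj => hz j (by omega)).trans ?_
      rw [hlm']
      congr 1
      ring
    · exact Finset.sum_eq_zero fun j hj => hz j (by have := Finset.mem_range.1 hj; omega)
  refine ⟨ψ, ?_, ?_, ?_, ?_, ?_⟩
  · exact ContDiff.sum fun j _ => hbs.comp (contDiff_id.sub contDiff_const)
  · intro x
    refine (Finset.sum_range_reflect _ _).symm.trans (Finset.sum_congr rfl fun j hj => ?_)
    have hj' : j ≤ 2 * m := by have := Finset.mem_range.1 hj; omega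
    rw [← hbe]
    congr 1
    rw [show 2 * m + 1 - 1 - j = 2 * m - j by omega, Nat.cast_sub hj']
    push_cast
    ring
  · intro x hx
    obtain ⟨j, hj, hne⟩ := Finset.exists_ne_zero_of_sum_ne_zero hx
    have hj' : (j : ℝ) ≤ 2 * m := by
      have : j ≤ 2 * m := by have := Finset.mem_range.1 hj; omega
      exact_mod_cast this
    have h1 : |x - ((j : ℝ) - m) * h| < h / 2 := by
      by_contra! hle
      exact hne (hbz _ hle)
    have h2 : 1 / (2 * a) = (m + 1 / 2) * h := by rw [hh]; field_simp
    have h3 : |((j : ℝ) - m) * h| ≤ m * h := by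
      rw [abs_mul, abs_of_pos hh0]
      refine mul_le_mul_of_nonneg_right (abs_le.2 ⟨?_, by linarith⟩) hh0.le
      have : (0 : ℝ) ≤ j := Nat.cast_nonneg j
      linarith
    have h4 := abs_add_le (x - ((j : ℝ) - m) * h) (((j : ℝ) - m) * h)
    rw [sub_add_cancel] at h4
    rw [h2]
    linarith
  · intro k
    have hbi : ∀ c : ℝ, Integrable fun t => (b (t - c) : ℂ) := fun c => by
      have hbcs : HasCompactSupport b := HasCompactSupport.intro (isCompact_Icc (a := -h) (b := h))
        fun x hx => hbz x (by
          by_contra! hlt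
          have := abs_lt.1 hlt
          exact hx ⟨by linarith, by linarith⟩)
      exact ((hbs.continuous.integrable_of_hasCompactSupport hbcs).comp_sub_right c).ofReal
    have e : 𝓕⁻ (fun t => (ψ t : ℂ)) (a * k) = ∑ j ∈ Finset.range (2 * m + 1),
        𝓕⁻ (fun t => (b (t - ((j : ℝ) - m) * h) : ℂ)) (a * k) := by
      simp only [Real.fourierInv_eq', ψ]
      rw [← integral_finsetSum]
      · refine integral_congr_ae (Filter.Eventually.of_forall fun t => ?_)
        simp only [smul_eq_mul, Complex.ofReal_sum, Finset.mul_sum]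
      · intro j _
        refine (hbi _).bdd_mul (c := 1) (by fun_prop) (Filter.Eventually.of_forall fun t => ?_)
        rw [Complex.norm_exp_ofReal_mul_I]
    obtain ⟨y, hy, hy'⟩ := hbF (a * k)
    obtain ⟨d, hd, hd'⟩ := sum_exp_div_nonneg m k
    refine ⟨d * y, mul_nonneg hd hy, ?_⟩
    rw [e, Complex.ofReal_mul, ← hd', ← hy', Finset.sum_mul]
    refine Finset.sum_congr rfl fun j _ => ?_
    rw [fourierInv_shift (fun t => (b t : ℂ))]
    congr 5
    rw [hh]
    field_simp
  · have hspan : (m + 1) * h < 1 := by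
      rw [hh, mul_one_div, div_lt_one (by positivity)]
      linarith
    have hmh : 0 < m * h := by
      have : (0 : ℝ) < m := by exact_mod_cast hm1
      positivity
    let δ : ℝ := (1 - (m + 1) * h) / 2
    have hδ : 0 < δ := by simp only [δ]; linarith
    have hδ' : δ + (m + 1) * h < 1 := by simp only [δ]; linarith
    -- A positive definite ψ with ψ(h) = ψ(0) would have period h, contradicting ψ(mh) = b(0) and
    -- ψ((m + 1)h) = 0. At these three points the quadratic form equals -2 b(0).
    refine ⟨![1, -2, 1], ![δ, δ + h, δ + (m + 1) * h], ?_, ?_⟩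
    · intro i
      fin_cases i
      · exact ⟨hδ, by change δ < 1; nlinarith⟩
      · exact ⟨by change 0 < δ + h; linarith, by change δ + h < 1; nlinarith⟩
      · exact ⟨by change 0 < δ + (m + 1) * h; positivity, hδ'⟩
    · have v0 : ψ 0 = b 0 := by simpa using hval 0
      have v1 : ψ h = b 0 := by
        have := hval 1
        rw [if_pos (by omega)] at this
        simpa using this
      have v1' : ψ (-h) = b 0 := by
        have := hval (-1)
        rw [if_pos (by omega)] at this
        simpa using this
      have vm : ψ (m * h) = b 0 := by
        have := hval m
        rw [if_pos (by omega)] at this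
        simpa using this
      have vm' : ψ (-(m * h)) = b 0 := by
        have := hval (-m)
        rw [if_pos (by omega)] at this
        simpa using this
      have vq : ψ ((m + 1) * h) = 0 := by
        have := hval (m + 1)
        rw [if_neg (by omega)] at this
        simpa using this
      have vq' : ψ (-((m + 1) * h)) = 0 := by
        have := hval (-(m + 1))
        rw [if_neg (by omega)] at this
        rw [← this]
        congr 1
        push_cast
        ring
      simp only [Fin.sum_univ_three, Matrix.cons_val_zero, Matrix.cons_val_one, Matrix.cons_val]
      rw [show δ - (δ + h) = -h by ring, show δ - (δ + (m + 1) * h) = -((m + 1) * h) by ring,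
        show δ + h - δ = h by ring, show δ + h - (δ + (m + 1) * h) = -(m * h) by ring,
        show δ + (m + 1) * h - δ = (m + 1) * h by ring,
        show δ + (m + 1) * h - (δ + h) = m * h by ring]
      simp only [sub_self, v0, v1, v1', vm, vm', vq, vq']
      linarith

end ResonantKernel

end LatticeMimicry

open scoped SchwartzMap

namespace LatticeMimicry

/-! ### Non-mimicry for a > 1/2, by positivity. -/

section ResonanceObstruction

open Matrix

lemma fourierInv_prod {n : ℕ} (f : ℝ → ℂ) (x : EuclideanSpace ℝ (Fin n)) :
    𝓕⁻ (fun ξ : EuclideanSpace ℝ (Fin n) => ∏ i, f (ξ i)) x = ∏ i, 𝓕⁻ f (x i) := by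
  simp only [Real.fourierInv_eq']
  rw [← integral_fintype_prod_volume_eq_prod (𝕜 := ℂ),
    ← (PiLp.volume_preserving_toLp (Fin n)).integral_comp
      (MeasurableEquiv.toLp 2 (Fin n → ℝ)).measurableEmbedding]
  refine integral_congr_ae (Filter.Eventually.of_forall fun t => ?_)
  simp only [smul_eq_mul]
  rw [Finset.prod_mul_distrib, ← Complex.exp_sum, ← Finset.sum_mul]
  congr 3
  rw [PiLp.inner_apply, Finset.mul_sum, Complex.ofReal_sum]

/-- The mean of a distinct sum whose terms are nonnegative on the lattice is nonnegative. -/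
lemma integral_distinctSum_nonneg {n : ℕ} {a : ℝ} {Q : PointProcess} (hQ : SupportedOnLattice a Q)
    {f : EuclideanSpace ℝ (Fin n) → ℂ}
    (hf : ∀ k : Fin n → ℤ, ∃ y : ℝ, 0 ≤ y ∧ f (latticePoint a k) = y) :
    ∃ y : ℝ, 0 ≤ y ∧ ∫ c, c.distinctSum f ∂(Q : Measure Configuration) = y := by
  -- Truncation by `toNNReal` gives nonnegativity for every configuration. Integrability is not
  -- required, since the default value 0 of the integral is nonnegative.
  refine ⟨∫ c, ∑' s : Fin n ↪ c.Point, (f (WithLp.toLp 2 fun i => (s i).pos)).re.toNNReal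
    ∂(Q : Measure Configuration), integral_nonneg fun c => by positivity, ?_⟩
  rw [← integral_complex_ofReal]
  refine integral_congr_ae ?_
  filter_upwards [hQ] with c hc
  simp only [Complex.ofReal_tsum]
  refine tsum_congr fun s => ?_
  have hk : ∀ i, ∃ k : ℤ, (s i).pos = a * k := fun i =>
    hc _ fun h0 => absurd (lt_of_lt_of_eq (s i).2.2 h0) (Nat.not_lt_zero _)
  choose k hk using hk
  have e : (WithLp.toLp 2 fun i => (s i).pos) = latticePoint a k := by
    ext i
    exact hk i
  obtain ⟨y, hy, hfy⟩ := hf k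
  rw [e, hfy, Complex.ofReal_re, Real.coe_toNNReal _ hy]

theorem not_isMimickedOnLattice_of_half_lt {a B : ℝ} (ha : 1 / 2 < a) (hB : 1 / (2 * a) ≤ B)
    {P : PointProcess} (hP : IsSineProcess P) : ¬ IsMimickedOnLattice P a B := by
  rintro ⟨Q, -, hQ, -, -, hmim⟩
  obtain ⟨ψ, hψs, hψe, hψB, hψF, c, s, hs, hneg⟩ := exists_resonant_kernel ha
  have hψ : Continuous ψ := hψs.continuous
  have hψz : ∀ x, x ∉ Set.Icc (-B) B → ψ x = 0 := fun x hx => by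
    by_contra h0
    exact hx (abs_le.1 ((hψB x h0).trans hB))
  have hψc : HasCompactSupport ψ := HasCompactSupport.intro isCompact_Icc hψz
  -- It remains to show that the n-th Fredholm coefficient of ψ is nonnegative; this is mimicry
  -- tested on the n-th tensor power of ψ.
  refine hneg.not_ge (sum_mul_kernel_nonneg hψ hψe hψc (fun n hn => ?_) c s hs)
  let Ψ : EuclideanSpace ℝ (Fin n) → ℂ := fun ξ => ∏ i, (ψ (ξ i) : ℂ)
  have hΨz : ∀ ξ, Ψ ξ ≠ 0 → ∀ i, ξ i ∈ Set.Icc (-B) B := by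
    intro ξ hξ i
    by_contra hi
    exact hξ (Finset.prod_eq_zero (Finset.mem_univ i) (by rw [hψz _ hi, Complex.ofReal_zero]))
  have hΨs : ContDiff ℝ (⊤ : ℕ∞) Ψ := by
    refine contDiff_prod fun i _ => Complex.ofRealCLM.contDiff.comp (hψs.comp ?_)
    exact (EuclideanSpace.proj i : EuclideanSpace ℝ (Fin n) →L[ℝ] ℝ).contDiff
  have hΨc : HasCompactSupport Ψ := by
    refine HasCompactSupport.intro
      ((isCompact_univ_pi fun _ : Fin n => isCompact_Icc (a := -B) (b := B)).image
        (PiLp.continuous_toLp 2 _)) fun ξ hξ => ?_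
    by_contra h0
    exact hξ ⟨ξ.ofLp, fun i _ => hΨz ξ h0 i, rfl⟩
  obtain ⟨η, hηF, hη⟩ := exists_schwartz_fourier_eq hΨc hΨs
  obtain ⟨y, hy, hQy⟩ := integral_distinctSum_nonneg hQ (f := η) fun k => by
    choose z hz hz' using hψF
    refine ⟨∏ i, z (k i), Finset.prod_nonneg fun i _ => hz _, ?_⟩
    rw [hη, fourierInv_prod (fun t => (ψ t : ℂ)), Complex.ofReal_prod]
    exact Finset.prod_congr rfl fun i _ => by rw [latticePoint_apply, hz']
  rw [← hmim n hn η (by rw [hηF]; exact hΨz), hP.integral_distinctSum hn η.continuous η.integrable,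
    integral_mul_sineDet η.integrable, hηF] at hQy
  have hterm : ∀ σ : Equiv.Perm (Fin n), Continuous fun t : Fin n → ℝ =>
      ∏ i, ψ (t (σ i) - t i) := fun σ => continuous_finsetProd _ fun i _ =>
    hψ.comp ((continuous_apply _).sub (continuous_apply _))
  -- Reindexing by σ identifies the sampled values of the tensor power with the Leibniz terms of det
  -- [ψ(t_i - t_j)].
  have hperm : ∀ (σ : Equiv.Perm (Fin n)) (t : Fin n → ℝ),
      Ψ (-permFrequency σ t) = ((∏ i, ψ (t (σ i) - t i) : ℝ) : ℂ) := by
    intro σ t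
    rw [Complex.ofReal_prod]
    refine (Equiv.prod_comp σ _).symm.trans (Finset.prod_congr rfl fun i _ => ?_)
    rw [PiLp.neg_apply]
    simp [permFrequency]
  have hdet : ∫ t, (of fun i j : Fin n => ψ (t i - t j)).det ∂cubeMeasure n =
      ∑ σ : Equiv.Perm (Fin n), ((Equiv.Perm.sign σ : ℤ) : ℝ) *
        ∫ t, ∏ i, ψ (t (σ i) - t i) ∂cubeMeasure n := by
    simp only [det_apply', of_apply, ← integral_const_mul]
    exact integral_finsetSum _ fun σ _ => (integrable_cubeMeasure (hterm σ)).const_mul _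
  rw [hdet]
  simp only [hperm, integral_complex_ofReal] at hQy
  have : (∑ σ : Equiv.Perm (Fin n), ((Equiv.Perm.sign σ : ℤ) : ℝ) *
      ∫ t, ∏ i, ψ (t (σ i) - t i) ∂cubeMeasure n) = y := by exact_mod_cast hQy
  rwa [this]

end ResonanceObstruction

end LatticeMimicry

/-- Mimicry of the sine process by point processes supported on the lattice `aℤ`:
(i) for `0 < a ≤ 1` the discrete sine process on `aℤ` exists, has uniform local moments, and mimics
the sine process at every bandwidth `B ≤ (1 - a) / a`, so that the sine process is mimicked there;
(ii) for `0 < a ≤ 1 / 2` and `B > (1 - a) / a` it is not mimicked on `aℤ`;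
(iii) for `a > 1 / 2` and `B ≥ 1 / (2 a)` it is not mimicked on `aℤ`. -/
theorem mainTheorem1 :
    (∀ a : ℝ, 0 < a → a ≤ 1 →
      (∃ Q : LatticeMimicry.PointProcess, LatticeMimicry.IsDiscreteSineProcess a Q) ∧
      (∀ Q : LatticeMimicry.PointProcess, LatticeMimicry.IsDiscreteSineProcess a Q →
        LatticeMimicry.UniformLocalMoments Q ∧
        ∀ P : LatticeMimicry.PointProcess, LatticeMimicry.IsSineProcess P →
          ∀ B : ℝ, B ≤ (1 - a) / a → LatticeMimicry.Mimics Q P B) ∧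
      (∀ P : LatticeMimicry.PointProcess, LatticeMimicry.IsSineProcess P →
        ∀ B : ℝ, B ≤ (1 - a) / a → LatticeMimicry.IsMimickedOnLattice P a B)) ∧
    (∀ a B : ℝ, 0 < a → a ≤ 1 / 2 → (1 - a) / a < B →
      ∀ P : LatticeMimicry.PointProcess, LatticeMimicry.IsSineProcess P →
        ¬ LatticeMimicry.IsMimickedOnLattice P a B) ∧
    (∀ a B : ℝ, 1 / 2 < a → 1 / (2 * a) ≤ B →
      ∀ P : LatticeMimicry.PointProcess, LatticeMimicry.IsSineProcess P →
        ¬ LatticeMimicry.IsMimickedOnLattice P a B) := by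
  refine ⟨fun a h0 h1 => ⟨LatticeMimicry.exists_isDiscreteSineProcess h0 h1,
    fun Q hQ => ⟨hQ.uniformLocalMoments h0, fun P hP B hB => hQ.mimics h0 hB hP⟩,
    fun P hP B hB => ?_⟩,
    fun a B h0 h1 hB P hP => LatticeMimicry.not_isMimickedOnLattice_of_le_half h0 h1 hB hP,
    fun a B h0 hB P hP => LatticeMimicry.not_isMimickedOnLattice_of_half_lt h0 hB hP⟩
  obtain ⟨Q, hQ⟩ := LatticeMimicry.exists_isDiscreteSineProcess h0 h1
  exact ⟨Q, hQ.uniformLocalMoments h0, hQ.1, hQ.mimics h0 hB hP⟩
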